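/- Let $q\in\mathbb N$ and consider a $q$-spin system on the grid $\mathbb Z^2$ given by a field $b:[q]\to[0,\infty)$ and a symmetric matrix $A:[q]\times[q]\to[0,\infty)$: for a finite $G\subset\mathbb Z^2$ a configuration $\eta$ has weight $w_G(\eta)=\prod_{x\in G}b(\eta_x)\prod_{\{x,y\}}A(\eta_x,\eta_y)$, the second product being over the edges of $\mathbb Z^2$ inside $G$. For finite $W$ and a boundary condition $\tau$, let $\mu_W^{\tau}$ be the Gibbs distribution on $W$ given $\tau$ on the outer vertex boundary $\partial W$ (probabilities proportional to $w_{W\cup\partial W}$). A Gibbs measure is a probability measure $\mu$ on $[q]^{\mathbb Z^2}$ with $\mu(E)=\int\mu_W^{\omega}(E)\,\mu(d\omega)$ for all finite $W$ and measurable $E$. A partial configuration is feasible if it extends to a configuration of $\mathbb Z^2$ all of whose finite restrictions have positive weight. For a feasible partial configuration $\rho$, $\mu_v^{\rho}$ denotes the conditional law of the spin at $v$ given $\rho$; where it is used inside the algorithm it is a finite-volume quantity. Assume: (i) $A$ is soft: there are $\alpha>0$ and a spin $i$ with $b_i>0$ such that $A_{ij}>\alpha$ for all $j$. (ii) Set weak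 spatial mixing with exponential rate: there are $C,\gamma>0$ such that for all $W\subset\mathbb Z^2$ with finite complement $D$, all $U\subset D$, and all feasible $\tau^1\ne\tau^2$ in $[q]^W$, the marginals on $U$ of $\mu_D^{\tau^1}$ and $\mu_D^{\tau^2}$ have total variation distance at most $\sum_{u\in U,\,w\in W}Ce^{-\gamma d(u,w)}$, where $d$ is the graph distance. For $L\ge1$ let the $L$-mesh $\Gamma$ be the set of $(i,j)\in\mathbb Z^2$ with $L\mid i$ or $L\mid j$. For $v=(i,j)\in\Gamma$ let $k,\ell$ be the multiples of $L$ with $k+\frac L2\le i<k+\frac{3L}2$ and $\ell+\frac L2\le j<\ell+\frac{3L}2$, and put $\Gamma_v=\partial\{(k+a,\ell+b'):0<a,b'<2L\}$. The algorithm LAZY is called with a finite $\Lambda\subset\Gamma$, a feasible $\sigma\in[q]^\Lambda$ and $v\in\Gamma\setminus\Lambda$. It computes $p^i=\min_\tau\mu_v^{\sigma\oplus\tau}(i)$, $i\in[q]$, the minimum being over the $\tau\in[q]^{\Gamma_v\setminus\Lambda}$ for which $\sigma\oplus\tau$ is feasible, and draws a fresh $y$ uniformly from $[0,1]$. If $y\in[\sum_{j<i}p^j,\sum_{j\le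 i}p^j)$ for some $i$, it returns $\sigma\oplus(v,i)$. Otherwise it lists $\Gamma_v\setminus\Lambda$ in an arbitrary order, calls LAZY on these vertices in turn, each time given $\sigma$ and the spins already found, and so obtains a configuration $\sigma'$ on $\Lambda\cup\Gamma_v$; with $\rho^i=\mu_v^{\sigma'}(i)-p^i$ it returns $\sigma\oplus(v,i)$ for the $i$ with $y\in[\sum_jp^j+\sum_{j<i}\rho^j,\ \sum_jp^j+\sum_{j\le i}\rho^j)$. Then there is exactly one Gibbs measure $\mu$, and there is $L_0$ such that for every $L>L_0$ there is a constant $K<\infty$ for which the following hold, for every choice of the orders. (1) For all finite $\Lambda\subset\Gamma$, feasible $\sigma\in[q]^\Lambda$ and $v\in\Gamma\setminus\Lambda$, LAZY called on $((\Lambda,\sigma),v)$ terminates with probability $1$, returns $\sigma\oplus(v,i)$ with probability exactly $\mu(\eta_v=i\mid\eta_\Lambda=\sigma)$ for every $i\in[q]$, and makes in expectation at most $K$ calls of LAZY in total (recursive calls included). (2) Let $U\subset\mathbb Z^2$ be finite. Starting from the empty configuration, call LAZY successively, in any order, on the vertices of $U\cap\Gamma$ and of the boundaries of the $L\times L$ mesh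 squares that contain the vertices of $U\setminus\Gamma$, each time given the spins found before. Then sample the interiors of these mesh squares from the finite Gibbs distribution with the resulting boundary condition. The calls of LAZY terminate with probability $1$, the spins obtained on $U$ have exactly the law $\mu_U$ (the marginal of $\mu$ on $U$), and the expected total number of calls of LAZY is at most $K|U|$. -/

import Mathlib

open MeasureTheory ProbabilityTheory
open scoped NNReal ENNReal

noncomputable section

namespace LazySampling

/-! ### The square lattice -/

abbrev Site : Type := ℤ × ℤ

/-- The graph distance of the grid `ℤ²`, i.e. the `ℓ¹` distance (see `gridGraph_dist`). -/
def gridDist (u v : Site) : ℕ := (u.1 - v.1).natAbs + (u.2 - v.2).natAbs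

/-- The two-dimensional grid as a graph. -/
def gridGraph : SimpleGraph Site where
  Adj u v := gridDist u v = 1
  symm := ⟨fun u v h => by simp only [gridDist] at *; omega⟩
  loopless := ⟨fun u h => by simp [gridDist] at h⟩

lemma gridGraph_adj {u v : Site} : gridGraph.Adj u v ↔ gridDist u v = 1 := Iff.rfl

lemma gridDist_le_length {u v : Site} (p : gridGraph.Walk u v) : gridDist u v ≤ p.length := by
  induction p with
  | nil => simp [gridDist]
  | cons h p ih =>
    rw [gridGraph_adj] at h
    simp only [gridDist, SimpleGraph.Walk.length_cons] at *
    omega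

lemma exists_walk (n : ℕ) : ∀ u v : Site, gridDist u v = n →
    ∃ p : gridGraph.Walk u v, p.length = n := by
  induction n with
  | zero =>
    intro u v h
    have : u = v := by
      simp only [gridDist] at h
      ext <;> omega
    subst this
    exact ⟨.nil, rfl⟩
  | succ n ih =>
    intro u v h
    have : ∃ w : Site, gridDist u w = 1 ∧ gridDist w v = n := by
      simp only [gridDist] at h ⊢
      rcases lt_trichotomy u.1 v.1 with h1 | h1 | h1
      · exact ⟨(u.1 + 1, u.2), by simp only; omega, by simp only; omega⟩
      · rcases lt_trichotomy u.2 v.2 with h2 | h2 | h2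
        · exact ⟨(u.1, u.2 + 1), by simp only; omega, by simp only; omega⟩
        · omega
        · exact ⟨(u.1, u.2 - 1), by simp only; omega, by simp only; omega⟩
      · exact ⟨(u.1 - 1, u.2), by simp only; omega, by simp only; omega⟩
    obtain ⟨w, hw, hv⟩ := this
    obtain ⟨p, hp⟩ := ih w v hv
    exact ⟨.cons (gridGraph_adj.2 hw) p, by simp [hp]⟩

theorem gridGraph_dist (u v : Site) : gridGraph.dist u v = gridDist u v := by
  obtain ⟨p, hp⟩ := exists_walk _ u v rfl
  refine le_antisymm (hp ▸ SimpleGraph.dist_le p) ?_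
  obtain ⟨p', hp'⟩ := (SimpleGraph.Walk.reachable p).exists_walk_length_eq_dist
  exact hp' ▸ gridDist_le_length p'

def neighbours (x : Site) : Finset Site :=
  {x + (1, 0), x + (-1, 0), x + (0, 1), x + (0, -1)}

/-- The outer vertex boundary `∂W` of a finite set of sites. -/
def boundary (W : Finset Site) : Finset Site := W.biUnion neighbours \ W

theorem mem_boundary {W : Finset Site} {v : Site} :
    v ∈ boundary W ↔ v ∉ W ∧ ∃ u ∈ W, gridGraph.Adj u v := by
  have key : ∀ u : Site, v ∈ neighbours u ↔ gridGraph.Adj u v := by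
    intro u
    rw [gridGraph_adj]
    simp only [neighbours, gridDist, Finset.mem_insert, Finset.mem_singleton, Prod.ext_iff,
      Prod.fst_add, Prod.snd_add]
    omega
  simp only [boundary, Finset.mem_sdiff, Finset.mem_biUnion, key]
  exact and_comm

/-! ### Spin systems on the grid -/

/-- Configurations on `ℤ²`. A partial configuration `(Λ, σ)` is a set `Λ` of sites with a
`σ : Conf q`, of which only the values on `Λ` are looked at. -/
abbrev Conf (q : ℕ) : Type := Site → Fin q

/-- A `q`-spin system on `ℤ²`: a field `b` and a symmetric interaction matrix `A`,
both with non-negative entries. -/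
structure SpinSystem (q : ℕ) where
  b : Fin q → ℝ
  A : Matrix (Fin q) (Fin q) ℝ
  symm : A.IsSymm
  b_nonneg : ∀ i, 0 ≤ b i
  A_nonneg : ∀ i j, 0 ≤ A i j

/-- The configuration that equals `ξ` on `W` and `ω` off `W`. -/
def glue {q : ℕ} (W : Finset Site) (ξ : W → Fin q) (ω : Conf q) : Conf q :=
  fun x => if h : x ∈ W then ξ ⟨x, h⟩ else ω x

namespace SpinSystem

variable {q : ℕ} (S : SpinSystem q)

/-- The interaction matrix has a row that is bounded below by a positive constant
(the row of a spin of positive field weight). -/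
def IsSoft : Prop := ∃ α : ℝ, 0 < α ∧ ∃ i, 0 < S.b i ∧ ∀ j, α < S.A i j

/-- The Gibbs weight of `η` on the subgraph of `ℤ²` induced by the finite set `G`. Each edge
occurs once, from its lower or left end point `x` to its other end point `y`. -/
def weight (G : Finset Site) (η : Conf q) : ℝ :=
  (∏ x ∈ G, S.b (η x)) *
    ∏ x ∈ G, ∏ y ∈ G with y = x + (1, 0) ∨ y = x + (0, 1), S.A (η x) (η y)

/-- `(Λ, τ)` is feasible: it extends to a configuration on `ℤ²` of which every finite part
has positive weight. -/
def Feasible (Λ : Set Site) (τ : Conf q) : Prop :=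
  ∃ η : Conf q, (∀ x ∈ Λ, η x = τ x) ∧ ∀ G : Finset Site, 0 < S.weight G η

/-- The specification: the probability of the event `E` for the Gibbs distribution on the
finite set `W` with the boundary condition `ω` off `W`. It is computed on the finite graph
`W ∪ ∂W`, conditioned on the values of `ω` on `∂W`. -/
def spec (W : Finset Site) (ω : Conf q) (E : Set (Conf q)) : ℝ :=
  (∑ ξ : W → Fin q, E.indicator (S.weight (W ∪ boundary W)) (glue W ξ ω)) /
    ∑ ξ : W → Fin q, S.weight (W ∪ boundary W) (glue W ξ ω)

/-- An infinite-volume Gibbs measure: a probability measure `μ` on configurations that is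
consistent with the specification, `μ π_W = μ` for every finite `W`. -/
def IsGibbs (μ : Measure (Conf q)) : Prop :=
  IsProbabilityMeasure μ ∧ ∀ (W : Finset Site) (E : Set (Conf q)), MeasurableSet E →
    μ E = ∫⁻ ω, ENNReal.ofReal (S.spec W ω E) ∂μ

/-- Total variation distance between the marginals on `U` of the Gibbs distributions on `D`
with boundary conditions `τ₁` and `τ₂`. -/
def tvDist (D U : Finset Site) (τ₁ τ₂ : Conf q) : ℝ :=
  (1 / 2) * ∑ ξ : U → Fin q,
    |S.spec D τ₁ {η | ∀ x : U, η x = ξ x} - S.spec D τ₂ {η | ∀ x : U, η x = ξ x}|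

/-- Set weak spatial mixing with rate `f`. Here `D` is the complement of the set `W` on which
the boundary conditions live. -/
def SetWeakSpatialMixing (f : ℕ → ℝ) : Prop :=
  ∀ (D U : Finset Site), U ⊆ D → ∀ τ₁ τ₂ : Conf q,
    S.Feasible {w | w ∉ D} τ₁ → S.Feasible {w | w ∉ D} τ₂ → (∃ w, w ∉ D ∧ τ₁ w ≠ τ₂ w) →
    ENNReal.ofReal (S.tvDist D U τ₁ τ₂) ≤
      ∑ u ∈ U, ∑' w : {w : Site // w ∉ D}, ENNReal.ofReal (f (gridDist u w))

/-- Set weak spatial mixing with exponential rate. -/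
def ExpWeakSpatialMixing : Prop :=
  ∃ C γ : ℝ, 0 < C ∧ 0 < γ ∧ S.SetWeakSpatialMixing fun n => C * Real.exp (-γ * n)

end SpinSystem

/-! ### The mesh -/

/-- The vertex set of the `L`-mesh `Γ`. -/
def mesh (L : ℕ) : Set Site := {v | (L : ℤ) ∣ v.1 ∨ (L : ℤ) ∣ v.2}

/-- The sites strictly inside the square with lower left corner `c` and side length `n`. -/
def openSquare (c : Site) (n : ℤ) : Finset Site :=
  Finset.Ioo c.1 (c.1 + n) ×ˢ Finset.Ioo c.2 (c.2 + n)

/-- The multiple `k` of `L` with `k + L/2 ≤ i < k + 3L/2`. -/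
def corner (L : ℕ) (i : ℤ) : ℤ := L * ((2 * i - L) / (2 * L))

theorem corner_spec {L : ℕ} (hL : 0 < L) (i : ℤ) :
    (L : ℤ) ∣ corner L i ∧ 2 * corner L i + L ≤ 2 * i ∧ 2 * i < 2 * corner L i + 3 * L := by
  have hL' : (0 : ℤ) < 2 * L := by omega
  have h1 := Int.mul_ediv_add_emod (2 * i - L) (2 * L)
  have h2 := Int.emod_nonneg (2 * i - L) hL'.ne'
  have h3 := Int.emod_lt_of_pos (2 * i - L) hL'
  have h4 : 2 * (L : ℤ) * ((2 * i - L) / (2 * L)) = 2 * corner L i := by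
    rw [corner, mul_assoc]
  refine ⟨Dvd.intro _ rfl, ?_, ?_⟩ <;> omega

/-- The sites strictly inside the square of side length `2L` around `v`. -/
def inner (L : ℕ) (v : Site) : Finset Site :=
  openSquare (corner L v.1, corner L v.2) (2 * L)

/-- The square `Γ_v`. -/
def ring (L : ℕ) (v : Site) : Finset Site := boundary (inner L v)

/-! ### The algorithm -/

/-- The state of the computation: the known sites `Λ`, the configuration `σ` on them, and the
number of calls of LAZY made so far. -/
structure State (q : ℕ) where
  known : Finset Site
  spin : Conf q
  calls : ℕ

section Algorithm

variable {q : ℕ} (S : SpinSystem q) (L : ℕ)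

/-- `μ_v^{(Λ ∪ Γ_v, τ)}(i)`. The component of `v` off `Λ ∪ Γ_v` lies inside `Γ_v`, so the finite
set `inner L v \ Λ` determines it. -/
def condMarginal (Λ : Finset Site) (τ : Conf q) (v : Site) (i : Fin q) : ℝ :=
  S.spec (inner L v \ Λ) τ {η | η v = i}

/-- `p_v^i`: the minimum of `μ_v^{σ ⊕ τ}(i)` over the configurations `τ` on `Γ_v \ Λ` for which
`σ ⊕ τ` is feasible (it ranges over finitely many values). -/
def pMin (Λ : Finset Site) (σ : Conf q) (v : Site) (i : Fin q) : ℝ :=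
  ⨅ τ : {τ : Conf q // (∀ x ∈ Λ, τ x = σ x) ∧
      S.Feasible ((Λ ∪ ring L v : Finset Site) : Set Site) τ},
    condMarginal S L Λ τ v i

/-- Search, in order, for the spin `i` with `y ∈ [a + ∑_{j < i} r j, a + ∑_{j ≤ i} r j)`. -/
def pick (a : ℝ) (r : Fin q → ℝ) (y : ℝ) : Option (Fin q) :=
  (List.finRange q).find? fun i =>
    decide (a + ∑ j ∈ Finset.Iio i, r j ≤ y ∧ y < a + ∑ j ∈ Finset.Iic i, r j)

/-- `ord Λ σ v` lists the sites of `Γ_v \ Λ`, each once. -/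
def IsOrdering (ord : Finset Site → Conf q → Site → List Site) : Prop :=
  ∀ Λ σ v, (ord Λ σ v).Nodup ∧ (ord Λ σ v).toFinset = ring L v \ Λ

/-- BD-CALC: call `call` (which stands for LAZY) on the sites of `Γ_v \ Λ` in turn, each time
with the spins found so far, and determine the spin at `v` from the result and from `y`. The
current state is `s`; in the output, only `v` is added to the known sites. -/
def bdCalc (ord : Finset Site → Conf q → Site → List Site)
    (call : State q → Site → Option (State q)) (s : State q) (v : Site) (p : Fin q → ℝ) (y : ℝ) :
    Option (State q) :=
  ((ord s.known s.spin v).foldlM call s).bind fun s' =>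
    (pick (∑ j, p j) (fun i => condMarginal S L s'.known s'.spin v i - p i) y).map fun i =>
      ⟨insert v s.known, Function.update s.spin v i, s'.calls⟩

/-- LAZY on the random tape `y`, with recursion depth at most the first numerical argument
(`none` if this depth is exceeded). Each call draws exactly one uniform variable, so the call
that finds the counter at `s.calls` reads `y s.calls` and increases the counter by one. -/
def lazyDepth (ord : Finset Site → Conf q → Site → List Site) (y : ℕ → unitInterval) :
    ℕ → State q → Site → Option (State q)
  | 0, _, _ => none
  | n + 1, s, v =>
    let p := pMin S L s.known s.spin v
    match pick 0 p (y s.calls) with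
    | some i => some ⟨insert v s.known, Function.update s.spin v i, s.calls + 1⟩
    | none => bdCalc S L ord (lazyDepth ord y n) ⟨s.known, s.spin, s.calls + 1⟩ v p (y s.calls)

/-- On the tape `y`, LAZY called in state `s` on `v` halts and returns the state `s'`. -/
def LazyReturns (ord : Finset Site → Conf q → Site → List Site) (y : ℕ → unitInterval)
    (s : State q) (v : Site) (s' : State q) : Prop :=
  ∃ n, lazyDepth S L ord y n s v = some s'

/-- LAZY called on the sites of the list `ws` in turn, starting in state `s`, halts and
returns the state `s'`. -/
def LazyListReturns (ord : Finset Site → Conf q → Site → List Site) (y : ℕ → unitInterval)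
    (s : State q) (ws : List Site) (s' : State q) : Prop :=
  ∃ n, ws.foldlM (lazyDepth S L ord y n) s = some s'

/-- The number of calls made by a computation whose final states are the `s` with `R s`
(there is at most one); it is `∞` if the computation does not halt. -/
def callCount (R : State q → Prop) : ℝ≥0∞ := ⨅ (s : State q) (_ : R s), (s.calls : ℝ≥0∞)

/-- A sequence of independent uniform random variables on `[0, 1]`. -/
def tape : Measure (ℕ → unitInterval) := Measure.infinitePi fun _ => volume

/-! ### Sampling a window, also off the mesh -/

/-- The sites strictly inside the mesh squares (of side length `L`) that contain the sites of `U`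
lying off the mesh. -/
def cellInteriors (U : Finset Site) : Finset Site :=
  open Classical in
  {v ∈ U | v ∉ mesh L}.biUnion fun v => openSquare (L * (v.1 / L), L * (v.2 / L)) L

/-- The mesh sites on which LAZY is called to sample the window `U`: those in `U`, and the
boundaries of the mesh squares that contain the other sites of `U`. -/
def meshSupport (U : Finset Site) : Finset Site :=
  open Classical in
  {v ∈ U | v ∈ mesh L} ∪
    {v ∈ U | v ∉ mesh L}.biUnion fun v => boundary (openSquare (L * (v.1 / L), L * (v.2 / L)) L)

/-- Given the tape `y`, the probability that the window sampler outputs a configuration that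
agrees with `ξ` on `U`: LAZY determines the spins on `ws`, then the insides of the mesh squares
are drawn from the Gibbs distribution with this boundary condition. It is `0` if the calls of LAZY
do not halt. -/
def windowProb (ord : Finset Site → Conf q → Site → List Site) (U : Finset Site)
    (s : State q) (ws : List Site) (ξ : Conf q) (y : ℕ → unitInterval) : ℝ≥0∞ :=
  ⨆ (s' : State q) (_ : LazyListReturns S L ord y s ws s'),
    ENNReal.ofReal (S.spec (cellInteriors L U) s'.spin {η | ∀ x ∈ U, η x = ξ x})

end Algorithm

end LazySampling

end

/-! Existence and uniqueness of `μ`. The soft spin `s₀` is compatible with every spin, so the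
constant configuration `s₀` has positive weight, and a limit point of the finite-volume
distributions with this boundary condition is a Gibbs measure (`exists_isGibbs`). Under the mixing
hypothesis the influence of the complement of a growing volume on a fixed window tends to zero, so
any two Gibbs measures agree (`ExpWeakSpatialMixing.gibbs_unique`).

Decoupling on the mesh. The mixing bound charges every site that carries a boundary condition,
including the sites of `Λ` where both conditions agree, so it is useless close to `Λ`. But within
distance `L/2` of `v` the set `Λ` lies on one vertical and one horizontal line. Only boundedly many
sites of a sphere around `v` are within a constant distance `k` of these lines. With probability
bounded below they all carry `s₀` (finite energy), and on the rest of the sphere the mixing bound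
gives total variation distance at most `1/2`. Hence each sphere multiplies the influence of the far
boundary condition by some `ρ < 1` (`expect_sub_le_of_layer`), and about `√L/2` spheres with spacing
about `√L` fit around `v` (`abs_expect_ball_sub_le`). So `1 - ∑ p^i` is at most `q ρ^n` with `n` of
order `√L`, which beats `|Γ_v| = O(L²)`: for large `L` a call makes on average at most `1/2` direct
recursive calls (`exists_scale`).

Analysis of LAZY. The recursion is truncated at depth `n`, and everything is weighted by `μ(cyl Λ
σ)`, which makes infeasible configurations disappear. By induction on `n` the output law of the
truncated algorithm is dominated by the conditional law under `μ` (`isSampler_lazyDepth`): the quick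
branch contributes `p^i`, the slow branch `μ_v^η(i) - p^i` averaged over the spins `η` on `Γ_v`, and
these add up by the law of total probability. If exceeding the depth is charged `t`, subcriticality
bounds the expected cost of a call by `2 + t 2^{-n}` (`lazyDepth_cost_le`). With `t = 2^n` and
Markov's inequality this gives termination, with `t = 0` the bound on the number of calls. Once the
algorithm halts almost surely its output law has full mass, so the domination is an equality
(`lintegral_iSup_lazyListReturns`). The window sampler is then exact because `μ` is consistent with
the specification on the interiors of the mesh squares. -/

open Function (update)

namespace LazySampling

variable {q : ℕ}

/-! ### Sums over the configurations on a finite set -/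

lemma glue_of_mem {W : Finset Site} {ξ : W → Fin q} {ω : Conf q} {x : Site} (h : x ∈ W) :
    glue W ξ ω x = ξ ⟨x, h⟩ := by simp [glue, h]

lemma glue_of_notMem {W : Finset Site} {ξ : W → Fin q} {ω : Conf q} {x : Site} (h : x ∉ W) :
    glue W ξ ω x = ω x := by simp [glue, h]

lemma glue_restrict (W : Finset Site) (ω : Conf q) : glue W (fun x => ω x) ω = ω := by
  funext x; by_cases h : x ∈ W <;> simp [glue, h]

lemma glue_congr {W : Finset Site} (ξ : W → Fin q) {ω ω' : Conf q} (h : ∀ x ∉ W, ω x = ω' x) :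
    glue W ξ ω = glue W ξ ω' := by
  funext x; by_cases hx : x ∈ W <;> simp [glue, hx]
  exact h x hx

section SumOver

variable {M : Type*} [AddCommMonoid M]

/-- The sum of `f` over all configurations that agree with `ω` off `W`. -/
def sumOver (W : Finset Site) (f : Conf q → M) (ω : Conf q) : M :=
  ∑ ξ : W → Fin q, f (glue W ξ ω)

lemma sumOver_congr {W : Finset Site} {f g : Conf q → M} {ω : Conf q}
    (h : ∀ η : Conf q, (∀ x ∉ W, η x = ω x) → f η = g η) : sumOver W f ω = sumOver W g ω :=
  Finset.sum_congr rfl fun _ _ => h _ fun _ hx => glue_of_notMem hx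

lemma sumOver_congr_off {W : Finset Site} (f : Conf q → M) {ω ω' : Conf q}
    (h : ∀ x ∉ W, ω x = ω' x) : sumOver W f ω = sumOver W f ω' :=
  Finset.sum_congr rfl fun ξ _ => by rw [glue_congr ξ h]

lemma sumOver_empty (f : Conf q → M) (ω : Conf q) : sumOver ∅ f ω = f ω := by
  have : ∀ ξ : (∅ : Finset Site) → Fin q, glue ∅ ξ ω = ω := fun ξ => by
    funext x; exact glue_of_notMem (by simp)
  simp [sumOver, this]

lemma sumOver_insert {W : Finset Site} {x : Site} (hx : x ∉ W) (f : Conf q → M) (ω : Conf q) :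
    sumOver (insert x W) f ω = ∑ i, sumOver W f (update ω x i) := by
  simp only [sumOver]
  rw [← Finset.sum_product' (s := Finset.univ) (t := Finset.univ)
    (f := fun i ξ => f (glue W ξ (update ω x i)))]
  refine Finset.sum_bij'
    (i := fun ξ _ => (ξ ⟨x, Finset.mem_insert_self _ _⟩,
      fun y : W => ξ ⟨y, Finset.mem_insert_of_mem y.2⟩))
    (j := fun p _ => fun y => glue W p.2 (update ω x p.1) y) ?_ ?_ ?_ ?_ ?_
  · simp
  · simp
  · rintro ξ -
    funext ⟨y, hy⟩
    rcases Finset.mem_insert.1 hy with rfl | h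
    · simp [glue, hx]
    · simp [glue, h]
  · rintro ⟨i, ξ⟩ -
    simp [glue, hx]
  · rintro ξ -
    congr 1
    funext y
    by_cases hyx : y = x
    · subst hyx; simp [glue, hx]
    · by_cases hy : y ∈ W
      · simp [glue, hy]
      · simp [glue, hy, hyx]

lemma sumOver_singleton (x : Site) (f : Conf q → M) (ω : Conf q) :
    sumOver {x} f ω = ∑ i, f (update ω x i) := by
  rw [← insert_empty_eq, sumOver_insert (Finset.notMem_empty x)]
  simp [sumOver_empty]

lemma sumOver_union {W W' : Finset Site} (h : Disjoint W W') (f : Conf q → M) (ω : Conf q) :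
    sumOver (W ∪ W') f ω = sumOver W' (sumOver W f) ω := by
  induction W' using Finset.induction_on generalizing ω with
  | empty => simp [sumOver_empty]
  | insert x W' hx ih =>
    rw [Finset.disjoint_insert_right] at h
    rw [Finset.union_insert, sumOver_insert (by simp [hx, h.1]), sumOver_insert hx]
    exact Finset.sum_congr rfl fun i _ => ih h.2 _

lemma sumOver_add (W : Finset Site) (f g : Conf q → M) (ω : Conf q) :
    sumOver W (fun η => f η + g η) ω = sumOver W f ω + sumOver W g ω := Finset.sum_add_distrib

lemma sumOver_sum {ι : Type*} (s : Finset ι) (W : Finset Site) (f : ι → Conf q → M) (ω : Conf q) :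
    sumOver W (fun η => ∑ i ∈ s, f i η) ω = ∑ i ∈ s, sumOver W (f i) ω := Finset.sum_comm

end SumOver

lemma sumOver_mul_left {R : Type*} [NonUnitalNonAssocSemiring R] (W : Finset Site) (c : R)
    (f : Conf q → R) (ω : Conf q) : sumOver W (fun η => c * f η) ω = c * sumOver W f ω :=
  (Finset.mul_sum _ _ _).symm

lemma sumOver_mul_right {R : Type*} [NonUnitalNonAssocSemiring R] (W : Finset Site) (c : R)
    (f : Conf q → R) (ω : Conf q) : sumOver W (fun η => f η * c) ω = sumOver W f ω * c :=
  (Finset.sum_mul _ _ _).symm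

lemma sumOver_mono {M : Type*} [AddCommMonoid M] [PartialOrder M] [IsOrderedAddMonoid M]
    {W : Finset Site} {f g : Conf q → M} {ω : Conf q}
    (h : ∀ η : Conf q, (∀ x ∉ W, η x = ω x) → f η ≤ g η) : sumOver W f ω ≤ sumOver W g ω :=
  Finset.sum_le_sum fun _ _ => h _ fun _ hx => glue_of_notMem hx

/-! ### Neighbourhoods -/

/-- A finite set together with its outer boundary. -/
def nbhd (W : Finset Site) : Finset Site := W ∪ boundary W

lemma subset_nbhd (W : Finset Site) : W ⊆ nbhd W := Finset.subset_union_left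

lemma mem_nbhd_of_adj {W : Finset Site} {x y : Site} (hx : x ∈ W) (h : gridGraph.Adj x y) :
    y ∈ nbhd W := by
  by_cases hy : y ∈ W
  · exact subset_nbhd W hy
  · exact Finset.mem_union_right _ (mem_boundary.2 ⟨hy, x, hx, h⟩)

lemma nbhd_mono {W W' : Finset Site} (h : W ⊆ W') : nbhd W ⊆ nbhd W' := by
  intro x hx
  rcases Finset.mem_union.1 hx with hx | hx
  · exact subset_nbhd _ (h hx)
  · obtain ⟨-, u, hu, hux⟩ := mem_boundary.1 hx
    exact mem_nbhd_of_adj (h hu) hux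

/-- The edges inside a finite set, directed upwards or to the right. -/
def edgesIn (G : Finset Site) : Finset (Site × Site) :=
  (G ×ˢ G).filter fun p => p.2 = p.1 + (1, 0) ∨ p.2 = p.1 + (0, 1)

lemma adj_of_step {x y : Site} (h : y = x + (1, 0) ∨ y = x + (0, 1)) : gridGraph.Adj x y := by
  rw [gridGraph_adj]
  rcases h with rfl | rfl <;> simp [gridDist]

lemma step_of_adj {x y : Site} (h : gridGraph.Adj x y) :
    (y = x + (1, 0) ∨ y = x + (0, 1)) ∨ (x = y + (1, 0) ∨ x = y + (0, 1)) := by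
  rw [gridGraph_adj, gridDist] at h
  simp only [Prod.ext_iff, Prod.fst_add, Prod.snd_add]
  omega

lemma mem_edgesIn {G : Finset Site} {p : Site × Site} : p ∈ edgesIn G ↔
    (p.1 ∈ G ∧ p.2 ∈ G) ∧ (p.2 = p.1 + (1, 0) ∨ p.2 = p.1 + (0, 1)) := by
  simp [edgesIn]

lemma edgesIn_mono {G H : Finset Site} (h : H ⊆ G) : edgesIn H ⊆ edgesIn G := by
  intro p hp
  rw [mem_edgesIn] at hp ⊢
  exact ⟨⟨h hp.1.1, h hp.1.2⟩, hp.2⟩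

/-! ### Weights and finite-volume expectations -/

namespace SpinSystem

variable (S : SpinSystem q)

lemma weight_eq (G : Finset Site) (η : Conf q) :
    S.weight G η = (∏ x ∈ G, S.b (η x)) * ∏ p ∈ edgesIn G, S.A (η p.1) (η p.2) := by
  rw [weight, edgesIn, Finset.prod_filter, Finset.prod_product]
  simp_rw [Finset.prod_filter]

lemma weight_nonneg (G : Finset Site) (η : Conf q) : 0 ≤ S.weight G η := by
  rw [weight_eq]
  exact mul_nonneg (Finset.prod_nonneg fun _ _ => S.b_nonneg _)
    (Finset.prod_nonneg fun _ _ => S.A_nonneg _ _)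

lemma weight_congr {G : Finset Site} {η η' : Conf q} (h : ∀ x ∈ G, η x = η' x) :
    S.weight G η = S.weight G η' := by
  rw [weight_eq, weight_eq]
  congr 1
  · exact Finset.prod_congr rfl fun x hx => by rw [h x hx]
  · refine Finset.prod_congr rfl fun p hp => ?_
    rw [mem_edgesIn] at hp
    rw [h _ hp.1.1, h _ hp.1.2]

/-- The factors of the weight on `G` that do not occur in the weight on `H`. -/
noncomputable def rest (H G : Finset Site) (η : Conf q) : ℝ :=
  (∏ x ∈ G \ H, S.b (η x)) * ∏ p ∈ edgesIn G \ edgesIn H, S.A (η p.1) (η p.2)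

lemma weight_eq_rest_mul {H G : Finset Site} (h : H ⊆ G) (η : Conf q) :
    S.weight G η = S.rest H G η * S.weight H η := by
  rw [weight_eq, weight_eq, rest, ← Finset.prod_sdiff h, ← Finset.prod_sdiff (edgesIn_mono h)]
  ring

/-- An edge that meets `W` has both end points in `nbhd W`, so the factors left over by `nbhd W` do
not see the spins on `W`. -/
lemma rest_congr {W G : Finset Site} {η η' : Conf q} (h : ∀ x ∉ W, η x = η' x) :
    S.rest (nbhd W) G η = S.rest (nbhd W) G η' := by
  rw [rest, rest]
  congr 1
  · refine Finset.prod_congr rfl fun x hx => ?_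
    rw [h x fun hW => (Finset.mem_sdiff.1 hx).2 (subset_nbhd W hW)]
  · refine Finset.prod_congr rfl fun p hp => ?_
    rw [Finset.mem_sdiff, mem_edgesIn, mem_edgesIn] at hp
    have hadj := adj_of_step hp.1.2
    rw [h p.1 fun h1 => hp.2 ⟨⟨subset_nbhd W h1, mem_nbhd_of_adj h1 hadj⟩, hp.1.2⟩,
      h p.2 fun h2 => hp.2 ⟨⟨mem_nbhd_of_adj h2 hadj.symm, subset_nbhd W h2⟩, hp.1.2⟩]

/-- The expectation of `f` under the Gibbs distribution on `W` with boundary condition `ω`. -/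
noncomputable def expect (W : Finset Site) (ω : Conf q) (f : Conf q → ℝ) : ℝ :=
  sumOver W (fun η => S.weight (nbhd W) η * f η) ω / sumOver W (S.weight (nbhd W)) ω

lemma spec_eq_expect (W : Finset Site) (ω : Conf q) (E : Set (Conf q)) :
    S.spec W ω E = S.expect W ω (E.indicator fun _ => 1) := by
  classical
  simp only [spec, expect, sumOver, nbhd, Set.indicator_apply, mul_ite, mul_one, mul_zero]

lemma partition_nonneg (W G : Finset Site) (ω : Conf q) : 0 ≤ sumOver W (S.weight G) ω :=
  Finset.sum_nonneg fun _ _ => S.weight_nonneg _ _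

lemma sumOver_weight_mul_eq_zero {W G : Finset Site} {ω : Conf q}
    (h : sumOver W (S.weight G) ω = 0) (f : Conf q → ℝ) :
    sumOver W (fun η => S.weight G η * f η) ω = 0 := by
  have h0 := (Finset.sum_eq_zero_iff_of_nonneg fun ξ _ => S.weight_nonneg G (glue W ξ ω)).1 h
  exact Finset.sum_eq_zero fun ξ hξ => mul_eq_zero_of_left (h0 ξ hξ) _

/-- If the partition function vanishes then so do all weights and both sides are zero. This is why
consistency below needs no feasibility assumption. -/
lemma expect_mul_partition (W : Finset Site) (ω : Conf q) (f : Conf q → ℝ) :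
    S.expect W ω f * sumOver W (S.weight (nbhd W)) ω =
      sumOver W (fun η => S.weight (nbhd W) η * f η) ω := by
  rw [expect]
  by_cases h : sumOver W (S.weight (nbhd W)) ω = 0
  · rw [h, mul_zero, S.sumOver_weight_mul_eq_zero h]
  · rw [div_mul_cancel₀ _ h]

lemma expect_congr_off (W : Finset Site) {ω ω' : Conf q} (h : ∀ x ∉ W, ω x = ω' x)
    (f : Conf q → ℝ) : S.expect W ω f = S.expect W ω' f := by
  rw [expect, expect, sumOver_congr_off _ h, sumOver_congr_off (S.weight (nbhd W)) h]

/-- The finite-volume Gibbs distributions are consistent. -/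
theorem expect_expect {W' W : Finset Site} (h : W' ⊆ W) (ω : Conf q) (f : Conf q → ℝ) :
    S.expect W ω (fun η => S.expect W' η f) = S.expect W ω f := by
  rw [expect, expect]
  congr 1
  have hW : W' ∪ W \ W' = W := Finset.union_sdiff_of_subset h
  nth_rw 1 3 [← hW]
  rw [sumOver_union Finset.disjoint_sdiff, sumOver_union Finset.disjoint_sdiff]
  refine sumOver_congr fun η _ => ?_
  -- Once the spins off `W'` are fixed, the weight for `W` is a constant multiple of the weight for
  -- `W'`. The constant comes out of the inner sum over `W'`.
  have hR : ∀ ζ : Conf q, (∀ x ∉ W', ζ x = η x) → S.weight (nbhd W) ζ =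
      S.rest (nbhd W') (nbhd W) η * S.weight (nbhd W') ζ := fun ζ hζ => by
    rw [S.weight_eq_rest_mul (nbhd_mono h), S.rest_congr hζ]
  rw [sumOver_congr (g := fun ζ => (S.rest (nbhd W') (nbhd W) η * S.expect W' η f) *
      S.weight (nbhd W') ζ), sumOver_congr (f := fun ζ => S.weight (nbhd W) ζ * f ζ)
      (g := fun ζ => S.rest (nbhd W') (nbhd W) η * (S.weight (nbhd W') ζ * f ζ)),
    sumOver_mul_left, sumOver_mul_left, mul_assoc, expect_mul_partition]
  · intro ζ hζ; rw [hR ζ hζ, mul_assoc]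
  · intro ζ hζ; rw [hR ζ hζ, S.expect_congr_off W' hζ]; ring

lemma expect_congr {W : Finset Site} {ω ω' : Conf q} {f g : Conf q → ℝ}
    (h : ∀ x ∈ boundary W, ω x = ω' x)
    (hfg : ∀ ξ : W → Fin q, f (glue W ξ ω) = g (glue W ξ ω')) :
    S.expect W ω f = S.expect W ω' g := by
  have hw : ∀ ξ : W → Fin q,
      S.weight (nbhd W) (glue W ξ ω) = S.weight (nbhd W) (glue W ξ ω') := fun ξ => by
    refine S.weight_congr fun x hx => ?_
    by_cases hxW : x ∈ W
    · simp [glue, hxW]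
    · simp only [glue, hxW, dite_false]
      exact h x ((Finset.mem_union.1 hx).resolve_left hxW)
  rw [expect, expect]
  simp only [sumOver, hw, hfg]

lemma expect_congr_fun {W : Finset Site} {ω : Conf q} {f g : Conf q → ℝ}
    (h : ∀ η : Conf q, (∀ x ∉ W, η x = ω x) → f η = g η) : S.expect W ω f = S.expect W ω g :=
  S.expect_congr (fun _ _ => rfl) fun _ => h _ fun _ hx => glue_of_notMem hx

lemma expect_mul_left (W : Finset Site) (ω : Conf q) (c : ℝ) (f : Conf q → ℝ) :
    S.expect W ω (fun η => c * f η) = c * S.expect W ω f := by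
  rw [expect, expect, ← mul_div_assoc, ← sumOver_mul_left]
  congr 2; funext η; ring

lemma expect_add (W : Finset Site) (ω : Conf q) (f g : Conf q → ℝ) :
    S.expect W ω (fun η => f η + g η) = S.expect W ω f + S.expect W ω g := by
  rw [expect, expect, expect, ← add_div, ← sumOver_add]
  congr 2; funext η; ring

lemma expect_sum {ι : Type*} (s : Finset ι) (W : Finset Site) (ω : Conf q)
    (f : ι → Conf q → ℝ) :
    S.expect W ω (fun η => ∑ i ∈ s, f i η) = ∑ i ∈ s, S.expect W ω (f i) := by
  simp only [expect, Finset.mul_sum, ← Finset.sum_div, sumOver_sum]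

lemma expect_nonneg {W : Finset Site} {ω : Conf q} {f : Conf q → ℝ}
    (h : ∀ η : Conf q, (∀ x ∉ W, η x = ω x) → 0 ≤ f η) : 0 ≤ S.expect W ω f :=
  div_nonneg (Finset.sum_nonneg fun _ _ => mul_nonneg (S.weight_nonneg _ _)
    (h _ fun _ hx => glue_of_notMem hx)) (S.partition_nonneg _ _ _)

lemma spec_nonneg (W : Finset Site) (ω : Conf q) (E : Set (Conf q)) : 0 ≤ S.spec W ω E := by
  rw [spec_eq_expect]
  exact S.expect_nonneg fun η _ => Set.indicator_nonneg (fun _ _ => zero_le_one) _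

/-! ### Configurations of positive weight -/

/-- All finite parts of `ω` have positive weight (see `good_iff`). -/
def Good (ω : Conf q) : Prop :=
  (∀ x, 0 < S.b (ω x)) ∧ ∀ x y, gridGraph.Adj x y → 0 < S.A (ω x) (ω y)

variable {S}

lemma weight_pos_iff {G : Finset Site} {ω : Conf q} : 0 < S.weight G ω ↔
    (∀ x ∈ G, 0 < S.b (ω x)) ∧
      ∀ x ∈ G, ∀ y ∈ G, gridGraph.Adj x y → 0 < S.A (ω x) (ω y) := by
  have hlt : 0 < S.weight G ω ↔ S.weight G ω ≠ 0 := (S.weight_nonneg G ω).lt_iff_ne'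
  rw [hlt, weight_eq, mul_ne_zero_iff, Finset.prod_ne_zero_iff, Finset.prod_ne_zero_iff]
  refine and_congr (forall₂_congr fun x _ => (S.b_nonneg _).lt_iff_ne'.symm) ⟨?_, ?_⟩
  · intro h x hx y hy hxy
    rcases step_of_adj hxy with hs | hs
    · exact (S.A_nonneg _ _).lt_of_ne' (h (x, y) (mem_edgesIn.2 ⟨⟨hx, hy⟩, hs⟩))
    · rw [← S.symm.apply]
      exact (S.A_nonneg _ _).lt_of_ne' (h (y, x) (mem_edgesIn.2 ⟨⟨hy, hx⟩, hs⟩))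
  · intro h p hp
    rw [mem_edgesIn] at hp
    exact (h _ hp.1.1 _ hp.1.2 (adj_of_step hp.2)).ne'

lemma good_iff {ω : Conf q} : S.Good ω ↔ ∀ G, 0 < S.weight G ω := by
  refine ⟨fun h G => weight_pos_iff.2 ⟨fun x _ => h.1 x, fun x _ y _ => h.2 x y⟩, fun h => ?_⟩
  refine ⟨fun x => (weight_pos_iff.1 (h {x})).1 x (by simp), fun x y hxy => ?_⟩
  exact (weight_pos_iff.1 (h {x, y})).2 x (by simp) y (by simp) hxy

lemma feasible_iff_exists_good {Λ : Set Site} {τ : Conf q} :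
    S.Feasible Λ τ ↔ ∃ η, (∀ x ∈ Λ, η x = τ x) ∧ S.Good η := by
  simp only [Feasible, good_iff]

lemma Good.feasible {ω : Conf q} (h : S.Good ω) (Λ : Set Site) : S.Feasible Λ ω :=
  feasible_iff_exists_good.2 ⟨ω, fun _ _ => rfl, h⟩

/-- Positivity is a condition on single sites and edges: those that meet `W` lie in `nbhd W`, the
others are inherited from `ω`. -/
lemma Good.glue {W : Finset Site} {ω : Conf q} (h : S.Good ω) {η : Conf q}
    (hη : ∀ x ∉ W, η x = ω x) (hw : 0 < S.weight (nbhd W) η) : S.Good η := by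
  rw [weight_pos_iff] at hw
  refine ⟨fun x => ?_, fun x y hxy => ?_⟩
  · by_cases hx : x ∈ W
    · exact hw.1 x (subset_nbhd W hx)
    · rw [hη x hx]; exact h.1 x
  · by_cases hx : x ∈ W
    · exact hw.2 x (subset_nbhd W hx) y (mem_nbhd_of_adj hx hxy) hxy
    · by_cases hy : y ∈ W
      · exact hw.2 x (mem_nbhd_of_adj hy hxy.symm) y (subset_nbhd W hy) hxy
      · rw [hη x hx, hη y hy]; exact h.2 x y hxy

lemma Good.partition_pos {ω : Conf q} (h : S.Good ω) (W G : Finset Site) :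
    0 < sumOver W (S.weight G) ω := by
  refine Finset.sum_pos' (fun ξ _ => S.weight_nonneg _ _) ⟨fun x => ω x, Finset.mem_univ _, ?_⟩
  rw [glue_restrict]
  exact good_iff.1 h G

lemma expect_const_of_good {ω : Conf q} (h : S.Good ω) (W : Finset Site) (c : ℝ) :
    S.expect W ω (fun _ => c) = c := by
  rw [expect, sumOver_mul_right, mul_comm, mul_div_assoc, div_self (h.partition_pos _ _).ne',
    mul_one]

/-- Configurations of weight zero do not contribute, and the others are good by `Good.glue`. Bounds
valid for feasible boundary conditions only can therefore be used under the expectation. -/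
lemma Good.expect_mono {W : Finset Site} {ω : Conf q} (h : S.Good ω) {f g : Conf q → ℝ}
    (hfg : ∀ η : Conf q, S.Good η → (∀ x ∉ W, η x = ω x) → f η ≤ g η) :
    S.expect W ω f ≤ S.expect W ω g := by
  refine div_le_div_of_nonneg_right (sumOver_mono fun η hη => ?_) (S.partition_nonneg _ _ _)
  rcases (S.weight_nonneg (nbhd W) η).eq_or_lt with h0 | h0
  · simp [← h0]
  · exact mul_le_mul_of_nonneg_left (hfg η (h.glue hη h0) hη) h0.le

lemma Good.expect_congr_fun {W : Finset Site} {ω : Conf q} (h : S.Good ω) {f g : Conf q → ℝ}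
    (hfg : ∀ η : Conf q, S.Good η → (∀ x ∉ W, η x = ω x) → f η = g η) :
    S.expect W ω f = S.expect W ω g :=
  le_antisymm (h.expect_mono fun η h1 h2 => (hfg η h1 h2).le)
    (h.expect_mono fun η h1 h2 => (hfg η h1 h2).ge)

lemma Good.spec_univ {ω : Conf q} (h : S.Good ω) (W : Finset Site) :
    S.spec W ω Set.univ = 1 := by
  rw [spec_eq_expect, Set.indicator_univ, expect_const_of_good h]

lemma Good.spec_le_one {ω : Conf q} (h : S.Good ω) (W : Finset Site) (E : Set (Conf q)) :
    S.spec W ω E ≤ 1 := by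
  classical
  rw [← h.spec_univ W, spec_eq_expect, spec_eq_expect]
  refine h.expect_mono fun η _ _ => ?_
  by_cases hE : η ∈ E <;> simp [hE]

/-- Fill the complement of `Λ` with the soft spin, which is compatible with all spins. For soft
systems feasibility is thus a local condition on `Λ`. -/
lemma exists_good_of_pos_on {s₀ : Fin q} (hb : 0 < S.b s₀) (hA : ∀ j, 0 < S.A s₀ j)
    {Λ : Set Site} {τ : Conf q} (h1 : ∀ x ∈ Λ, 0 < S.b (τ x))
    (h2 : ∀ x ∈ Λ, ∀ y ∈ Λ, gridGraph.Adj x y → 0 < S.A (τ x) (τ y)) :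
    ∃ η, (∀ x ∈ Λ, η x = τ x) ∧ (∀ x ∉ Λ, η x = s₀) ∧ S.Good η := by
  classical
  refine ⟨fun x => if x ∈ Λ then τ x else s₀, fun x hx => by simp [hx], fun x hx => by simp [hx],
    fun x => ?_, fun x y hxy => ?_⟩
  · by_cases hx : x ∈ Λ
    · simpa [hx] using h1 x hx
    · simpa [hx] using hb
  · by_cases hx : x ∈ Λ
    · by_cases hy : y ∈ Λ
      · simpa [hx, hy] using h2 x hx y hy hxy
      · have := hA (τ x)
        rw [← S.symm.apply] at this
        simpa [hx, hy] using this
    · simpa [hx] using hA _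

lemma Good.glue_const {s₀ : Fin q} (hb : 0 < S.b s₀) (hA : ∀ j, 0 < S.A s₀ j) {ω : Conf q}
    (h : S.Good ω) (N : Finset Site) : S.Good (LazySampling.glue N (fun _ => s₀) ω) := by
  obtain ⟨η, h1, h2, h3⟩ := exists_good_of_pos_on hb hA (Λ := {x | x ∉ N}) (τ := ω)
    (fun x _ => h.1 x) (fun x _ y _ => h.2 x y)
  convert h3 using 1
  funext x
  by_cases hx : x ∈ N
  · rw [glue_of_mem hx, h2 x (by simpa using hx)]
  · rw [glue_of_notMem hx, h1 x hx]

end SpinSystem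

end LazySampling

namespace LazySampling

variable {q : ℕ}

/-! ### Exponential sums over the lattice -/

/-- The sum of `e^{-γ |n|}` over the integers. -/
noncomputable def lineSum (γ : ℝ) : ℝ≥0∞ := ∑' n : ℤ, ENNReal.ofReal (Real.exp (-γ * n.natAbs))

lemma lineSum_ne_top {γ : ℝ} (hγ : 0 < γ) : lineSum γ ≠ ∞ := by
  have h : Summable fun n : ℕ => Real.exp (-γ * n) := by
    have := Real.summable_exp_nat_mul_iff.2 (neg_lt_zero.2 hγ)
    simpa [mul_comm] using this
  have : Summable fun n : ℤ => Real.exp (-γ * n.natAbs) := by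
    refine Summable.of_nat_of_neg ?_ ?_ <;> simpa using h
  exact this.tsum_ofReal_ne_top

lemma tsum_ofReal_exp_dist {C : ℝ} (hC : 0 ≤ C) (γ : ℝ) (u : Site) :
    ∑' w : Site, ENNReal.ofReal (C * Real.exp (-γ * gridDist u w)) =
      ENNReal.ofReal C * lineSum γ ^ 2 := by
  have h : ∀ w : Site, ENNReal.ofReal (C * Real.exp (-γ * gridDist u w)) = ENNReal.ofReal C *
      (ENNReal.ofReal (Real.exp (-γ * (u.1 - w.1).natAbs)) *
        ENNReal.ofReal (Real.exp (-γ * (u.2 - w.2).natAbs))) := fun w => by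
    rw [← ENNReal.ofReal_mul (Real.exp_nonneg _), ← Real.exp_add, ← ENNReal.ofReal_mul hC,
      gridDist, Nat.cast_add, mul_add]
  have h1 : ∀ a : ℤ, ∑' b : ℤ, ENNReal.ofReal (Real.exp (-γ * (a - b).natAbs)) = lineSum γ :=
    fun a => (Equiv.subLeft a).tsum_eq fun n : ℤ => ENNReal.ofReal (Real.exp (-γ * n.natAbs))
  simp_rw [h]
  rw [ENNReal.tsum_mul_left, ENNReal.tsum_prod']
  simp_rw [ENNReal.tsum_mul_left, h1, ENNReal.tsum_mul_right, h1, sq]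

namespace SpinSystem

variable {S : SpinSystem q}

/-! ### Total variation bounds -/

/-- Two finite-volume expectations of an observable of the spins on `U` differ by at most the
total variation distance times the oscillation of the observable. -/
lemma abs_expect_sub_le {D U : Finset Site} {τ τ' : Conf q} (hτ : S.Good τ) (hτ' : S.Good τ')
    {h : Conf q → ℝ} {m M : ℝ}
    (hdep : ∀ η : Conf q, ((∀ x ∉ D, η x = τ x) ∨ ∀ x ∉ D, η x = τ' x) →
      h η = h (glue U (fun x => η x) τ))
    (hm : ∀ η : Conf q, S.Good η → ((∀ x ∉ D, η x = τ x) ∨ ∀ x ∉ D, η x = τ' x) →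
      m ≤ h η ∧ h η ≤ M) :
    |S.expect D τ h - S.expect D τ' h| ≤ S.tvDist D U τ τ' * (M - m) := by
  classical
  set cy : (U → Fin q) → Set (Conf q) := fun ζ => {η | ∀ x : U, η x = ζ x} with hcy
  have hsum : ∀ (η : Conf q) (g : (U → Fin q) → ℝ),
      ∑ ζ, g ζ * (cy ζ).indicator (fun _ => 1) η = g fun x => η x := by
    intro η g
    rw [Finset.sum_eq_single fun x : U => η x]
    · simp [hcy]
    · intro ζ _ hζ
      have : η ∉ cy ζ := fun h => hζ (funext fun x => (h x).symm)
      simp [this]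
    · simp
  have key : ∀ ω : Conf q, (ω = τ ∨ ω = τ') →
      S.expect D ω h = ∑ ζ, h (glue U ζ τ) * S.spec D ω (cy ζ) := by
    intro ω hω
    simp_rw [spec_eq_expect, ← expect_mul_left, ← expect_sum]
    refine S.expect_congr_fun fun η hη => ?_
    rw [hsum η fun ζ => h (glue U ζ τ)]
    rcases hω with rfl | rfl
    exacts [hdep η (Or.inl hη), hdep η (Or.inr hη)]
  have one : ∀ ω : Conf q, S.Good ω → ∑ ζ, S.spec D ω (cy ζ) = 1 := by
    intro ω hω
    simp_rw [spec_eq_expect, ← expect_sum]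
    refine (S.expect_congr_fun fun η _ => ?_).trans (expect_const_of_good hω D 1)
    simpa using hsum η fun _ => 1
  -- The bounds `m` and `M` are known on good configurations only. A pattern of positive probability
  -- is realised by one.
  have hz : ∀ ω : Conf q, S.Good ω → (ω = τ ∨ ω = τ') → ∀ ζ, S.spec D ω (cy ζ) ≠ 0 →
      m ≤ h (glue U ζ τ) ∧ h (glue U ζ τ) ≤ M := by
    intro ω hgood hω ζ hne
    by_contra hcon
    refine hne ?_
    have h0 : S.expect D ω (fun _ => (0 : ℝ)) = 0 := expect_const_of_good hgood D 0
    rw [spec_eq_expect, ← h0]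
    refine hgood.expect_congr_fun fun η hη hoff => Set.indicator_of_notMem (fun hmem => hcon ?_) _
    have hor : (∀ x ∉ D, η x = τ x) ∨ ∀ x ∉ D, η x = τ' x := by
      rcases hω with rfl | rfl
      exacts [Or.inl hoff, Or.inr hoff]
    have := hm η hη hor
    rwa [hdep η hor, show (fun x : U => η x) = ζ from funext hmem] at this
  rw [key τ (Or.inl rfl), key τ' (Or.inr rfl), ← Finset.sum_sub_distrib]
  -- Both laws have total mass one, so `h` may be centred at the midpoint of `[m, M]`. This yields
  -- the factor `(M - m)/2`, which matches the `1/2` in the total variation distance.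
  have e : ∑ ζ, (h (glue U ζ τ) * S.spec D τ (cy ζ) - h (glue U ζ τ) * S.spec D τ' (cy ζ)) =
      ∑ ζ, (h (glue U ζ τ) - (m + M) / 2) * (S.spec D τ (cy ζ) - S.spec D τ' (cy ζ)) := by
    have : ∑ ζ, (m + M) / 2 * (S.spec D τ (cy ζ) - S.spec D τ' (cy ζ)) = 0 := by
      rw [← Finset.mul_sum, Finset.sum_sub_distrib, one τ hτ, one τ' hτ']; ring
    rw [← sub_zero (∑ ζ, (h (glue U ζ τ) * _ - _)), ← this, ← Finset.sum_sub_distrib]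
    exact Finset.sum_congr rfl fun ζ _ => by ring
  rw [e, tvDist]
  refine (Finset.abs_sum_le_sum_abs _ _).trans ?_
  rw [mul_comm, Finset.mul_sum, Finset.mul_sum]
  refine Finset.sum_le_sum fun ζ _ => ?_
  rw [abs_mul]
  by_cases h0 : S.spec D τ (cy ζ) = 0 ∧ S.spec D τ' (cy ζ) = 0
  · change _ * |S.spec D τ (cy ζ) - S.spec D τ' (cy ζ)| ≤
      _ * (_ * |S.spec D τ (cy ζ) - S.spec D τ' (cy ζ)|)
    simp [h0.1, h0.2]
  · have hb : m ≤ h (glue U ζ τ) ∧ h (glue U ζ τ) ≤ M := by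
      by_cases h1 : S.spec D τ (cy ζ) = 0
      · exact hz τ' hτ' (Or.inr rfl) ζ fun h2 => h0 ⟨h1, h2⟩
      · exact hz τ hτ (Or.inl rfl) ζ h1
    have : |h (glue U ζ τ) - (m + M) / 2| ≤ (M - m) * (1 / 2) := by
      rw [abs_le]; constructor <;> linarith
    rw [← mul_assoc]
    exact mul_le_mul_of_nonneg_right this (abs_nonneg _)

/-- The mixing hypothesis speaks of distinct boundary conditions; for equal ones the distance is
zero, so the case distinction can be dropped. -/
lemma SetWeakSpatialMixing.tvDist_le {f : ℕ → ℝ} (hf : S.SetWeakSpatialMixing f)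
    {D U : Finset Site} (hUD : U ⊆ D) {τ τ' : Conf q} (hτ : S.Good τ) (hτ' : S.Good τ') :
    ENNReal.ofReal (S.tvDist D U τ τ') ≤
      ∑ u ∈ U, ∑' w : {w : Site // w ∉ D}, ENNReal.ofReal (f (gridDist u w)) := by
  by_cases h : ∃ w, w ∉ D ∧ τ w ≠ τ' w
  · exact hf D U hUD τ τ' (hτ.feasible _) (hτ'.feasible _) h
  · push Not at h
    have : S.tvDist D U τ τ' = 0 := by
      rw [tvDist]
      simp_rw [spec_eq_expect, S.expect_congr_off D h]
      simp
    simp [this]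

end SpinSystem

/-! ### Cylinder events -/

/-- The event that the spins on `Λ` are those of `σ`. -/
def cyl (Λ : Finset Site) (σ : Conf q) : Set (Conf q) := {η | ∀ x ∈ Λ, η x = σ x}

lemma mem_cyl {Λ : Finset Site} {σ η : Conf q} : η ∈ cyl Λ σ ↔ ∀ x ∈ Λ, η x = σ x := Iff.rfl

lemma measurableSet_eval (v : Site) (i : Fin q) : MeasurableSet {η : Conf q | η v = i} :=
  (measurable_pi_apply (X := fun _ : Site => Fin q) v) (measurableSet_singleton i)

lemma measurableSet_cyl (Λ : Finset Site) (σ : Conf q) : MeasurableSet (cyl Λ σ) := by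
  have : cyl Λ σ = ⋂ x ∈ Λ, {η : Conf q | η x = σ x} := by ext; simp [cyl]
  rw [this]
  exact Finset.measurableSet_biInter _ fun x _ => measurableSet_eval x _

lemma eq_comp_of_dependsOn {β : Type*} {Λ : Finset Site} {f : Conf q → β}
    (hf : DependsOn f (Λ : Set Site)) (ω : Conf q) :
    f = (fun ζ : Λ → Fin q => f (glue Λ ζ ω)) ∘ fun η x => η x := by
  funext η
  refine hf fun x hx => ?_
  have hx' : x ∈ Λ := hx
  simp [glue, hx']

lemma continuous_of_dependsOn {β : Type*} [TopologicalSpace β] {Λ : Finset Site}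
    {f : Conf q → β} (hf : DependsOn f (Λ : Set Site)) : Continuous f := by
  rcases isEmpty_or_nonempty (Conf q) with h | ⟨⟨ω⟩⟩
  · exact continuous_of_const fun x => (IsEmpty.false x).elim
  · rw [eq_comp_of_dependsOn hf ω]
    exact continuous_of_discreteTopology.comp (by fun_prop)

lemma measurable_of_dependsOn {β : Type*} [MeasurableSpace β] {Λ : Finset Site}
    {f : Conf q → β} (hf : DependsOn f (Λ : Set Site)) : Measurable f := by
  rcases isEmpty_or_nonempty (Conf q) with h | ⟨⟨ω⟩⟩
  · exact measurable_of_empty f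
  · rw [eq_comp_of_dependsOn hf ω]
    exact (measurable_of_finite _).comp (by fun_prop)

lemma measurable_glue (W : Finset Site) (ξ : W → Fin q) : Measurable (glue W ξ) := by
  refine measurable_pi_lambda _ fun x => ?_
  by_cases hx : x ∈ W
  · simp [glue, hx]
  · simpa [glue, hx] using measurable_pi_apply x

/-- Integration of a local function over a cylinder event. -/
lemma setLIntegral_cyl (μ : Measure (Conf q)) {Λ R : Finset Site} (hΛR : Disjoint Λ R)
    (σ : Conf q) {F : Conf q → ℝ≥0∞} (hF : DependsOn F ((Λ ∪ R : Finset Site) : Set Site)) :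
    ∫⁻ ω in cyl Λ σ, F ω ∂μ = sumOver R (fun η => μ (cyl (Λ ∪ R) η) * F η) σ := by
  classical
  have : ∀ ω, (cyl Λ σ).indicator F ω =
      sumOver R (fun η => (cyl (Λ ∪ R) η).indicator (fun _ => F η) ω) σ := by
    intro ω
    rw [sumOver, Finset.sum_eq_single fun x : R => ω x]
    · have hiff : ω ∈ cyl (Λ ∪ R) (glue R (fun x => ω x) σ) ↔ ω ∈ cyl Λ σ := by
        simp only [mem_cyl]
        refine ⟨fun h x hx => ?_, fun h x hx => ?_⟩
        · rw [h x (Finset.mem_union_left _ hx),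
            glue_of_notMem (Finset.disjoint_left.1 hΛR hx)]
        · by_cases hxR : x ∈ R
          · simp [glue, hxR]
          · rw [glue_of_notMem hxR, h x ((Finset.mem_union.1 hx).resolve_right hxR)]
      by_cases hω : ω ∈ cyl Λ σ
      · rw [Set.indicator_of_mem hω, Set.indicator_of_mem (hiff.2 hω)]
        exact hF (hiff.2 hω)
      · rw [Set.indicator_of_notMem hω, Set.indicator_of_notMem (mt hiff.1 hω)]
    · intro ξ _ hξ
      refine Set.indicator_of_notMem (fun h => hξ ?_) _
      funext x
      have := h x (Finset.mem_union_right _ x.2)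
      simpa [glue] using this.symm
    · simp
  rw [← lintegral_indicator (measurableSet_cyl Λ σ)]
  simp_rw [this, sumOver]
  rw [lintegral_finsetSum _ fun ξ _ => measurable_const.indicator (measurableSet_cyl _ _)]
  refine Finset.sum_congr rfl fun ξ _ => ?_
  rw [lintegral_indicator_const (measurableSet_cyl _ _), mul_comm]

lemma measure_cyl (μ : Measure (Conf q)) {Λ R : Finset Site} (hΛR : Disjoint Λ R)
    (σ : Conf q) : μ (cyl Λ σ) = sumOver R (fun η => μ (cyl (Λ ∪ R) η)) σ := by
  have := setLIntegral_cyl μ hΛR σ (F := fun _ => 1) (fun _ _ _ => rfl)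
  simpa using this

lemma measure_cyl_insert (μ : Measure (Conf q)) {Λ : Finset Site} {v : Site} (hv : v ∉ Λ)
    (σ : Conf q) : μ (cyl Λ σ) = ∑ i, μ (cyl (insert v Λ) (update σ v i)) := by
  rw [measure_cyl μ (Finset.disjoint_singleton_right.2 hv), sumOver_singleton]
  simp

lemma cyl_insert_update {Λ : Finset Site} {v : Site} (hv : v ∉ Λ) (σ : Conf q) (i : Fin q) :
    cyl (insert v Λ) (update σ v i) = cyl Λ σ ∩ {η | η v = i} := by
  ext η
  simp only [mem_cyl, Finset.forall_mem_insert, Function.update_self, Set.mem_inter_iff,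
    Set.mem_ofPred_eq]
  rw [and_comm]
  refine and_congr_left fun _ => forall₂_congr fun x hx => ?_
  rw [Function.update_of_ne (ne_of_mem_of_not_mem hx hv)]

lemma measure_ext_of_cylinders {μ ν : Measure (Conf q)} [IsFiniteMeasure μ] 
    (h : ∀ (U : Finset Site) (E : Set (Conf q)), DependsOn (· ∈ E) (U : Set Site) →
      MeasurableSet E → μ E = ν E) : μ = ν := by
  refine ext_of_generate_finite (measurableCylinders fun _ : Site => Fin q)
    generateFrom_measurableCylinders.symm isPiSystem_measurableCylinders (fun E hE => ?_)
    (h ∅ _ (fun _ _ _ => by simp) MeasurableSet.univ)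
  obtain ⟨U, T, hT, rfl⟩ := (mem_measurableCylinders _).1 hE
  refine h U _ (fun η η' hη => ?_) (MeasurableSet.of_mem_measurableCylinders hE)
  have : U.restrict η = U.restrict η' := funext fun x => hη x x.2
  simp only [mem_cylinder, this]

lemma measure_ext_of_cyl {μ ν : Measure (Conf q)} [IsFiniteMeasure μ] 
    (h : ∀ (U : Finset Site) (σ : Conf q), μ (cyl U σ) = ν (cyl U σ)) : μ = ν := by
  classical
  refine measure_ext_of_cylinders fun U E hE hEm => ?_
  rcases isEmpty_or_nonempty (Conf q) with h | ⟨⟨σ⟩⟩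
  · rw [Set.eq_empty_of_isEmpty E, measure_empty, measure_empty]
  have key : ∀ m : Measure (Conf q), m E =
      sumOver U (fun η => m (cyl U η) * E.indicator (fun _ => 1) η) σ := by
    intro m
    have := setLIntegral_cyl m (Finset.disjoint_empty_left U) σ
      (F := E.indicator fun _ => 1) (fun η η' hη => by
        have := hE (x := η) (y := η') (by simpa using hη)
        simp only [Set.indicator_apply]
        simp only [eq_iff_iff] at this
        simp [this])
    rw [Finset.empty_union] at this
    rw [← this, show cyl ∅ σ = Set.univ by ext; simp [cyl], Measure.restrict_univ,
      lintegral_indicator_const hEm, one_mul]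
  rw [key μ, key ν]
  exact sumOver_congr fun η _ => by rw [h U η]

/-! ### Gibbs measures -/

namespace SpinSystem

variable {S : SpinSystem q}

lemma expect_dependsOn (W : Finset Site) {U : Finset Site} {f : Conf q → ℝ}
    (hf : DependsOn f (U : Set Site)) :
    DependsOn (fun ω => S.expect W ω f) ((boundary W ∪ U : Finset Site) : Set Site) := by
  intro ω ω' h
  refine S.expect_congr (fun x hx => h x (by simp [hx])) fun ξ => hf fun x hx => ?_
  by_cases hxW : x ∈ W
  · simp [glue, hxW]
  · rw [glue_of_notMem hxW, glue_of_notMem hxW]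
    exact h x (by simp [Finset.mem_coe.1 hx])

lemma expect_dependsOn' {W U : Finset Site} {f : Conf q → ℝ}
    (hU : boundary W ⊆ U) (hf : DependsOn f ((U ∪ W : Finset Site) : Set Site)) :
    DependsOn (fun ω => S.expect W ω f) (U : Set Site) := by
  intro ω ω' h
  refine S.expect_congr (fun x hx => h x (hU hx)) fun ξ => hf fun x hx => ?_
  by_cases hxW : x ∈ W
  · simp [glue, hxW]
  · rw [glue_of_notMem hxW, glue_of_notMem hxW]
    exact h x ((Finset.mem_union.1 hx).resolve_right hxW)

lemma dependsOn_indicator {E : Set (Conf q)} {U : Set Site} (h : DependsOn (· ∈ E) U) :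
    DependsOn (E.indicator fun _ => (1 : ℝ)) U := by
  classical
  intro η η' hη
  have := h hη
  simp only [eq_iff_iff] at this
  simp [Set.indicator_apply, this]

/-- The transition densities of the specification. -/
noncomputable def density (S : SpinSystem q) (W : Finset Site) (ξ : W → Fin q) (ω : Conf q) :
    ℝ≥0∞ :=
  ENNReal.ofReal (S.weight (nbhd W) (glue W ξ ω) / sumOver W (S.weight (nbhd W)) ω)

lemma weight_dependsOn (G : Finset Site) : DependsOn (S.weight G) (G : Set Site) :=
  fun _ _ h => S.weight_congr h

lemma measurable_density (W : Finset Site) (ξ : W → Fin q) : Measurable (S.density W ξ) := by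
  have h : ∀ ξ : W → Fin q, Measurable fun ω => S.weight (nbhd W) (glue W ξ ω) := fun ξ =>
    (measurable_of_dependsOn (weight_dependsOn _)).comp (measurable_glue W ξ)
  refine ENNReal.measurable_ofReal.comp ((h ξ).div ?_)
  exact Finset.measurable_fun_sum _ fun ξ _ => h ξ

lemma ofReal_spec (W : Finset Site) (ω : Conf q) (E : Set (Conf q)) :
    ENNReal.ofReal (S.spec W ω E) =
      ∑ ξ : W → Fin q, (glue W ξ ⁻¹' E).indicator (S.density W ξ) ω := by
  classical
  rw [spec_eq_expect, expect, sumOver, Finset.sum_div, ENNReal.ofReal_sum_of_nonneg]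
  · refine Finset.sum_congr rfl fun ξ _ => ?_
    by_cases h : glue W ξ ω ∈ E <;> simp [h, density]
  · exact fun ξ _ => div_nonneg (mul_nonneg (S.weight_nonneg _ _)
      (Set.indicator_nonneg (fun _ _ => zero_le_one) _)) (S.partition_nonneg _ _ _)

lemma measurable_ofReal_spec (W : Finset Site) {E : Set (Conf q)} (hE : MeasurableSet E) :
    Measurable fun ω => ENNReal.ofReal (S.spec W ω E) := by
  simp_rw [ofReal_spec]
  exact Finset.measurable_fun_sum _ fun ξ _ =>
    (measurable_density W ξ).indicator (measurable_glue W ξ hE)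

/-- The image of a measure under the specification on `W`. -/
noncomputable def applySpec (S : SpinSystem q) (W : Finset Site) (μ : Measure (Conf q)) :
    Measure (Conf q) :=
  ∑ ξ : W → Fin q, (μ.withDensity (S.density W ξ)).map (glue W ξ)

lemma applySpec_apply (W : Finset Site) (μ : Measure (Conf q)) {E : Set (Conf q)}
    (hE : MeasurableSet E) :
    S.applySpec W μ E = ∫⁻ ω, ENNReal.ofReal (S.spec W ω E) ∂μ := by
  simp_rw [ofReal_spec]
  rw [lintegral_finsetSum _ fun ξ _ =>
    (measurable_density W ξ).indicator (measurable_glue W ξ hE), applySpec,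
    Measure.finsetSum_apply]
  refine Finset.sum_congr rfl fun ξ _ => ?_
  rw [Measure.map_apply (measurable_glue W ξ) hE, withDensity_apply _ (measurable_glue W ξ hE),
    lintegral_indicator (measurable_glue W ξ hE)]

/-- Both sides of the consistency equation are measures in `E`, so it is enough that they agree on
the generating π-system of local events. -/
lemma isGibbs_of_local {μ : Measure (Conf q)} [IsProbabilityMeasure μ]
    (h : ∀ (W U : Finset Site) (E : Set (Conf q)), DependsOn (· ∈ E) (U : Set Site) →
      MeasurableSet E → μ E = ∫⁻ ω, ENNReal.ofReal (S.spec W ω E) ∂μ) : S.IsGibbs μ := by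
  refine ⟨inferInstance, fun W E hE => ?_⟩
  rw [← applySpec_apply W μ hE,
    ← measure_ext_of_cylinders (μ := μ) (ν := S.applySpec W μ) fun U E hU hE => ?_]
  rw [h W U E hU hE, applySpec_apply W μ hE]

/-! ### Existence of a Gibbs measure -/

/-- The finite-volume Gibbs distribution as a measure. -/
noncomputable def finVol (S : SpinSystem q) (D : Finset Site) (ω : Conf q) : Measure (Conf q) :=
  S.applySpec D (Measure.dirac ω)

lemma finVol_apply (D : Finset Site) (ω : Conf q) {E : Set (Conf q)} (hE : MeasurableSet E) :
    S.finVol D ω E = ENNReal.ofReal (S.spec D ω E) := by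
  rw [finVol, applySpec_apply _ _ hE, lintegral_dirac' _ (measurable_ofReal_spec D hE)]

lemma isProbabilityMeasure_finVol (D : Finset Site) {ω : Conf q} (h : S.Good ω) :
    IsProbabilityMeasure (S.finVol D ω) :=
  ⟨by rw [finVol_apply _ _ MeasurableSet.univ, h.spec_univ, ENNReal.ofReal_one]⟩

lemma integral_finVol {D : Finset Site} {ω : Conf q} (h : S.Good ω) {U : Finset Site}
    {f : Conf q → ℝ} (hf : DependsOn f (U : Set Site)) :
    ∫ η, f η ∂(S.finVol D ω) = S.expect D ω f := by
  classical
  have := isProbabilityMeasure_finVol D h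
  have hE : ∀ ζ : U → Fin q, MeasurableSet (cyl U (glue U ζ ω)) := fun ζ => measurableSet_cyl _ _
  have hfs : f = fun η => ∑ ζ : U → Fin q,
      f (glue U ζ ω) * (cyl U (glue U ζ ω)).indicator (fun _ => (1 : ℝ)) η := by
    funext η
    have hmem : η ∈ cyl U (glue U (fun x => η x) ω) := fun x hx => by simp [glue, hx]
    rw [Finset.sum_eq_single fun x : U => η x]
    · rw [Set.indicator_of_mem hmem, mul_one]
      exact hf hmem
    · intro ζ _ hζ
      rw [Set.indicator_of_notMem, mul_zero]
      intro hc
      refine hζ (funext fun x => ?_)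
      have := hc x x.2
      simpa [glue] using this.symm
    · simp
  rw [hfs, expect_sum, integral_finsetSum]
  · refine Finset.sum_congr rfl fun ζ _ => ?_
    rw [expect_mul_left, integral_const_mul, integral_indicator_const _ (hE ζ), smul_eq_mul,
      mul_one, Measure.real, finVol_apply _ _ (hE ζ), ENNReal.toReal_ofReal (S.spec_nonneg _ _ _),
      spec_eq_expect]
  · exact fun ζ _ => ((integrable_const (1 : ℝ)).indicator (hE ζ)).const_mul _

lemma abs_expect_le {W : Finset Site} {ω : Conf q} {f : Conf q → ℝ} {c : ℝ} (hc : 0 ≤ c)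
    (h : ∀ η, |f η| ≤ c) : |S.expect W ω f| ≤ c := by
  rw [expect, abs_div, abs_of_nonneg (S.partition_nonneg _ _ _)]
  refine div_le_of_le_mul₀ (S.partition_nonneg _ _ _) hc ?_
  rw [← sumOver_mul_left]
  refine (Finset.abs_sum_le_sum_abs _ _).trans (Finset.sum_le_sum fun ξ _ => ?_)
  rw [abs_mul, abs_of_nonneg (S.weight_nonneg _ _), mul_comm]
  exact mul_le_mul_of_nonneg_right (h _) (S.weight_nonneg _ _)

/-- The probability measures on the compact space of configurations are compact. The consistency
equation passes to a limit point because, for a local event, both sides are integrals of local,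
hence continuous, functions. -/
theorem exists_isGibbs {ω₀ : Conf q} (hω₀ : S.Good ω₀) : ∃ μ, S.IsGibbs μ := by
  classical
  let P : Finset Site → ProbabilityMeasure (Conf q) := fun D =>
    ⟨S.finVol D ω₀, isProbabilityMeasure_finVol D hω₀⟩
  -- An ultrafilter finer than `atTop` replaces the passage to a convergent subsequence of volumes.
  let l : Ultrafilter (Finset Site) := Ultrafilter.of Filter.atTop
  have hl : (l : Filter (Finset Site)) ≤ Filter.atTop := Ultrafilter.of_le _
  obtain ⟨μ, hμ⟩ : ∃ μ, Filter.Tendsto P l (nhds μ) := by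
    obtain ⟨μ, -, hμ⟩ := isCompact_univ.ultrafilter_le_nhds (l.map P) (by simp)
    exact ⟨μ, hμ⟩
  have hlim : ∀ (U : Finset Site) (f : Conf q → ℝ), DependsOn f (U : Set Site) →
      (∃ c, ∀ η, |f η| ≤ c) →
      Filter.Tendsto (fun D => S.expect D ω₀ f) l (nhds (∫ η, f η ∂μ)) := by
    intro U f hf ⟨c, hc⟩
    let F : BoundedContinuousFunction (Conf q) ℝ :=
      BoundedContinuousFunction.ofNormedAddCommGroup f (continuous_of_dependsOn hf) c hc
    have := (ProbabilityMeasure.tendsto_iff_forall_integral_tendsto.1 hμ) F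
    refine this.congr fun D => ?_
    exact integral_finVol hω₀ hf
  refine ⟨μ, isGibbs_of_local fun W U E hU hE => ?_⟩
  have hf := dependsOn_indicator hU
  have hbd : ∀ η, |E.indicator (fun _ => (1 : ℝ)) η| ≤ 1 := fun η => by
    by_cases h : η ∈ E <;> simp [h]
  have h1 := hlim U _ hf ⟨1, hbd⟩
  have h2 := hlim _ _ (S.expect_dependsOn W hf) ⟨1, fun η => abs_expect_le zero_le_one hbd⟩
  have heq : ∫ η, E.indicator (fun _ => (1 : ℝ)) η ∂(μ : Measure (Conf q)) =
      ∫ ω, S.expect W ω (E.indicator fun _ => (1 : ℝ)) ∂(μ : Measure (Conf q)) := by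
    -- As soon as `D` contains `W`, the two finite-volume expectations coincide by `expect_expect`,
    -- so their limits do as well.
    refine tendsto_nhds_unique h1 (h2.congr' ?_)
    filter_upwards [hl (Filter.mem_atTop W)] with D hD
    exact S.expect_expect hD ω₀ _
  rw [integral_indicator_const _ hE, smul_eq_mul, mul_one] at heq
  have hm := measurable_of_dependsOn (S.expect_dependsOn W hf)
  rw [← ENNReal.ofReal_toReal (measure_ne_top (μ : Measure (Conf q)) E), ← Measure.real, heq,
    ofReal_integral_eq_lintegral_ofReal]
  · simp_rw [spec_eq_expect]
  · exact (integrable_const (1 : ℝ)).mono' hm.aestronglyMeasurable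
      (Filter.Eventually.of_forall fun η => abs_expect_le zero_le_one hbd)
  · exact Filter.Eventually.of_forall fun η => S.expect_nonneg fun ζ _ =>
      Set.indicator_nonneg (fun _ _ => zero_le_one) _

/-- Conditioning the specification on positive weight removes only terms that are already zero, so
for every `ω` the event has the same value as the whole space. Consistency then gives it measure
one. -/
lemma IsGibbs.ae_good {μ : Measure (Conf q)} (hμ : S.IsGibbs μ) : ∀ᵐ ω ∂μ, S.Good ω := by
  have := hμ.1
  simp_rw [good_iff]
  rw [ae_all_iff]
  intro G
  have hm : MeasurableSet {ω | 0 < S.weight G ω} :=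
    measurable_of_dependsOn (weight_dependsOn G) measurableSet_Ioi
  refine (prob_compl_eq_zero_iff hm).2 ?_
  rw [hμ.2 G _ hm, ← measure_univ (μ := μ), hμ.2 G _ MeasurableSet.univ]
  refine lintegral_congr fun ω => ?_
  rw [spec_eq_expect, spec_eq_expect, expect, expect]
  congr 2
  refine sumOver_congr fun η _ => ?_
  rcases (S.weight_nonneg (nbhd G) η).eq_or_lt with h | h
  · simp [← h]
  · have : 0 < S.weight G η := by
      rw [weight_pos_iff] at h ⊢
      exact ⟨fun x hx => h.1 x (subset_nbhd G hx),
        fun x hx y hy => h.2 x (subset_nbhd G hx) y (subset_nbhd G hy)⟩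
    simp [this]

lemma spec_cyl_inter {W Λ : Finset Site} (h : Disjoint Λ W) (σ ω : Conf q) (E : Set (Conf q)) :
    ENNReal.ofReal (S.spec W ω (cyl Λ σ ∩ E)) =
      (cyl Λ σ).indicator (fun ω => ENNReal.ofReal (S.spec W ω E)) ω := by
  classical
  have hmem : ∀ η : Conf q, (∀ x ∉ W, η x = ω x) → (η ∈ cyl Λ σ ↔ ω ∈ cyl Λ σ) := fun η hη =>
    forall₂_congr fun x hx => by rw [hη x (Finset.disjoint_left.1 h hx)]
  by_cases hω : ω ∈ cyl Λ σ
  · rw [Set.indicator_of_mem hω, spec_eq_expect, spec_eq_expect]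
    congr 1
    refine S.expect_congr_fun fun η hη => ?_
    simp [Set.indicator_apply, (hmem η hη).2 hω]
  · rw [Set.indicator_of_notMem hω, spec_eq_expect,
      S.expect_congr_fun (g := fun _ => 0 * 0), expect_mul_left, zero_mul, ENNReal.ofReal_zero]
    intro η hη
    simp [mt (hmem η hη).1 hω]

/-- The defining property of Gibbs measures, on a cylinder event off `W`. -/
lemma IsGibbs.setLIntegral_spec {μ : Measure (Conf q)} (hμ : S.IsGibbs μ) {W Λ : Finset Site}
    (h : Disjoint Λ W) (σ : Conf q) {E : Set (Conf q)} (hE : MeasurableSet E) :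
    ∫⁻ ω in cyl Λ σ, ENNReal.ofReal (S.spec W ω E) ∂μ = μ (cyl Λ σ ∩ E) := by
  rw [hμ.2 W _ ((measurableSet_cyl Λ σ).inter hE),
    ← lintegral_indicator (measurableSet_cyl Λ σ)]
  exact lintegral_congr fun ω => (spec_cyl_inter h σ ω E).symm

lemma IsGibbs.feasible_of_measure_cyl_ne_zero {μ : Measure (Conf q)} (hμ : S.IsGibbs μ)
    {Λ : Finset Site} {σ : Conf q} (h : μ (cyl Λ σ) ≠ 0) : ∃ η ∈ cyl Λ σ, S.Good η := by
  by_contra hcon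
  push Not at hcon
  refine h (measure_mono_null (fun η hη => hcon η hη) ?_)
  exact hμ.ae_good

/-- A layer of soft spins around `Λ` joins a feasible pattern on `Λ` to almost every outside
configuration. The specification on `nbhd Λ` therefore gives the cylinder positive probability
almost everywhere. -/
lemma IsGibbs.measure_cyl_pos {μ : Measure (Conf q)} (hμ : S.IsGibbs μ) {s₀ : Fin q}
    (hb : 0 < S.b s₀) (hA : ∀ j, 0 < S.A s₀ j) {Λ : Finset Site} {σ : Conf q}
    (hσ : S.Feasible (Λ : Set Site) σ) : μ (cyl Λ σ) ≠ 0 := by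
  classical
  have := hμ.1
  obtain ⟨ζ, hζ, hgood⟩ := feasible_iff_exists_good.1 hσ
  rw [hμ.2 (nbhd Λ) _ (measurableSet_cyl Λ σ)]
  rw [Ne, lintegral_eq_zero_iff (measurable_ofReal_spec _ (measurableSet_cyl Λ σ))]
  intro h0
  obtain ⟨ω, hω0, hω⟩ := (h0.and hμ.ae_good).exists
  simp only [Pi.zero_apply, ENNReal.ofReal_eq_zero] at hω0
  refine absurd hω0 (not_le.2 ?_)
  have hfar : ∀ x ∈ Λ, ∀ y ∉ nbhd Λ, ¬ gridGraph.Adj x y := fun x hx y hy hxy =>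
    hy (mem_nbhd_of_adj hx hxy)
  obtain ⟨η, h1, -, h3⟩ := exists_good_of_pos_on hb hA (Λ := (Λ : Set Site) ∪ {x | x ∉ nbhd Λ})
    (τ := fun x => if x ∈ Λ then ζ x else ω x) (fun x _ => by
      by_cases hx : x ∈ Λ
      · simpa [hx] using hgood.1 x
      · simpa [hx] using hω.1 x) (fun x hx y hy hxy => by
      by_cases hxΛ : x ∈ Λ <;> by_cases hyΛ : y ∈ Λ
      · simpa [hxΛ, hyΛ] using hgood.2 x y hxy
      · exact absurd hxy (hfar x hxΛ y (hy.resolve_left hyΛ))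
      · exact absurd hxy.symm (hfar y hyΛ x (hx.resolve_left hxΛ))
      · simpa [hxΛ, hyΛ] using hω.2 x y hxy)
  have hcyl : η ∈ cyl Λ σ := fun x hx => by
    rw [h1 x (Or.inl hx)]; simp only [hx, if_true]; exact hζ x hx
  have hoff : ∀ x ∉ nbhd Λ, η x = ω x := fun x hx => by
    rw [h1 x (Or.inr hx)]; simp [mt (fun h => subset_nbhd Λ h) hx]
  rw [spec_eq_expect, S.expect_congr_off (ω' := η) _ fun x hx => (hoff x hx).symm]
  refine div_pos ?_ (h3.partition_pos _ _)
  refine Finset.sum_pos' (fun ξ _ => mul_nonneg (S.weight_nonneg _ _)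
    (Set.indicator_nonneg (fun _ _ => zero_le_one) _)) ⟨fun x => η x, Finset.mem_univ _, ?_⟩
  rw [glue_restrict]
  simp only [Set.indicator_of_mem hcyl, mul_one]
  exact good_iff.1 h3 _

/-- Set weak spatial mixing implies that there is at most one Gibbs measure. -/
theorem ExpWeakSpatialMixing.gibbs_unique (h : S.ExpWeakSpatialMixing) {μ ν : Measure (Conf q)}
    (hμ : S.IsGibbs μ) (hν : S.IsGibbs ν) : μ = ν := by
  classical
  obtain ⟨C, γ, hC, hγ, hf⟩ := h
  have := hμ.1
  have := hν.1
  refine measure_ext_of_cyl fun U σ => ?_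
  obtain ⟨ω₀, hω₀⟩ := hμ.ae_good.exists
  -- Every Gibbs measure is compared with the same finite-volume distribution, whose volume `D`
  -- depends only on `ε` and `U`.
  have key : ∀ ε : ℝ, 0 < ε → ∃ D, ∀ m : Measure (Conf q), S.IsGibbs m →
      |m.real (cyl U σ) - S.spec D ω₀ (cyl U σ)| ≤ ε := by
    intro ε hε
    -- The mixing bound is a tail of a convergent series for each of the finitely many `u`.
    have ht : Filter.Tendsto (fun D : Finset Site => ∑ u ∈ U, ∑' w : {w : Site // w ∉ D},
        ENNReal.ofReal (C * Real.exp (-γ * gridDist u w))) Filter.atTop (nhds 0) := by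
      rw [← Finset.sum_const_zero (s := U)]
      refine tendsto_finsetSum _ fun u _ =>
        ENNReal.tendsto_tsum_compl_atTop_zero (f := fun w : Site =>
          ENNReal.ofReal (C * Real.exp (-γ * gridDist u w))) ?_
      rw [tsum_ofReal_exp_dist hC.le]
      exact ENNReal.mul_ne_top ENNReal.ofReal_ne_top (ENNReal.pow_ne_top (lineSum_ne_top hγ))
    obtain ⟨D, hD, hUD⟩ := ((ht.eventually_lt_const (ENNReal.ofReal_pos.2 hε)).and
      (Filter.eventually_ge_atTop U)).exists
    refine ⟨D, fun m hm => ?_⟩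
    have := hm.1
    have hdist : ∀ ω, S.Good ω → |S.spec D ω (cyl U σ) - S.spec D ω₀ (cyl U σ)| ≤ ε := by
      intro ω hω
      have h1 := (hf.tvDist_le hUD hω hω₀).trans hD.le
      rw [ENNReal.ofReal_le_ofReal_iff hε.le] at h1
      rw [spec_eq_expect, spec_eq_expect]
      refine (abs_expect_sub_le (m := 0) (M := 1) hω hω₀ (fun η _ => ?_) fun η _ _ => ?_).trans
        (by simpa using h1)
      · refine dependsOn_indicator (U := (U : Set Site)) (fun η η' hη => ?_) fun x hx => ?_
        · simp only [mem_cyl, eq_iff_iff]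
          exact forall₂_congr fun x hx => by rw [hη x hx]
        · have hx' : x ∈ U := hx
          simp [glue, hx']
      · by_cases hη : η ∈ cyl U σ <;> simp [hη]
    have hmeas := measurable_ofReal_spec (S := S) D (measurableSet_cyl U σ)
    have hint : Integrable (fun ω => S.spec D ω (cyl U σ)) m := by
      refine (integrable_const (1 : ℝ)).mono' ?_ ?_
      · have := hmeas.ennreal_toReal
        simp only [ENNReal.toReal_ofReal (S.spec_nonneg _ _ _)] at this
        exact this.aestronglyMeasurable
      · filter_upwards [hm.ae_good] with ω hω
        rw [Real.norm_of_nonneg (S.spec_nonneg _ _ _)]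
        exact hω.spec_le_one _ _
    have heq : m.real (cyl U σ) = ∫ ω, S.spec D ω (cyl U σ) ∂m := by
      rw [Measure.real, hm.2 D _ (measurableSet_cyl U σ),
        ← ofReal_integral_eq_lintegral_ofReal hint
          (Filter.Eventually.of_forall fun ω => S.spec_nonneg _ _ _),
        ENNReal.toReal_ofReal (integral_nonneg fun ω => S.spec_nonneg _ _ _)]
    have hc : S.spec D ω₀ (cyl U σ) = ∫ _, S.spec D ω₀ (cyl U σ) ∂m := by simp
    rw [heq, hc, ← integral_sub hint (integrable_const _), ← Real.norm_eq_abs]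
    refine (norm_integral_le_of_norm_le_const (C := ε) ?_).trans (by simp)
    filter_upwards [hm.ae_good] with ω hω using hdist ω hω
  have hreal : μ.real (cyl U σ) = ν.real (cyl U σ) := by
    refine eq_of_abs_sub_le_all fun ε hε => ?_
    obtain ⟨D, hD⟩ := key (ε / 2) (half_pos hε)
    have h1 := hD μ hμ
    have h2 := hD ν hν
    rw [abs_le] at h1 h2 ⊢
    constructor <;> linarith
  rw [Measure.real, Measure.real,
    ENNReal.toReal_eq_toReal_iff' (measure_ne_top _ _) (measure_ne_top _ _)] at hreal
  exact hreal

end SpinSystem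

end LazySampling

namespace LazySampling

variable {q : ℕ}

namespace SpinSystem

variable {S : SpinSystem q}

/-! ### Finite energy -/

/-- The factors that see the spin at `x` are separated from the rest `R`, which cancels when the
conditional law at `x` is formed. -/
lemma weight_nbhd_singleton (S : SpinSystem q) (x : Site) : ∃ R : Conf q → ℝ, (∀ ω, 0 ≤ R ω) ∧
    (∀ ω i, R (update ω x i) = R ω) ∧
    ∃ T : Finset (Site × Site), T.card ≤ 4 ∧ (∀ p ∈ T, p.1 ≠ p.2 ∧ (p.1 = x ∨ p.2 = x)) ∧
      ∀ ω, S.weight (nbhd {x}) ω =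
        R ω * (S.b (ω x) * ∏ p ∈ T, S.A (ω p.1) (ω p.2)) := by
  classical
  set G := nbhd {x} with hG
  have hxG : x ∈ G := subset_nbhd _ (Finset.mem_singleton_self x)
  refine ⟨fun ω => (∏ y ∈ G.erase x, S.b (ω y)) *
    ∏ p ∈ (edgesIn G).filter (fun p => ¬(p.1 = x ∨ p.2 = x)), S.A (ω p.1) (ω p.2),
    fun ω => ?_, fun ω i => ?_,
    (edgesIn G).filter fun p => p.1 = x ∨ p.2 = x, ?_, fun p hp => ?_, fun ω => ?_⟩
  · exact mul_nonneg (Finset.prod_nonneg fun _ _ => S.b_nonneg _)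
      (Finset.prod_nonneg fun _ _ => S.A_nonneg _ _)
  · refine congrArg₂ _ ?_ ?_
    · refine Finset.prod_congr rfl fun y hy => ?_
      rw [Function.update_of_ne (Finset.ne_of_mem_erase hy)]
    · refine Finset.prod_congr rfl fun p hp => ?_
      have := (Finset.mem_filter.1 hp).2
      push Not at this
      rw [Function.update_of_ne this.1, Function.update_of_ne this.2]
  · refine (Finset.card_le_card (t := {(x, x + (1, 0)), (x, x + (0, 1)), (x - (1, 0), x),
      (x - (0, 1), x)}) fun p hp => ?_).trans Finset.card_le_four
    rw [Finset.mem_filter, mem_edgesIn] at hp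
    obtain ⟨a, b⟩ := p
    obtain ⟨⟨-, h⟩, h'⟩ := hp
    simp only [Finset.mem_insert, Finset.mem_singleton, Prod.mk.injEq] at h h' ⊢
    rcases h' with rfl | rfl
    · rcases h with rfl | rfl <;> simp
    · rcases h with rfl | rfl <;> simp
  · rw [Finset.mem_filter, mem_edgesIn] at hp
    exact ⟨(adj_of_step hp.1.2).ne, hp.2⟩
  · rw [weight_eq, ← Finset.mul_prod_erase G _ hxG,
      ← Finset.prod_filter_mul_prod_filter_not (edgesIn G) fun p => p.1 = x ∨ p.2 = x]
    ring

/-- The event that all spins on `N` are `s₀`. -/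
noncomputable def allEq (N : Finset Site) (s₀ : Fin q) : Conf q → ℝ :=
  Set.indicator {η | ∀ x ∈ N, η x = s₀} fun _ => 1

lemma allEq_nonneg (N : Finset Site) (s₀ : Fin q) (η : Conf q) : 0 ≤ allEq N s₀ η :=
  Set.indicator_nonneg (fun _ _ => zero_le_one) _

lemma allEq_le_one (N : Finset Site) (s₀ : Fin q) (η : Conf q) : allEq N s₀ η ≤ 1 := by
  rw [allEq, Set.indicator_apply]; split_ifs <;> norm_num

/-- Finite energy: whatever the neighbours are, the weight of `s₀` at `x` is bounded below and the
total weight bounded above, uniformly in `x` and `ω`. -/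
lemma IsSoft.exists_singleton_lower_bound (hS : S.IsSoft) : ∃ s₀ : Fin q, 0 < S.b s₀ ∧
    (∀ j, 0 < S.A s₀ j) ∧ ∃ c : ℝ, 0 < c ∧ ∀ (x : Site) (ω : Conf q), S.Good ω →
      c ≤ S.expect {x} ω (allEq {x} s₀) := by
  obtain ⟨α, hα, s₀, hb, hA⟩ := hS
  refine ⟨s₀, hb, fun j => hα.trans (hA j), ?_⟩
  -- Taking `a ≥ 1` and `α' ≤ 1` allows products over at most four edges to be compared with fourth
  -- powers.
  set a : ℝ := max 1 (∑ i, ∑ j, S.A i j) with ha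
  have hAa : ∀ i j, S.A i j ≤ a := fun i j =>
    (Finset.single_le_sum (f := fun j => S.A i j) (fun j _ => S.A_nonneg i j)
      (Finset.mem_univ j)).trans ((Finset.single_le_sum (f := fun i => ∑ j, S.A i j)
        (fun i _ => Finset.sum_nonneg fun j _ => S.A_nonneg i j)
        (Finset.mem_univ i)).trans (le_max_right _ _))
  have ha1 : 1 ≤ a := le_max_left _ _
  set α' := min α 1
  have hα' : 0 < α' := lt_min hα one_pos
  set B := ∑ j, S.b j
  have hB : 0 < B := hb.trans_le (Finset.single_le_sum (f := S.b) (fun j _ => S.b_nonneg j)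
    (Finset.mem_univ s₀))
  have hB4 : 0 < a ^ 4 * B := by positivity
  refine ⟨S.b s₀ * α' ^ 4 / (a ^ 4 * B), by positivity, fun x ω hω => ?_⟩
  obtain ⟨R, hR0, hRx, T, hT4, hTx, hw⟩ := S.weight_nbhd_singleton x
  rw [expect, le_div_iff₀ (hω.partition_pos _ _), sumOver_singleton, sumOver_singleton]
  have hnum : S.b s₀ * α' ^ 4 * R ω ≤ ∑ i, S.weight (nbhd {x}) (update ω x i) *
      allEq {x} s₀ (update ω x i) := by
    refine le_trans ?_ (Finset.single_le_sum (fun i _ => mul_nonneg (S.weight_nonneg _ _)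
      (allEq_nonneg _ _ _)) (Finset.mem_univ s₀))
    have h1 : allEq {x} s₀ (update ω x s₀) = 1 := by simp [allEq]
    rw [h1, mul_one, hw, hRx, Function.update_self, mul_comm (R ω)]
    refine mul_le_mul_of_nonneg_right (mul_le_mul_of_nonneg_left ?_ hb.le) (hR0 ω)
    calc α' ^ 4 ≤ α' ^ T.card := pow_le_pow_of_le_one hα'.le (min_le_right _ _) hT4
      _ ≤ _ := by
        rw [← Finset.prod_const]
        refine Finset.prod_le_prod (fun _ _ => hα'.le) fun p hp => (min_le_left _ _).trans ?_
        rcases (hTx p hp).2 with h | h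
        · rw [h, Function.update_self]; exact (hA _).le
        · rw [h, Function.update_self, ← S.symm.apply]; exact (hA _).le
  have hden : ∑ i, S.weight (nbhd {x}) (update ω x i) ≤ R ω * (a ^ 4 * B) := by
    rw [mul_comm (a ^ 4), Finset.sum_mul, Finset.mul_sum]
    refine Finset.sum_le_sum fun i _ => ?_
    rw [hw, hRx, Function.update_self]
    refine mul_le_mul_of_nonneg_left (mul_le_mul_of_nonneg_left ?_ (S.b_nonneg _)) (hR0 ω)
    calc _ ≤ a ^ T.card := by
          rw [← Finset.prod_const]
          exact Finset.prod_le_prod (fun _ _ => S.A_nonneg _ _) fun p _ => hAa _ _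
      _ ≤ a ^ 4 := pow_le_pow_right₀ ha1 hT4
  calc _ ≤ S.b s₀ * α' ^ 4 / (a ^ 4 * B) * (R ω * (a ^ 4 * B)) :=
        mul_le_mul_of_nonneg_left hden (by positivity)
    _ = S.b s₀ * α' ^ 4 * R ω := by field_simp
    _ ≤ _ := hnum

/-- Reveal the sites of `N` one by one: given all other spins, each is `s₀` with probability at
least `c`. -/
lemma Good.pow_le_expect_allEq {s₀ : Fin q} {c : ℝ} (hc : 0 ≤ c)
    (h : ∀ (x : Site) (ω : Conf q), S.Good ω → c ≤ S.expect {x} ω (allEq {x} s₀))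
    (N : Finset Site) {ω : Conf q} (hω : S.Good ω) :
    c ^ N.card ≤ S.expect N ω (allEq N s₀) := by
  induction N using Finset.induction_on generalizing ω with
  | empty =>
    have : allEq (∅ : Finset Site) s₀ = fun _ => 1 := by funext; simp [allEq]
    rw [this, expect_const_of_good hω]; simp
  | insert x N hx ih =>
    rw [Finset.card_insert_of_notMem hx]
    have hmul : ∀ η, allEq (insert x N) s₀ η = allEq N s₀ η * allEq {x} s₀ η := fun η => by
      simp only [allEq, Set.indicator_apply, Set.mem_ofPred_eq, Finset.forall_mem_insert,
        Finset.mem_singleton, forall_eq]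
      split_ifs <;> simp_all
    -- Resampling `x` alone does not change the event on `N`, since `x ∉ N`, so its indicator can be
    -- taken out of the inner expectation.
    have hstep : S.expect (insert x N) ω (allEq (insert x N) s₀) =
        S.expect (insert x N) ω fun η => allEq N s₀ η * S.expect {x} η (allEq {x} s₀) := by
      rw [← S.expect_expect (W' := {x}) (by simp)]
      refine S.expect_congr_fun fun η _ => ?_
      rw [← expect_mul_left]
      refine S.expect_congr_fun fun ζ hζ => ?_
      rw [hmul]
      congr 1
      simp only [allEq, Set.indicator_apply]
      refine if_congr (forall₂_congr fun y hy => ?_) rfl rfl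
      rw [hζ y (by rw [Finset.mem_singleton]; rintro rfl; exact hx hy)]
    calc c ^ (N.card + 1) = c * c ^ N.card := pow_succ' _ _
      _ ≤ c * S.expect (insert x N) ω (allEq N s₀) := by
        refine mul_le_mul_of_nonneg_left ?_ hc
        rw [← S.expect_expect (Finset.subset_insert x N)]
        exact (expect_const_of_good hω (insert x N) _).symm.le.trans
          (hω.expect_mono fun η hη _ => ih hη)
      _ = S.expect (insert x N) ω fun η => c * allEq N s₀ η := (expect_mul_left _ _ _ _ _).symm
      _ ≤ _ := by
        rw [hstep]
        refine hω.expect_mono fun η hη _ => ?_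
        rw [mul_comm]
        exact mul_le_mul_of_nonneg_left (h x η hη) (allEq_nonneg _ _ _)

lemma tvDist_comm (D U : Finset Site) (τ τ' : Conf q) :
    S.tvDist D U τ τ' = S.tvDist D U τ' τ := by
  simp only [tvDist, abs_sub_comm]

/-- Contraction across a layer `N ∪ U`: if the total variation distance on `U` is at most `1/2`
and all spins on `N` are `s₀` with conditional probability at least `c`, then the influence of
the boundary condition on an observable of the layer is smaller than its oscillation. -/
lemma expect_sub_le_of_layer {D N U Λ : Finset Site} {s₀ : Fin q} (hb : 0 < S.b s₀)
    (hA : ∀ j, 0 < S.A s₀ j) {c : ℝ} (hc0 : 0 ≤ c)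
    (hc : ∀ ω, S.Good ω → c ≤ S.expect N ω (allEq N s₀))
    {τ τ' : Conf q} (hτ : S.Good τ) (hτ' : S.Good τ') (hND : N ⊆ D)
    (hΛD : Disjoint Λ D) (hΛ : ∀ x ∈ Λ, τ x = τ' x)
    (htv : S.tvDist D U τ τ' ≤ 1 / 2) {f : Conf q → ℝ}
    (hf : DependsOn f ((N ∪ U ∪ Λ : Finset Site) : Set Site)) {m M : ℝ}
    (hm : ∀ η, S.Good η → (∀ x ∈ Λ, η x = τ x) → m ≤ f η ∧ f η ≤ M) :
    S.expect D τ f - S.expect D τ' f ≤ (1 - c / 2) * (M - m) := by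
  -- Overwriting `N` by `s₀` leaves an observable of the spins on `U` and of the common values on
  -- `Λ`, to which the total variation bound applies.
  set h : Conf q → ℝ := fun ω => f (glue N (fun _ => s₀) ω) with hh
  have hΛN : ∀ x ∈ Λ, x ∉ N := fun x hx hxN => Finset.disjoint_left.1 hΛD hx (hND hxN)
  have hhm : ∀ η, S.Good η → (∀ x ∈ Λ, η x = τ x) → m ≤ h η ∧ h η ≤ M := fun η hη h2 =>
    hm _ (hη.glue_const hb hA N) fun x hx => by rw [glue_of_notMem (hΛN x hx), h2 x hx]
  have heq : ∀ ω η : Conf q, (∀ x ∉ N, η x = ω x) → (∀ x ∈ N, η x = s₀) → f η = h ω := by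
    intro ω η h1 h2
    refine congrArg f (funext fun x => ?_)
    by_cases hx : x ∈ N
    · rw [glue_of_mem hx, h2 x hx]
    · rw [glue_of_notMem hx, h1 x hx]
  -- When `N` is resampled, `f` equals `h` on the event of all `s₀`, of probability at least `c`;
  -- off this event only `f ≤ M` is used.
  have hup : ∀ ω, S.Good ω → (∀ x ∈ Λ, ω x = τ x) →
      S.expect N ω f ≤ c * h ω + (1 - c) * M := by
    intro ω hω hωΛ
    have h1 : S.expect N ω f ≤ S.expect N ω fun η => M + (h ω - M) * allEq N s₀ η := by
      refine hω.expect_mono fun η hη hoff => ?_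
      have hηΛ : ∀ x ∈ Λ, η x = τ x := fun x hx => (hoff x (hΛN x hx)).trans (hωΛ x hx)
      by_cases hs : ∀ x ∈ N, η x = s₀
      · have : allEq N s₀ η = 1 := if_pos hs
        rw [this, heq ω η hoff hs]; linarith
      · have : allEq N s₀ η = 0 := if_neg hs
        rw [this]; linarith [(hm η hη hηΛ).2]
    rw [expect_add, expect_mul_left, expect_const_of_good hω] at h1
    nlinarith [hc ω hω, (hhm ω hω hωΛ).2]
  have hlo : ∀ ω, S.Good ω → (∀ x ∈ Λ, ω x = τ x) →
      c * h ω + (1 - c) * m ≤ S.expect N ω f := by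
    intro ω hω hωΛ
    have h1 : (S.expect N ω fun η => m + (h ω - m) * allEq N s₀ η) ≤ S.expect N ω f := by
      refine hω.expect_mono fun η hη hoff => ?_
      have hηΛ : ∀ x ∈ Λ, η x = τ x := fun x hx => (hoff x (hΛN x hx)).trans (hωΛ x hx)
      by_cases hs : ∀ x ∈ N, η x = s₀
      · have : allEq N s₀ η = 1 := if_pos hs
        rw [this, heq ω η hoff hs]; linarith
      · have : allEq N s₀ η = 0 := if_neg hs
        rw [this]; linarith [(hm η hη hηΛ).1]
    rw [expect_add, expect_mul_left, expect_const_of_good hω] at h1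
    nlinarith [hc ω hω, (hhm ω hω hωΛ).1]
  have e1 : S.expect D τ f ≤ c * S.expect D τ h + (1 - c) * M := by
    rw [← S.expect_expect hND τ f, ← expect_mul_left,
      ← (expect_const_of_good hτ D ((1 - c) * M) :), ← expect_add]
    refine hτ.expect_mono fun η hη hoff => ?_
    exact hup η hη fun x hx => hoff x (Finset.disjoint_left.1 hΛD hx)
  have e2 : c * S.expect D τ' h + (1 - c) * m ≤ S.expect D τ' f := by
    rw [← S.expect_expect hND τ' f, ← expect_mul_left,
      ← (expect_const_of_good hτ' D ((1 - c) * m) :), ← expect_add]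
    refine hτ'.expect_mono fun η hη hoff => ?_
    exact hlo η hη fun x hx => (hoff x (Finset.disjoint_left.1 hΛD hx)).trans (hΛ x hx).symm
  have hor : ∀ η : Conf q, ((∀ x ∉ D, η x = τ x) ∨ ∀ x ∉ D, η x = τ' x) →
      ∀ x ∈ Λ, η x = τ x := by
    rintro η (h1 | h1) x hx
    · exact h1 x (Finset.disjoint_left.1 hΛD hx)
    · exact (h1 x (Finset.disjoint_left.1 hΛD hx)).trans (hΛ x hx).symm
  have e3 := abs_expect_sub_le (h := h) (U := U) (m := m) (M := M) hτ hτ' (fun η hη => by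
    refine hf fun x hx => ?_
    by_cases hxN : x ∈ N
    · rw [glue_of_mem hxN, glue_of_mem hxN]
    rw [glue_of_notMem hxN, glue_of_notMem hxN]
    by_cases hxU : x ∈ U
    · rw [glue_of_mem hxU]
    rw [glue_of_notMem hxU]
    have hx' : x ∈ N ∪ U ∪ Λ := hx
    exact hor η hη x (by simpa [hxN, hxU] using hx')) (fun η hη hη' => hhm η hη (hor η hη'))
  have hmM : m ≤ M := (hm τ hτ fun _ _ => rfl).1.trans (hm τ hτ fun _ _ => rfl).2
  -- The expectations of `h` differ by at most `(M - m)/2`. Together with `e1` and `e2` the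
  -- difference for `f` is at most `c (M - m)/2 + (1 - c)(M - m)`.
  have e4 := (le_abs_self _).trans (e3.trans
    (mul_le_mul_of_nonneg_right htv (sub_nonneg.2 hmM)))
  nlinarith [mul_le_mul_of_nonneg_left e4 hc0]

end SpinSystem

/-! ### Balls and spheres -/

/-- The open `ℓ¹` ball. -/
noncomputable def ball (v : Site) (r : ℕ) : Finset Site :=
  (Finset.Icc (v.1 - r) (v.1 + r) ×ˢ Finset.Icc (v.2 - r) (v.2 + r)).filter (gridDist · v < r)

lemma mem_ball {v u : Site} {r : ℕ} : u ∈ ball v r ↔ gridDist u v < r := by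
  rw [ball, Finset.mem_filter, Finset.mem_product, Finset.mem_Icc, Finset.mem_Icc, gridDist]
  omega

/-- The `ℓ¹` sphere. -/
noncomputable def sphere (v : Site) (r : ℕ) : Finset Site :=
  (Finset.Icc (v.1 - r) (v.1 + r) ×ˢ Finset.Icc (v.2 - r) (v.2 + r)).filter (gridDist · v = r)

lemma mem_sphere {v u : Site} {r : ℕ} : u ∈ sphere v r ↔ gridDist u v = r := by
  rw [sphere, Finset.mem_filter, Finset.mem_product, Finset.mem_Icc, Finset.mem_Icc, gridDist]
  omega

lemma boundary_ball_sdiff (v : Site) (r : ℕ) (Λ : Finset Site) :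
    boundary (ball v r \ Λ) ⊆ sphere v r ∪ Λ := by
  intro u hu
  obtain ⟨hu1, w, hw, hwu⟩ := mem_boundary.1 hu
  simp only [Finset.mem_union, Finset.mem_sdiff, mem_ball, mem_sphere, gridGraph_adj,
    gridDist] at *
  by_cases h : u ∈ Λ
  · exact Or.inr h
  · simp only [h, not_false_eq_true, and_true] at hu1
    exact Or.inl (by omega)

/-- A vertical line meets an `ℓ¹` sphere in at most two points, told apart by whether they lie below
`v` or not. -/
lemma sum_fst_le_of_subset_sphere {v : Site} {r : ℕ} {T : Finset Site} (hT : T ⊆ sphere v r)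
    (g : ℤ → ℝ≥0∞) : ∑ u ∈ T, g u.1 ≤ 2 * ∑' n, g n := by
  classical
  have hinj : Set.InjOn (fun u : Site => (u.1, decide (v.2 ≤ u.2))) T := by
    intro u hu w hw h
    have hu := mem_sphere.1 (hT hu)
    have hw := mem_sphere.1 (hT hw)
    simp only [Prod.mk.injEq, decide_eq_decide, gridDist] at h hu hw
    ext <;> omega
  calc ∑ u ∈ T, g u.1 = ∑ p ∈ T.image (fun u : Site => (u.1, decide (v.2 ≤ u.2))), g p.1 :=
        (Finset.sum_image (f := fun p : ℤ × Bool => g p.1) hinj).symm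
    _ ≤ ∑' p : ℤ × Bool, g p.1 := ENNReal.sum_le_tsum _
    _ = _ := by
        rw [ENNReal.tsum_prod']
        simp [two_mul, ENNReal.tsum_add]

lemma sum_snd_le_of_subset_sphere {v : Site} {r : ℕ} {T : Finset Site} (hT : T ⊆ sphere v r)
    (g : ℤ → ℝ≥0∞) : ∑ u ∈ T, g u.2 ≤ 2 * ∑' n, g n := by
  classical
  have hinj : Set.InjOn (Prod.swap : Site → Site) T := Prod.swap_injective.injOn
  have := sum_fst_le_of_subset_sphere (v := v.swap) (r := r) (T := T.image Prod.swap)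
    (fun u hu => by
      obtain ⟨w, hw, rfl⟩ := Finset.mem_image.1 hu
      have := mem_sphere.1 (hT hw)
      rw [mem_sphere]
      simp only [gridDist, Prod.fst_swap, Prod.snd_swap] at *
      omega) g
  rwa [Finset.sum_image hinj] at this

lemma tsum_indicator_Ico (a b : ℤ) :
    ∑' n : ℤ, (if n ∈ Finset.Ico a b then (1 : ℝ≥0∞) else 0) = ((b - a).toNat : ℝ≥0∞) := by
  rw [tsum_eq_sum (s := Finset.Ico a b) fun n hn => if_neg hn,
    Finset.sum_congr rfl fun n hn => if_pos hn]
  simp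

lemma card_le_of_subset_sphere {v : Site} {r : ℕ} {T : Finset Site} (hT : T ⊆ sphere v r)
    {a b : ℤ} (h : (∀ u ∈ T, u.1 ∈ Finset.Ico a b) ∨ ∀ u ∈ T, u.2 ∈ Finset.Ico a b) :
    T.card ≤ 2 * (b - a).toNat := by
  have key : (T.card : ℝ≥0∞) ≤ 2 * ((b - a).toNat : ℝ≥0∞) := by
    rw [← tsum_indicator_Ico]
    rcases h with h | h
    · refine le_trans ?_ (sum_fst_le_of_subset_sphere hT _)
      rw [Finset.sum_congr rfl fun u hu => if_pos (h u hu)]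
      simp
    · refine le_trans ?_ (sum_snd_le_of_subset_sphere hT _)
      rw [Finset.sum_congr rfl fun u hu => if_pos (h u hu)]
      simp
  exact_mod_cast key

lemma card_sphere_le (v : Site) (r : ℕ) : (sphere v r).card ≤ 2 * (2 * r + 1) := by
  have := card_le_of_subset_sphere (Finset.Subset.refl (sphere v r)) (a := v.1 - r)
    (b := v.1 + r + 1) (Or.inl fun u hu => by
      rw [mem_sphere, gridDist] at hu
      rw [Finset.mem_Ico]; omega)
  omega

end LazySampling

namespace LazySampling

variable {q : ℕ}

/-! ### The influence of distant sites and of two lines -/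

/-- `e^{-γ n}` as an extended non-negative real. -/
noncomputable def decay (γ : ℝ) (n : ℕ) : ℝ≥0∞ := ENNReal.ofReal (Real.exp (-γ * n))

lemma decay_add (γ : ℝ) (m n : ℕ) : decay γ (m + n) = decay γ m * decay γ n := by
  rw [decay, decay, decay, ← ENNReal.ofReal_mul (Real.exp_nonneg _), ← Real.exp_add,
    Nat.cast_add, mul_add]

/-- Half of the rate pays for the minimal distance `s`; the other half keeps the lattice sums
convergent. -/
lemma decay_le {γ : ℝ} (hγ : 0 ≤ γ) {s n : ℕ} (h : s ≤ n) :
    decay γ n ≤ decay (γ / 2) s * decay (γ / 2) n := by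
  rw [decay, decay, decay, ← ENNReal.ofReal_mul (Real.exp_nonneg _), ← Real.exp_add]
  refine ENNReal.ofReal_le_ofReal (Real.exp_le_exp.2 ?_)
  have : (s : ℝ) ≤ n := by exact_mod_cast h
  nlinarith

lemma ofReal_mul_exp {C : ℝ} (hC : 0 ≤ C) (γ : ℝ) (n : ℕ) :
    ENNReal.ofReal (C * Real.exp (-γ * n)) = ENNReal.ofReal C * decay γ n :=
  ENNReal.ofReal_mul hC

lemma tsum_decay_gridDist (γ : ℝ) (u : Site) :
    ∑' w : Site, decay γ (gridDist u w) = lineSum γ ^ 2 := by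
  have := tsum_ofReal_exp_dist zero_le_one γ u
  simpa [decay] using this

lemma tsum_decay_sub (γ : ℝ) (a : ℤ) : ∑' b : ℤ, decay γ (a - b).natAbs = lineSum γ :=
  (Equiv.subLeft a).tsum_eq fun n : ℤ => decay γ n.natAbs

lemma tsum_decay_fst_eq (γ : ℝ) (u : Site) (a : ℤ) :
    ∑' w : Site, (if w.1 = a then decay γ (gridDist u w) else 0) =
      decay γ (u.1 - a).natAbs * lineSum γ := by
  rw [ENNReal.tsum_prod', tsum_eq_single a fun b hb => by simp [hb]]
  simp [gridDist, decay_add, ENNReal.tsum_mul_left, tsum_decay_sub]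

lemma tsum_decay_snd_eq (γ : ℝ) (u : Site) (a : ℤ) :
    ∑' w : Site, (if w.2 = a then decay γ (gridDist u w) else 0) =
      decay γ (u.2 - a).natAbs * lineSum γ := by
  rw [ENNReal.tsum_prod', ENNReal.tsum_comm, tsum_eq_single a fun b hb => by simp [hb]]
  simp [gridDist, decay_add, ENNReal.tsum_mul_right, tsum_decay_sub, mul_comm]

lemma tsum_decay_tail {γ : ℝ} (hγ : 0 ≤ γ) (k : ℕ) (a : ℤ) :
    ∑' n : ℤ, (if k ≤ (n - a).natAbs then decay γ (n - a).natAbs else 0) ≤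
      decay (γ / 2) k * lineSum (γ / 2) := by
  have h : lineSum (γ / 2) = ∑' n : ℤ, decay (γ / 2) (n - a).natAbs :=
    ((Equiv.subRight a).tsum_eq fun n : ℤ => decay (γ / 2) n.natAbs).symm
  rw [h, ← ENNReal.tsum_mul_left]
  refine ENNReal.tsum_le_tsum fun n => ?_
  split_ifs with h
  · exact decay_le hγ h
  · exact zero_le

/-- A site `w` off `D` is either at distance at least `s` from the sphere or on one of two lines.
The first kind costs the size of the sphere times a small factor. For a line, the sum over `w`
decays in the distance of `u` to it, and since each coordinate value occurs at most twice on the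
sphere, the sum over `u` is bounded uniformly in `r`; the `4` is two for each line. -/
lemma sum_far_le {γ : ℝ} (hγ : 0 ≤ γ) {v : Site} {r s k : ℕ} {a b : ℤ}
    {T D : Finset Site} (hT : T ⊆ sphere v r)
    (hfar : ∀ u ∈ T, k ≤ (u.1 - a).natAbs ∧ k ≤ (u.2 - b).natAbs)
    (hD : ∀ w ∉ D, r + s ≤ gridDist w v ∨ w.1 = a ∨ w.2 = b) :
    ∑ u ∈ T, ∑' w : {w : Site // w ∉ D}, decay γ (gridDist u w) ≤
      (2 * (2 * r + 1) : ℕ) * (decay (γ / 2) s * lineSum (γ / 2) ^ 2) +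
        4 * (decay (γ / 2) k * lineSum (γ / 2) * lineSum γ) := by
  classical
  have h1 : ∀ u ∈ T, ∑' w : {w : Site // w ∉ D}, decay γ (gridDist u w) ≤
      decay (γ / 2) s * lineSum (γ / 2) ^ 2 +
        ((if k ≤ (u.1 - a).natAbs then decay γ (u.1 - a).natAbs else 0) * lineSum γ +
          (if k ≤ (u.2 - b).natAbs then decay γ (u.2 - b).natAbs else 0) * lineSum γ) := by
    intro u hu
    rw [if_pos (hfar u hu).1, if_pos (hfar u hu).2, ← tsum_decay_fst_eq, ← tsum_decay_snd_eq,
      ← tsum_decay_gridDist (γ / 2) u, ← ENNReal.tsum_mul_left, ← ENNReal.tsum_add,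
      ← ENNReal.tsum_add]
    refine (tsum_subtype {w : Site | w ∉ D} fun w => decay γ (gridDist u w)).le.trans ?_
    refine ENNReal.tsum_le_tsum fun w => ?_
    by_cases hw : w ∈ D
    · rw [Set.indicator_of_notMem (by simpa using hw)]
      exact zero_le
    · rw [Set.indicator_of_mem (by simpa using hw)]
      rcases hD w hw with h | h | h
      · refine le_trans (decay_le hγ ?_) le_self_add
        have := mem_sphere.1 (hT hu)
        simp only [gridDist] at *
        omega
      · rw [if_pos h]
        exact le_self_add.trans le_add_self
      · rw [if_pos h]
        exact le_add_self.trans le_add_self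
  refine (Finset.sum_le_sum h1).trans ?_
  rw [Finset.sum_add_distrib, Finset.sum_const, nsmul_eq_mul]
  refine add_le_add ?_ ?_
  · gcongr
    exact (Finset.card_le_card hT).trans (card_sphere_le v r)
  · rw [Finset.sum_add_distrib, ← Finset.sum_mul, ← Finset.sum_mul, ← add_mul,
      ← mul_assoc]
    gcongr
    rw [show (4 : ℝ≥0∞) = 2 + 2 by norm_num, add_mul]
    refine add_le_add ?_ ?_
    · refine (sum_fst_le_of_subset_sphere hT fun n : ℤ =>
        if k ≤ (n - a).natAbs then decay γ (n - a).natAbs else 0).trans ?_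
      gcongr
      exact tsum_decay_tail hγ k a
    · refine (sum_snd_le_of_subset_sphere hT fun n : ℤ =>
        if k ≤ (n - b).natAbs then decay γ (n - b).natAbs else 0).trans ?_
      gcongr
      exact tsum_decay_tail hγ k b

lemma tendsto_succ_pow_mul_pow (k : ℕ) {r : ℝ} (h0 : 0 < r) (h1 : r < 1) :
    Filter.Tendsto (fun n : ℕ => ((n : ℝ) + 1) ^ k * r ^ n) Filter.atTop (nhds 0) := by
  have h := (tendsto_pow_const_mul_const_pow_of_abs_lt_one k
    (show |r| < 1 by rwa [abs_of_pos h0])).comp (Filter.tendsto_add_atTop_nat 1)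
  have h' := h.mul_const r⁻¹
  rw [zero_mul] at h'
  refine h'.congr fun n => ?_
  simp only [Function.comp_apply, Nat.cast_add, Nat.cast_one]
  rw [pow_succ r n]
  field_simp

lemma decay_eq_pow (γ : ℝ) (n : ℕ) : decay γ n = ENNReal.ofReal (Real.exp (-γ) ^ n) := by
  rw [decay, ← Real.exp_nat_mul, mul_comm]

/-- The constants of the decoupling estimate. -/
lemma exists_far_bound {C γ : ℝ} (hγ : 0 < γ) : ∃ k s₁ : ℕ, ∀ s, s₁ ≤ s → ∀ r,
    2 * r + 1 ≤ (s + 1) ^ 2 → ENNReal.ofReal C *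
      ((2 * (2 * r + 1) : ℕ) * (decay (γ / 2) s * lineSum (γ / 2) ^ 2) +
        4 * (decay (γ / 2) k * lineSum (γ / 2) * lineSum γ)) ≤ ENNReal.ofReal (1 / 2) := by
  have hγ2 : 0 < γ / 2 := half_pos hγ
  have hr0 := Real.exp_pos (-(γ / 2))
  have hr1 : Real.exp (-(γ / 2)) < 1 := Real.exp_lt_one_iff.2 (neg_lt_zero.2 hγ2)
  have hA := lineSum_ne_top hγ
  have hB := lineSum_ne_top hγ2
  have t1 : Filter.Tendsto (fun k => ENNReal.ofReal C *
      (4 * (decay (γ / 2) k * lineSum (γ / 2) * lineSum γ))) Filter.atTop (nhds 0) := by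
    have h := (ENNReal.tendsto_ofReal (tendsto_succ_pow_mul_pow 0 hr0 hr1))
    simp only [pow_zero, one_mul, ENNReal.ofReal_zero, ← decay_eq_pow] at h
    have h2 := ENNReal.Tendsto.const_mul (a := ENNReal.ofReal C * 4) (ENNReal.Tendsto.mul_const h
      (Or.inr (ENNReal.mul_ne_top hB hA))) (Or.inr (by finiteness))
    rw [zero_mul, mul_zero] at h2
    exact h2.congr fun k => by ring
  have t2 : Filter.Tendsto (fun s : ℕ => ENNReal.ofReal C *
      ((2 * (s + 1) ^ 2 : ℕ) * (decay (γ / 2) s * lineSum (γ / 2) ^ 2))) Filter.atTop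
        (nhds 0) := by
    have h := (ENNReal.tendsto_ofReal (tendsto_succ_pow_mul_pow 2 hr0 hr1))
    rw [ENNReal.ofReal_zero] at h
    have h2 := ENNReal.Tendsto.const_mul (a := ENNReal.ofReal C * 2) (ENNReal.Tendsto.mul_const h
      (b := lineSum (γ / 2) ^ 2) (Or.inr (by finiteness))) (Or.inr (by finiteness))
    rw [zero_mul, mul_zero] at h2
    refine h2.congr fun s => ?_
    rw [ENNReal.ofReal_mul (by positivity), decay_eq_pow,
      show ((s : ℝ) + 1) ^ 2 = (((s + 1) ^ 2 : ℕ) : ℝ) by push_cast; ring, ENNReal.ofReal_natCast]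
    push_cast
    ring
  -- Each of the two contributions gets `1/4`. The width `k` is chosen from the line term alone, so
  -- it does not depend on `s` or `r`, and hence later not on `L`.
  have hq : (0 : ℝ≥0∞) < ENNReal.ofReal (1 / 4) := by simp
  obtain ⟨k, hk⟩ := (t1.eventually_lt_const hq).exists
  obtain ⟨s₁, hs₁⟩ := Filter.eventually_atTop.1 (t2.eventually_lt_const hq)
  refine ⟨k, s₁, fun s hs r hr => ?_⟩
  rw [mul_add, show (1 / 2 : ℝ) = 1 / 4 + 1 / 4 by norm_num,
    ENNReal.ofReal_add (by norm_num) (by norm_num)]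
  refine add_le_add (le_trans ?_ (hs₁ s hs).le) hk.le
  gcongr

/-! ### Strong mixing on the mesh -/

lemma exists_unique_multiple {L : ℕ} (x : ℤ) {R : ℕ} (hR : 2 * R ≤ L) :
    ∃ a : ℤ, ∀ y : ℤ, (L : ℤ) ∣ y → (y - x).natAbs < R → y = a := by
  by_cases h : ∃ y : ℤ, (L : ℤ) ∣ y ∧ (y - x).natAbs < R
  · obtain ⟨a, ha, ha'⟩ := h
    refine ⟨a, fun y hy hy' => ?_⟩
    have := Int.eq_zero_of_abs_lt_dvd (dvd_sub hy ha) (by rw [abs_lt]; omega)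
    omega
  · push Not at h
    -- No multiple of `L` is near `x`, so any value would do.
    exact ⟨0, fun y hy hy' => absurd hy' (not_lt.2 (h y hy))⟩

/-- In an open ball of radius at most `L/2` all multiples of `L` that occur as first coordinates
coincide, and likewise for second coordinates. This is where the geometry of the mesh enters. -/
lemma exists_lines {L : ℕ} (v : Site) {R : ℕ} (hR : 2 * R ≤ L) :
    ∃ a b : ℤ, ∀ w ∈ mesh L, gridDist w v < R → w.1 = a ∨ w.2 = b := by
  obtain ⟨a, ha⟩ := exists_unique_multiple v.1 hR
  obtain ⟨b, hb⟩ := exists_unique_multiple v.2 hR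
  refine ⟨a, b, fun w hw hwv => ?_⟩
  rw [gridDist] at hwv
  exact hw.imp (fun h => ha _ h (by omega)) fun h => hb _ h (by omega)

lemma exists_bounds_of_abs_sub_le {A : Set ℝ} (hA : A.Nonempty) {d : ℝ}
    (h : ∀ x ∈ A, ∀ y ∈ A, |x - y| ≤ d) : ∃ m, ∀ x ∈ A, m ≤ x ∧ x ≤ m + d := by
  obtain ⟨x₀, hx₀⟩ := hA
  have hb : BddBelow A := ⟨x₀ - d, fun y hy => by linarith [(abs_le.1 (h x₀ hx₀ y hy)).2]⟩
  refine ⟨sInf A, fun x hx => ⟨csInf_le hb hx, ?_⟩⟩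
  have : x - d ≤ sInf A := le_csInf ⟨x₀, hx₀⟩ fun y hy => by
    linarith [(abs_le.1 (h x hx y hy)).2]
  linarith

namespace SpinSystem

variable {S : SpinSystem q}

/-- The indicator of the event `η v = i`. -/
noncomputable def spinInd (v : Site) (i : Fin q) : Conf q → ℝ :=
  Set.indicator {η | η v = i} fun _ => 1

lemma spinInd_dependsOn (v : Site) (i : Fin q) : DependsOn (spinInd v i) {v} := by
  intro η η' h
  simp only [spinInd, Set.indicator_apply, Set.mem_ofPred_eq, h v rfl]

lemma expect_ball_dependsOn (v : Site) (r : ℕ) {Λ : Finset Site} (hv : v ∉ Λ) (i : Fin q) :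
    DependsOn (fun ω => S.expect (ball v r \ Λ) ω (spinInd v i))
      ((sphere v r ∪ Λ : Finset Site) : Set Site) := by
  refine expect_dependsOn' (boundary_ball_sdiff v r Λ) ((spinInd_dependsOn v i).mono ?_)
  have h0 : gridDist v v = 0 := by simp [gridDist]
  rw [Set.singleton_subset_iff, Finset.mem_coe, Finset.mem_union, Finset.mem_union,
    Finset.mem_sdiff, mem_sphere, mem_ball, h0]
  rcases Nat.eq_zero_or_pos r with rfl | h
  · exact Or.inl (Or.inl rfl)
  · exact Or.inr ⟨h, hv⟩

/-- Iterating the contraction over concentric spheres around `v`. -/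
theorem abs_expect_ball_sub_le {s₀ : Fin q} (hb : 0 < S.b s₀) (hA : ∀ j, 0 < S.A s₀ j)
    {c : ℝ} (hc0 : 0 < c) (hc1 : c ≤ 1)
    (hc : ∀ (x : Site) (ω : Conf q), S.Good ω → c ≤ S.expect {x} ω (allEq {x} s₀))
    {C γ : ℝ} (hC : 0 ≤ C) (hγ : 0 < γ)
    (hwsm : S.SetWeakSpatialMixing fun n => C * Real.exp (-γ * n)) {k s : ℕ} (hs : 0 < s)
    (hfar : ∀ r, 2 * r + 1 ≤ (s + 1) ^ 2 → ENNReal.ofReal C *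
      ((2 * (2 * r + 1) : ℕ) * (decay (γ / 2) s * lineSum (γ / 2) ^ 2) +
        4 * (decay (γ / 2) k * lineSum (γ / 2) * lineSum γ)) ≤ ENNReal.ofReal (1 / 2))
    {L : ℕ} (hL : L < (s + 1) ^ 2) {v : Site} {Λ : Finset Site} (hΛ : (Λ : Set Site) ⊆ mesh L)
    (hv : v ∉ Λ) (i : Fin q) (n : ℕ) (hn : 2 * (n * s) ≤ L) {τ τ' : Conf q} (hτ : S.Good τ)
    (hτ' : S.Good τ') (hττ' : ∀ x ∈ Λ, τ x = τ' x) :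
    |S.expect (ball v (n * s) \ Λ) τ (spinInd v i) -
      S.expect (ball v (n * s) \ Λ) τ' (spinInd v i)| ≤ (1 - c ^ (8 * k) / 2) ^ n := by
  classical
  induction n generalizing τ τ' with
  | zero =>
    have h01 : ∀ ω, 0 ≤ S.expect (ball v (0 * s) \ Λ) ω (spinInd v i) := fun ω =>
      S.expect_nonneg fun η _ => Set.indicator_nonneg (fun _ _ => zero_le_one) _
    have h1 : ∀ ω, S.Good ω → S.expect (ball v (0 * s) \ Λ) ω (spinInd v i) ≤ 1 := fun ω hω => by
      have := hω.spec_le_one (ball v (0 * s) \ Λ) {η | η v = i}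
      rwa [spec_eq_expect] at this
    rw [pow_zero, abs_le]
    constructor <;> linarith [h01 τ, h01 τ', h1 τ hτ, h1 τ' hτ']
  | succ n ih =>
    set r := n * s with hr
    have hrs : (n + 1) * s = r + s := by rw [hr]; ring
    rw [hrs] at hn ⊢
    obtain ⟨a, b, hab⟩ := exists_lines v hn
    set D := ball v (r + s) \ Λ with hD
    have hsub : ball v r \ Λ ⊆ D := Finset.sdiff_subset_sdiff
      (fun u hu => mem_ball.2 ((mem_ball.1 hu).trans_le (Nat.le_add_right _ _)))
      (Finset.Subset.refl _)
    -- By consistency the marginal for the larger ball is the expectation of `f`. Given `Λ`, `f`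
    -- sees only the sphere of radius `r`, and its oscillation is bounded by the induction
    -- hypothesis.
    set f : Conf q → ℝ := fun ω => S.expect (ball v r \ Λ) ω (spinInd v i) with hfdef
    have hΛD : Disjoint Λ D := Finset.disjoint_sdiff
    -- The part of the sphere near the lines, where mixing is not available. It has at most `8 * k`
    -- sites, since each of two strips of width `2 * k` contains at most `4 * k` sites of the
    -- sphere.
    set N := (sphere v r \ Λ).filter fun u => (u.1 - a).natAbs < k ∨ (u.2 - b).natAbs < k
    set U := (sphere v r \ Λ).filter fun u => ¬((u.1 - a).natAbs < k ∨ (u.2 - b).natAbs < k)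
    have hNUeq : N ∪ U = sphere v r \ Λ := Finset.filter_union_filter_not_eq _ _
    have hsphD : sphere v r \ Λ ⊆ D := Finset.sdiff_subset_sdiff
      (fun u hu => mem_ball.2 (by rw [mem_sphere.1 hu]; omega)) (Finset.Subset.refl _)
    have hND : N ⊆ D := (Finset.filter_subset _ _).trans hsphD
    have hUD : U ⊆ D := (Finset.filter_subset _ _).trans hsphD
    have hNcard : N.card ≤ 8 * k := by
      have hN : N ⊆ (sphere v r).filter (fun u => u.1 ∈ Finset.Ico (a - k) (a + k)) ∪
          (sphere v r).filter (fun u => u.2 ∈ Finset.Ico (b - k) (b + k)) := by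
        intro u hu
        obtain ⟨h1, h2⟩ := Finset.mem_filter.1 hu
        rw [Finset.mem_union, Finset.mem_filter, Finset.mem_filter, Finset.mem_Ico,
          Finset.mem_Ico]
        have h1 := (Finset.mem_sdiff.1 h1).1
        rcases h2 with h2 | h2
        · exact Or.inl ⟨h1, by omega⟩
        · exact Or.inr ⟨h1, by omega⟩
      have c1 := card_le_of_subset_sphere (Finset.filter_subset
        (fun u : Site => u.1 ∈ Finset.Ico (a - k) (a + k)) (sphere v r)) (a := a - k) (b := a + k)
        (Or.inl fun u hu => (Finset.mem_filter.1 hu).2)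
      have c2 := card_le_of_subset_sphere (Finset.filter_subset
        (fun u : Site => u.2 ∈ Finset.Ico (b - k) (b + k)) (sphere v r)) (a := b - k) (b := b + k)
        (Or.inr fun u hu => (Finset.mem_filter.1 hu).2)
      have := (Finset.card_le_card hN).trans (Finset.card_union_le _ _)
      omega
    have hcN : ∀ ω, S.Good ω → c ^ (8 * k) ≤ S.expect N ω (allEq N s₀) := fun ω hω =>
      (pow_le_pow_of_le_one hc0.le hc1 hNcard).trans (hω.pow_le_expect_allEq hc0.le hc N)
    have htv : S.tvDist D U τ τ' ≤ 1 / 2 := by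
      rw [← ENNReal.ofReal_le_ofReal_iff (by norm_num)]
      refine (hwsm.tvDist_le hUD hτ hτ').trans (le_trans ?_ (hfar r (by omega)))
      simp_rw [ofReal_mul_exp hC, ENNReal.tsum_mul_left]
      rw [← Finset.mul_sum]
      gcongr
      refine sum_far_le hγ.le (a := a) (b := b)
        ((Finset.filter_subset _ _).trans Finset.sdiff_subset) (fun u hu => ?_) fun w hw => ?_
      · have := (Finset.mem_filter.1 hu).2
        omega
      · rw [hD, Finset.mem_sdiff, mem_ball, not_and_not_right] at hw
        by_cases h : gridDist w v < r + s
        · exact Or.inr (hab w (hΛ (hw h)) h)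
        · exact Or.inl (not_lt.1 h)
    obtain ⟨m, hm⟩ := exists_bounds_of_abs_sub_le
      (A := f '' {η | S.Good η ∧ ∀ x ∈ Λ, η x = τ x}) (d := (1 - c ^ (8 * k) / 2) ^ n)
      ⟨f τ, τ, ⟨hτ, fun _ _ => rfl⟩, rfl⟩ (by
        rintro _ ⟨η, ⟨h1, h2⟩, rfl⟩ _ ⟨η', ⟨h3, h4⟩, rfl⟩
        exact ih (by omega) h1 h3 fun x hx => (h2 x hx).trans (h4 x hx).symm)
    have hm' : ∀ η, S.Good η → (∀ x ∈ Λ, η x = τ x) →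
        m ≤ f η ∧ f η ≤ m + (1 - c ^ (8 * k) / 2) ^ n := fun η h1 h2 =>
      hm _ ⟨η, ⟨h1, h2⟩, rfl⟩
    have hfdep : DependsOn f ((N ∪ U ∪ Λ : Finset Site) : Set Site) := by
      have := S.expect_ball_dependsOn v r hv i
      rwa [hNUeq, Finset.sdiff_union_self_eq_union]
    have e1 := expect_sub_le_of_layer hb hA (pow_nonneg hc0.le _) hcN hτ hτ' hND hΛD hττ' htv
      hfdep hm'
    have e2 := expect_sub_le_of_layer hb hA (pow_nonneg hc0.le _) hcN hτ' hτ hND hΛD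
      (fun x hx => (hττ' x hx).symm) (by rwa [tvDist_comm]) hfdep
      (fun η h1 h2 => hm' η h1 fun x hx => (h2 x hx).trans (hττ' x hx).symm)
    rw [S.expect_expect hsub, S.expect_expect hsub, add_sub_cancel_left, ← pow_succ'] at e1 e2
    rw [abs_le]
    constructor <;> linarith

/-! ### The marginals used by LAZY and the choice of the scale -/

lemma ball_subset_inner {L n : ℕ} (hL : 0 < L) (hn : 2 * n ≤ L) (v : Site) :
    ball v n ⊆ inner L v := by
  intro u hu
  have h1 := corner_spec hL v.1
  have h2 := corner_spec hL v.2
  rw [mem_ball, gridDist] at hu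
  rw [inner, openSquare, Finset.mem_product, Finset.mem_Ioo, Finset.mem_Ioo]
  dsimp only
  omega

lemma mem_inner_self {L : ℕ} (hL : 0 < L) (v : Site) : v ∈ inner L v := by
  have h1 := corner_spec hL v.1
  have h2 := corner_spec hL v.2
  rw [inner, openSquare, Finset.mem_product, Finset.mem_Ioo, Finset.mem_Ioo]
  dsimp only
  omega

/-- Any polynomial bound suffices, as it competes with a factor exponentially small in `√L`. -/
lemma card_ring_le (L : ℕ) (v : Site) : (ring L v).card ≤ 16 * L ^ 2 := by
  have h1 : (inner L v).card ≤ (2 * L) ^ 2 := by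
    rw [inner, openSquare, Finset.card_product, Int.card_Ioo, Int.card_Ioo, sq]
    exact Nat.mul_le_mul (by omega) (by omega)
  have h2 : (ring L v).card ≤ (inner L v).card * 4 := by
    refine (Finset.card_le_card Finset.sdiff_subset).trans (Finset.card_biUnion_le_card_mul _ _ _
      fun x _ => Finset.card_le_four)
  nlinarith

lemma condMarginal_nonneg (L : ℕ) (Λ : Finset Site) (τ : Conf q) (v : Site) (i : Fin q) :
    0 ≤ condMarginal S L Λ τ v i := S.spec_nonneg _ _ _

lemma condMarginal_congr (L : ℕ) {Λ : Finset Site} {τ τ' : Conf q} (v : Site) (i : Fin q)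
    (h : ∀ x ∈ boundary (inner L v \ Λ) ∪ (if v ∈ inner L v \ Λ then ∅ else {v}), τ x = τ' x) :
    condMarginal S L Λ τ v i = condMarginal S L Λ τ' v i := by
  rw [condMarginal, condMarginal, spec_eq_expect, spec_eq_expect]
  refine S.expect_congr (fun x hx => h x (Finset.mem_union_left _ hx)) fun ξ =>
    spinInd_dependsOn v i fun x hx => ?_
  obtain rfl : x = v := hx
  by_cases hv : x ∈ inner L x \ Λ
  · simp only [glue, hv, dite_true]
  · rw [glue_of_notMem hv, glue_of_notMem hv]
    exact h x (by simp [hv])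

lemma boundary_inner_sdiff (L : ℕ) (v : Site) (Λ : Finset Site) :
    boundary (inner L v \ Λ) ⊆ Λ ∪ ring L v := by
  intro u hu
  obtain ⟨h1, w, hw, hwu⟩ := mem_boundary.1 hu
  by_cases h : u ∈ Λ
  · exact Finset.mem_union_left _ h
  · refine Finset.mem_union_right _ (mem_boundary.2 ⟨fun h2 => h1 (Finset.mem_sdiff.2 ⟨h2, h⟩),
      w, (Finset.mem_sdiff.1 hw).1, hwu⟩)

lemma condMarginal_dependsOn {L : ℕ} (hL : 0 < L) {Λ : Finset Site} {v : Site} (hv : v ∉ Λ)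
    (i : Fin q) : DependsOn (fun τ => condMarginal S L Λ τ v i)
      ((Λ ∪ ring L v : Finset Site) : Set Site) := by
  intro τ τ' h
  refine condMarginal_congr L v i fun x hx => ?_
  rw [if_pos (Finset.mem_sdiff.2 ⟨mem_inner_self hL v, hv⟩), Finset.union_empty] at hx
  exact h x (boundary_inner_sdiff L v Λ hx)

lemma pMin_nonneg (L : ℕ) (Λ : Finset Site) (σ : Conf q) (v : Site) (i : Fin q) :
    0 ≤ pMin S L Λ σ v i := Real.iInf_nonneg fun _ => condMarginal_nonneg _ _ _ _ _

lemma pMin_le {L : ℕ} {Λ : Finset Site} {σ τ : Conf q} (h : ∀ x ∈ Λ, τ x = σ x)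
    (hτ : S.Good τ) (v : Site) (i : Fin q) : pMin S L Λ σ v i ≤ condMarginal S L Λ τ v i :=
  ciInf_le ⟨0, by rintro _ ⟨τ, rfl⟩; exact condMarginal_nonneg _ _ _ _ _⟩
    (⟨τ, h, hτ.feasible _⟩ : {τ : Conf q // (∀ x ∈ Λ, τ x = σ x) ∧
      S.Feasible ((Λ ∪ ring L v : Finset Site) : Set Site) τ})

lemma sum_condMarginal (L : ℕ) (Λ : Finset Site) {τ : Conf q} (hτ : S.Good τ) (v : Site) :
    ∑ i, condMarginal S L Λ τ v i = 1 := by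
  classical
  simp_rw [condMarginal, spec_eq_expect, ← expect_sum]
  refine (S.expect_congr_fun fun η _ => ?_).trans (expect_const_of_good hτ _ 1)
  simp [Set.indicator_apply]

/-- On large meshes, a recursive call is rarely needed. -/
theorem exists_scale (hsoft : S.IsSoft) (hwsm : S.ExpWeakSpatialMixing) :
    ∃ L₀ : ℕ, ∀ L, L₀ < L → ∀ (Λ : Finset Site) (σ : Conf q) (v : Site),
      (Λ : Set Site) ⊆ mesh L → S.Feasible (Λ : Set Site) σ → v ∉ Λ →
        (ring L v).card * (1 - ∑ i, pMin S L Λ σ v i) ≤ 1 / 2 := by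
  obtain ⟨s₀, hb, hA, c, hc0, hc⟩ := hsoft.exists_singleton_lower_bound
  obtain ⟨C, γ, hC, hγ, hmix⟩ := hwsm
  obtain ⟨k, s₁, hk⟩ := exists_far_bound hγ (C := C)
  have hgood : S.Good fun _ => s₀ := ⟨fun _ => hb, fun _ _ _ => hA _⟩
  have hc1 : c ≤ 1 := (hc 0 _ hgood).trans (by
    rw [← expect_const_of_good hgood {0} 1]
    exact hgood.expect_mono fun η _ _ => allEq_le_one _ _ _)
  set ρ := 1 - c ^ (8 * k) / 2 with hρ
  have hck : 0 < c ^ (8 * k) := pow_pos hc0 _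
  have hck1 : c ^ (8 * k) ≤ 1 := pow_le_one₀ hc0.le hc1
  have hρ0 : 0 < ρ := by linarith
  have hρ1 : ρ < 1 := by linarith
  -- The product of the two bounds proved below: with `L ≤ (2 (n + 1))²` the square has at most `16
  -- L² ≤ 256 (n + 1)⁴` sites, and `1 - ∑ p` is at most `q ρ^n`.
  have ht := (tendsto_succ_pow_mul_pow 4 hρ0 hρ1).const_mul (256 * q : ℝ)
  rw [mul_zero] at ht
  obtain ⟨n₁, hn₁⟩ := Filter.eventually_atTop.1
    (ht.eventually_lt_const (show (0 : ℝ) < 1 / 2 by norm_num))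
  refine ⟨(s₁ + 2 * n₁ + 2) ^ 2, fun L hL Λ σ v hΛ hσ hv => ?_⟩
  -- Spheres at spacing `s` of order `√L`, and `n = s / 2` of them so that `n * s ≤ L / 2`. The
  -- threshold on `L` makes `s ≥ s₁` and `n ≥ n₁`.
  set s := L.sqrt with hs
  have hsL : s ^ 2 ≤ L := Nat.sqrt_le' L
  have hLs : L < (s + 1) ^ 2 := Nat.lt_succ_sqrt' L
  have hss : s₁ + 2 * n₁ + 2 ≤ s := Nat.le_sqrt'.2 hL.le
  have hL0 : 0 < L := (Nat.zero_le _).trans_lt hL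
  set n := s / 2 with hn
  have hns : 2 * (n * s) ≤ L := by nlinarith [Nat.div_mul_le_self s 2]
  have hmixv : ∀ (i : Fin q) (τ τ' : Conf q), S.Good τ → S.Good τ' → (∀ x ∈ Λ, τ x = σ x) →
      (∀ x ∈ Λ, τ' x = σ x) →
      condMarginal S L Λ τ v i ≤ condMarginal S L Λ τ' v i + ρ ^ n := by
    intro i τ τ' hτ hτ' h h'
    obtain ⟨m, hm⟩ := exists_bounds_of_abs_sub_le
      (A := (fun ω => S.expect (ball v (n * s) \ Λ) ω (spinInd v i)) ''
        {η | S.Good η ∧ ∀ x ∈ Λ, η x = σ x}) (d := ρ ^ n) ⟨_, τ, ⟨hτ, h⟩, rfl⟩ (by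
        rintro _ ⟨η, ⟨h1, h2⟩, rfl⟩ _ ⟨η', ⟨h3, h4⟩, rfl⟩
        exact abs_expect_ball_sub_le hb hA hc0 hc1 hc hC.le hγ hmix (by omega)
          (hk s (by omega)) hLs hΛ hv i n hns h1 h3 fun x hx => (h2 x hx).trans (h4 x hx).symm)
    have hsub : ball v (n * s) \ Λ ⊆ inner L v \ Λ :=
      Finset.sdiff_subset_sdiff (ball_subset_inner hL0 hns v) (Finset.Subset.refl _)
    have hoff : ∀ x ∈ Λ, x ∉ inner L v \ Λ := fun x hx h => (Finset.mem_sdiff.1 h).2 hx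
    have e1 : condMarginal S L Λ τ v i ≤ m + ρ ^ n := by
      rw [condMarginal, spec_eq_expect, ← S.expect_expect hsub,
        ← expect_const_of_good hτ (inner L v \ Λ) (m + ρ ^ n)]
      exact hτ.expect_mono fun η h1 h2 =>
        (hm _ ⟨η, ⟨h1, fun x hx => (h2 x (hoff x hx)).trans (h x hx)⟩, rfl⟩).2
    have e2 : m ≤ condMarginal S L Λ τ' v i := by
      rw [condMarginal, spec_eq_expect, ← S.expect_expect hsub,
        ← expect_const_of_good hτ' (inner L v \ Λ) m]
      exact hτ'.expect_mono fun η h1 h2 =>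
        (hm _ ⟨η, ⟨h1, fun x hx => (h2 x (hoff x hx)).trans (h' x hx)⟩, rfl⟩).1
    linarith
  obtain ⟨τ₀, hτ₀, hτ₀g⟩ := feasible_iff_exists_good.1 hσ
  have hp : ∀ i, condMarginal S L Λ τ₀ v i - ρ ^ n ≤ pMin S L Λ σ v i := by
    intro i
    have : Nonempty {τ : Conf q // (∀ x ∈ Λ, τ x = σ x) ∧
      S.Feasible ((Λ ∪ ring L v : Finset Site) : Set Site) τ} := ⟨⟨τ₀, hτ₀, hτ₀g.feasible _⟩⟩
    refine le_ciInf fun ⟨τ, h1, h2⟩ => ?_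
    obtain ⟨η, h3, h4⟩ := feasible_iff_exists_good.1 h2
    have := hmixv i τ₀ η hτ₀g h4 hτ₀ fun x hx =>
      (h3 x (Finset.mem_coe.2 (Finset.mem_union_left _ hx))).trans (h1 x hx)
    -- The minimum runs over `τ` that are merely feasible on `Λ ∪ Γ_v`; the marginal does not change
    -- when `τ` is replaced by a good extension.
    have e : condMarginal S L Λ η v i = condMarginal S L Λ τ v i :=
      condMarginal_dependsOn hL0 hv i fun x hx => h3 x hx
    linarith
  have hsum : 1 - ∑ i, pMin S L Λ σ v i ≤ q * ρ ^ n := by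
    have := Finset.sum_le_sum fun i (_ : i ∈ Finset.univ) => hp i
    rw [Finset.sum_sub_distrib, sum_condMarginal L Λ hτ₀g v] at this
    simp only [Finset.sum_const, Finset.card_univ, Fintype.card_fin, nsmul_eq_mul] at this
    linarith
  have hring : ((ring L v).card : ℝ) ≤ 256 * ((n : ℝ) + 1) ^ 4 := by
    have h1 : L ≤ (2 * (n + 1)) ^ 2 := hLs.le.trans (Nat.pow_le_pow_left (by omega) 2)
    have h2 : (ring L v).card ≤ 256 * (n + 1) ^ 4 := by
      refine (card_ring_le L v).trans ?_
      calc 16 * L ^ 2 ≤ 16 * ((2 * (n + 1)) ^ 2) ^ 2 := by gcongr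
        _ = 256 * (n + 1) ^ 4 := by ring
    exact_mod_cast h2
  calc ((ring L v).card : ℝ) * (1 - ∑ i, pMin S L Λ σ v i)
      ≤ (ring L v).card * (q * ρ ^ n) := by gcongr
    _ ≤ 256 * ((n : ℝ) + 1) ^ 4 * (q * ρ ^ n) := by gcongr
    _ = 256 * q * (((n : ℝ) + 1) ^ 4 * ρ ^ n) := by ring
    _ ≤ 1 / 2 := (hn₁ n (by omega)).le

end SpinSystem

end LazySampling

namespace LazySampling

variable {q : ℕ}

/-! ### Measurable functions with countable range -/

/-- A function with countable range and measurable fibres. -/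
structure CountablyMeasurable {Ω β : Type*} [MeasurableSpace Ω] (F : Ω → β) : Prop where
  countable : (Set.range F).Countable
  measurableSet_fiber : ∀ b, MeasurableSet (F ⁻¹' {b})

namespace CountablyMeasurable

variable {Ω β γ : Type*} [MeasurableSpace Ω]

lemma const (b : β) : CountablyMeasurable fun _ : Ω => b :=
  ⟨(Set.countable_singleton b).mono (by rintro _ ⟨_, rfl⟩; rfl), fun c => by
    by_cases h : b = c <;> simp [h]⟩

/-- Decompose along the countably many values of `F`. This handles programs whose later steps depend
on earlier results, without a σ-algebra on the states. -/
lemma eval {F : Ω → β} (hF : CountablyMeasurable F) {G : β → Ω → γ}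
    (hG : ∀ b, CountablyMeasurable (G b)) : CountablyMeasurable fun ω => G (F ω) ω := by
  refine ⟨(hF.countable.biUnion fun b _ => (hG b).countable).mono ?_, fun c => ?_⟩
  · rintro _ ⟨ω, rfl⟩
    exact Set.mem_biUnion ⟨ω, rfl⟩ ⟨ω, rfl⟩
  · have : (fun ω => G (F ω) ω) ⁻¹' {c} = ⋃ b ∈ Set.range F, F ⁻¹' {b} ∩ G b ⁻¹' {c} := by
      ext ω
      simp only [Set.mem_iUnion, exists_prop, Set.mem_inter_iff, Set.mem_preimage,
        Set.mem_singleton_iff, Set.mem_range]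
      exact ⟨fun h => ⟨F ω, ⟨ω, rfl⟩, rfl, h⟩, by rintro ⟨b, -, rfl, h⟩; exact h⟩
    rw [this]
    exact .biUnion hF.countable fun b _ =>
      (hF.measurableSet_fiber b).inter ((hG b).measurableSet_fiber c)

lemma measurable_eval {δ : Type*} [MeasurableSpace δ] {F : Ω → β} (hF : CountablyMeasurable F)
    {h : β → Ω → δ} (hh : ∀ b, Measurable (h b)) : Measurable fun ω => h (F ω) ω := by
  intro T hT
  have : (fun ω => h (F ω) ω) ⁻¹' T = ⋃ b ∈ Set.range F, F ⁻¹' {b} ∩ h b ⁻¹' T := by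
    ext ω
    simp only [Set.mem_iUnion, exists_prop, Set.mem_inter_iff, Set.mem_preimage,
      Set.mem_singleton_iff, Set.mem_range]
    exact ⟨fun h => ⟨F ω, ⟨ω, rfl⟩, rfl, h⟩, by rintro ⟨b, -, rfl, h⟩; exact h⟩
  rw [this]
  exact .biUnion hF.countable fun b _ => (hF.measurableSet_fiber b).inter (hh b hT)

lemma comp {Ω' : Type*} [MeasurableSpace Ω'] {F : Ω → β} (hF : CountablyMeasurable F)
    {φ : Ω' → Ω} (hφ : Measurable φ) : CountablyMeasurable fun ω => F (φ ω) :=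
  ⟨hF.countable.mono (Set.range_comp_subset_range φ F), fun b => hφ (hF.measurableSet_fiber b)⟩

lemma bind {α : Type*} {F : Ω → Option α} (hF : CountablyMeasurable F)
    {G : α → Ω → Option γ} (hG : ∀ a, CountablyMeasurable (G a)) :
    CountablyMeasurable fun ω => (F ω).bind fun a => G a ω :=
  hF.eval (G := fun o ω => o.bind fun a => G a ω) fun o => by
    cases o with
    | none => exact const none
    | some a => exact hG a

lemma map {F : Ω → β} (hF : CountablyMeasurable F) (g : β → γ) :
    CountablyMeasurable fun ω => g (F ω) := hF.eval fun b => const (g b)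

lemma ite {p : Ω → Prop} [DecidablePred p] (hp : MeasurableSet {ω | p ω}) {F G : Ω → β}
    (hF : CountablyMeasurable F) (hG : CountablyMeasurable G) :
    CountablyMeasurable fun ω => if p ω then F ω else G ω := by
  refine ⟨(hF.countable.union hG.countable).mono ?_, fun b => ?_⟩
  · rintro _ ⟨ω, rfl⟩
    dsimp only
    split_ifs
    exacts [Or.inl ⟨ω, rfl⟩, Or.inr ⟨ω, rfl⟩]
  · have : (fun ω => if p ω then F ω else G ω) ⁻¹' {b} =
        {ω | p ω} ∩ F ⁻¹' {b} ∪ {ω | p ω}ᶜ ∩ G ⁻¹' {b} := by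
      ext ω; by_cases h : p ω <;> simp [h]
    rw [this]
    exact (hp.inter (hF.measurableSet_fiber b)).union (hp.compl.inter (hG.measurableSet_fiber b))

end CountablyMeasurable

/-! ### The search for a spin -/

lemma countablyMeasurable_find {Ω ι : Type*} [MeasurableSpace Ω] {P : ι → Ω → Prop}
    [∀ i ω, Decidable (P i ω)] (hP : ∀ i, MeasurableSet {ω | P i ω}) (l : List ι) :
    CountablyMeasurable fun ω => l.find? fun i => decide (P i ω) := by
  induction l with
  | nil => exact .const none
  | cons i l ih =>
    have : (fun ω => (i :: l).find? fun i => decide (P i ω)) = fun ω =>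
        if P i ω then some i else l.find? fun i => decide (P i ω) := by
      funext ω
      by_cases h : P i ω <;> simp [h]
    rw [this]
    exact .ite (hP i) (.const _) ih

lemma countablyMeasurable_pick (a : ℝ) (r : Fin q → ℝ) : CountablyMeasurable (pick a r) := by
  refine countablyMeasurable_find (P := fun i y => a + ∑ j ∈ Finset.Iio i, r j ≤ y ∧
    y < a + ∑ j ∈ Finset.Iic i, r j) (fun i => ?_) _
  exact measurableSet_Ico

lemma pick_spec {a : ℝ} {r : Fin q → ℝ} {y : ℝ} {i : Fin q} (h : pick a r y = some i) :
    y ∈ Set.Ico (a + ∑ j ∈ Finset.Iio i, r j) (a + ∑ j ∈ Finset.Iio i, r j + r i) := by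
  have := List.find?_some h
  rw [decide_eq_true_eq, ← Finset.Iio_insert, Finset.sum_insert (by simp)] at this
  exact ⟨this.1, by linarith [this.2]⟩

/-- The intervals are consecutive: a point to the right of the first left end that misses every
interval passes their right ends one after another. -/
lemma le_of_pick_eq_none {a : ℝ} {r : Fin q → ℝ} {y : ℝ} (h : pick a r y = none) (ha : a ≤ y) :
    a + ∑ i, r i ≤ y := by
  rw [pick, List.find?_eq_none] at h
  have key : ∀ k ≤ q, a + ∑ j with (j : Fin q).val < k, r j ≤ y := by
    intro k
    induction k with
    | zero => intro _; simpa using ha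
    | succ k ih =>
      intro hk
      have h1 := h ⟨k, hk⟩ (List.mem_finRange _)
      rw [decide_eq_true_eq, not_and, not_lt] at h1
      have e1 : Finset.Iio (⟨k, hk⟩ : Fin q) = Finset.univ.filter fun j : Fin q => j.val < k := by
        ext j; simp [Fin.lt_def]
      have e2 : Finset.Iic (⟨k, hk⟩ : Fin q) =
          Finset.univ.filter fun j : Fin q => j.val < k + 1 := by
        ext j; simp [Fin.le_def]
      rw [e1, e2] at h1
      exact h1 (ih (by omega))
  simpa using key q le_rfl

lemma volume_unitInterval_le (s : Set ℝ) :
    volume {x : unitInterval | (x : ℝ) ∈ s} ≤ volume s := by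
  rw [unitInterval.volume_apply]
  exact measure_mono (by rintro _ ⟨x, hx, rfl⟩; exact hx)

/-- An upper bound suffices for domination, so it does not matter whether the interval lies in `[0,
1]` or whether `r i` is negative. -/
lemma volume_pick_le (a : ℝ) (r : Fin q → ℝ) (i : Fin q) :
    volume {x : unitInterval | pick a r x = some i} ≤ ENNReal.ofReal (r i) := by
  refine (measure_mono (t := {x : unitInterval | (x : ℝ) ∈ Set.Ico (a + ∑ j ∈ Finset.Iio i, r j)
    (a + ∑ j ∈ Finset.Iio i, r j + r i)}) fun x hx => pick_spec hx).trans
      ((volume_unitInterval_le _).trans ?_)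
  rw [Real.volume_Ico]
  exact ENNReal.ofReal_le_ofReal (by linarith)

lemma volume_pick_none_le (r : Fin q → ℝ) :
    volume {x : unitInterval | pick 0 r x = none} ≤ ENNReal.ofReal (1 - ∑ i, r i) := by
  have : {x : unitInterval | pick 0 r x = none} ⊆
      {x : unitInterval | (x : ℝ) ∈ Set.Icc (∑ i, r i) 1} := fun x hx =>
    ⟨by simpa using le_of_pick_eq_none hx x.2.1, x.2.2⟩
  refine (measure_mono this).trans ((volume_unitInterval_le _).trans ?_)
  rw [Real.volume_Icc]

lemma measurableSet_pick (a : ℝ) (r : Fin q → ℝ) (o : Option (Fin q)) :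
    MeasurableSet {x : unitInterval | pick a r x = o} :=
  measurable_subtype_coe ((countablyMeasurable_pick a r).measurableSet_fiber o)

/-! ### The random tape -/

abbrev Tape : Type := ℕ → unitInterval

/-- The tape `y` from position `c` on. -/
def shift (c : ℕ) (y : Tape) : Tape := fun k => y (k + c)

/-- The tape with first entry `x` and remaining entries `z`. -/
def consTape (x : unitInterval) (z : Tape) : Tape
  | 0 => x
  | k + 1 => z k

lemma shift_add (c d : ℕ) (y : Tape) : shift (c + d) y = shift c (shift d y) := by
  funext k; simp only [shift, add_assoc]

lemma shift_zero (y : Tape) : shift 0 y = y := rfl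

lemma measurable_shift (c : ℕ) : Measurable (shift c) :=
  measurable_pi_lambda _ fun k => measurable_pi_apply (k + c)

lemma measurable_consTape : Measurable fun p : unitInterval × Tape => consTape p.1 p.2 := by
  refine measurable_pi_lambda _ fun k => ?_
  cases k with
  | zero => exact measurable_fst
  | succ k => exact (measurable_pi_apply k).comp measurable_snd

instance : IsProbabilityMeasure tape := by unfold tape; infer_instance

/-- Prepending an independent uniform entry to a random tape gives a random tape; it suffices to
compare boxes. -/
lemma map_consTape :
    ((volume : Measure unitInterval).prod tape).map (fun p => consTape p.1 p.2) = tape := by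
  refine Measure.eq_infinitePi _ fun s t ht => ?_
  obtain ⟨N, hN⟩ : ∃ N, s ⊆ Finset.range (N + 1) :=
    ⟨s.sup id, fun k hk => Finset.mem_range.2 (Nat.lt_succ_of_le (Finset.le_sup (f := id) hk))⟩
  -- The box is padded to an initial segment of indices, on which splitting off the entry `0` and
  -- shifting the others is possible.
  set t' : ℕ → Set unitInterval := fun k => if k ∈ s then t k else Set.univ with ht'
  have ht'm : ∀ k, MeasurableSet (t' k) := fun k => by
    by_cases h : k ∈ s
    · simpa [ht', h] using ht k
    · simp [ht', h]
  have h1 : Set.pi (s : Set ℕ) t = Set.pi (Finset.range (N + 1) : Set ℕ) t' := by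
    ext y
    simp only [Set.mem_pi, Finset.mem_coe]
    refine ⟨fun h k _ => ?_, fun h k hk => by simpa [ht', hk] using h k (hN hk)⟩
    by_cases hk : k ∈ s
    · simpa [ht', hk] using h k hk
    · simp [ht', hk]
  have h2 : ∏ k ∈ s, (volume : Measure unitInterval) (t k) =
      ∏ k ∈ Finset.range (N + 1), (volume : Measure unitInterval) (t' k) := by
    rw [← Finset.prod_subset hN fun k _ hk => by simp [ht', hk]]
    exact Finset.prod_congr rfl fun k hk => by simp [ht', hk]
  have h3 : (fun p : unitInterval × Tape => consTape p.1 p.2) ⁻¹'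
      Set.pi (Finset.range (N + 1) : Set ℕ) t' =
      t' 0 ×ˢ Set.pi (Finset.range N : Set ℕ) fun k => t' (k + 1) := by
    ext ⟨x, z⟩
    simp only [Set.mem_preimage, Set.mem_pi, Finset.mem_coe, Finset.mem_range, Set.mem_prod]
    refine ⟨fun h => ⟨h 0 (by omega), fun k hk => h (k + 1) (by omega)⟩, fun h k hk => ?_⟩
    cases k with
    | zero => exact h.1
    | succ k => exact h.2 k (by omega)
  rw [h2, h1, Measure.map_apply measurable_consTape
    (.pi (Finset.countable_toSet _) fun k _ => ht'm k), h3, Measure.prod_prod, tape,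
    Measure.infinitePi_pi _ fun k _ => ht'm (k + 1), Finset.prod_range_succ', mul_comm]

lemma lintegral_tape {F : Tape → ℝ≥0∞} (hF : Measurable F) :
    ∫⁻ y, F y ∂tape = ∫⁻ x, ∫⁻ z, F (consTape x z) ∂tape ∂(volume : Measure unitInterval) := by
  conv_lhs => rw [← map_consTape]
  rw [lintegral_map hF measurable_consTape]
  exact lintegral_prod _ (hF.comp measurable_consTape).aemeasurable

/-! ### Sequential calls of a sampler -/

/-- The state with `c` further calls. -/
def addCalls (c : ℕ) (s : State q) : State q := ⟨s.known, s.spin, s.calls + c⟩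

/-- A functional of the spins and the remaining tape, evaluated after a computation. -/
noncomputable def after (o : Option (State q)) (Ψ : Conf q → Tape → ℝ≥0∞) (y : Tape) : ℝ≥0∞ :=
  o.elim 0 fun s => Ψ s.spin (shift s.calls y)

/-- The number of calls of a computation, or `t` if it fails. -/
noncomputable def cost (t : ℝ≥0∞) (o : Option (State q)) : ℝ≥0∞ := o.elim t fun s => s.calls

lemma after_map_addCalls (c : ℕ) (o : Option (State q)) (Ψ : Conf q → Tape → ℝ≥0∞) (y : Tape) :
    after (o.map (addCalls c)) Ψ y = after o Ψ (shift c y) := by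
  cases o with
  | none => rfl
  | some s => simp [after, addCalls, shift_add]

lemma cost_map_addCalls_le (c : ℕ) (t : ℝ≥0∞) (o : Option (State q)) :
    cost t (o.map (addCalls c)) ≤ c + cost t o := by
  cases o with
  | none => exact le_add_self
  | some s => simp [cost, addCalls, add_comm]

lemma measurable_after {F : Tape → Option (State q)} (hF : CountablyMeasurable F)
    {Ψ : Conf q → Tape → ℝ≥0∞} (hΨ : ∀ η, Measurable (Ψ η)) :
    Measurable fun y => after (F y) Ψ y :=
  hF.measurable_eval (h := fun o y => after o Ψ y) fun o => by
    cases o with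
    | none => exact measurable_const
    | some s => exact (hΨ _).comp (measurable_shift _)

lemma measurable_cost {F : Tape → Option (State q)} (hF : CountablyMeasurable F) (t : ℝ≥0∞) :
    Measurable fun y => cost t (F y) :=
  hF.measurable_eval (h := fun o _ => cost t o) fun _ => measurable_const

/-- The properties of LAZY with bounded depth on which the analysis of sequential calls rests: it
reads the tape from the current counter on, it adds one site, and its output law is dominated by
the conditional law of the spin under `μ`. -/
structure IsSampler (μ : Measure (Conf q)) (call : Tape → State q → Site → Option (State q)) :
    Prop where
  call_addCalls : ∀ c y s v, call y (addCalls c s) v = (call (shift c y) s v).map (addCalls c)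
  known : ∀ y s v s', call y s v = some s' → s'.known = insert v s.known
  countablyMeasurable : ∀ s v, CountablyMeasurable fun y => call y s v
  dominated : ∀ (Λ : Finset Site) (σ : Conf q) (v : Site), v ∉ Λ →
    ∀ Ψ : Conf q → Tape → ℝ≥0∞, (∀ η, Measurable (Ψ η)) →
      μ (cyl Λ σ) * ∫⁻ y, after (call y ⟨Λ, σ, 0⟩ v) Ψ y ∂tape ≤
        ∑ i, μ (cyl (insert v Λ) (update σ v i)) * ∫⁻ z, Ψ (update σ v i) z ∂tape

lemma foldlM_addCalls {call call' : State q → Site → Option (State q)} {c : ℕ}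
    (h : ∀ s v, call (addCalls c s) v = (call' s v).map (addCalls c)) (ws : List Site)
    (s : State q) : ws.foldlM call (addCalls c s) = (ws.foldlM call' s).map (addCalls c) := by
  induction ws generalizing s with
  | nil => rfl
  | cons v ws ih =>
    rw [List.foldlM_cons, List.foldlM_cons, h]
    cases call' s v with
    | none => rfl
    | some s' => exact ih s'

namespace IsSampler

variable {μ : Measure (Conf q)} {call : Tape → State q → Site → Option (State q)}

lemma foldlM_known (h : IsSampler μ call) {y : Tape} {ws : List Site} {s s' : State q}
    (hs : ws.foldlM (call y) s = some s') : s'.known = s.known ∪ ws.toFinset := by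
  induction ws generalizing s with
  | nil =>
    obtain rfl : s = s' := by simpa using hs
    simp
  | cons v ws ih =>
    rw [List.foldlM_cons, Option.bind_eq_bind, Option.bind_eq_some_iff] at hs
    obtain ⟨s₁, h1, h2⟩ := hs
    rw [ih h2, h.known _ _ _ _ h1, List.toFinset_cons, Finset.insert_union, Finset.union_insert]

lemma countablyMeasurable_foldlM (h : IsSampler μ call) (ws : List Site) (s : State q) :
    CountablyMeasurable fun y => ws.foldlM (call y) s := by
  induction ws generalizing s with
  | nil => exact .const _
  | cons v ws ih => exact (h.countablyMeasurable s v).bind fun s' => ih s'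

lemma foldlM_eq (h : IsSampler μ call) (y : Tape) (ws : List Site) (s : State q) :
    ws.foldlM (call y) s = (ws.foldlM (call (shift s.calls y)) ⟨s.known, s.spin, 0⟩).map
      (addCalls s.calls) := by
  have := foldlM_addCalls (h.call_addCalls s.calls y) ws ⟨s.known, s.spin, 0⟩
  rw [← this]
  simp [addCalls]

/-- The restart property: after the first call, the remaining calls run as if from counter zero on
the unread part of the tape. -/
lemma after_foldlM_cons (h : IsSampler μ call) (y : Tape) (Λ : Finset Site) (σ : Conf q)
    (v : Site) (ws : List Site) (Ψ : Conf q → Tape → ℝ≥0∞) :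
    after ((v :: ws).foldlM (call y) ⟨Λ, σ, 0⟩) Ψ y = after (call y ⟨Λ, σ, 0⟩ v)
      (fun η z => after (ws.foldlM (call z) ⟨insert v Λ, η, 0⟩) Ψ z) y := by
  rw [List.foldlM_cons]
  cases hc : call y ⟨Λ, σ, 0⟩ v with
  | none => rfl
  | some s' =>
    change after (ws.foldlM (call y) s') Ψ y = _
    rw [h.foldlM_eq, after_map_addCalls, h.known _ _ _ _ hc]
    rfl

lemma cost_foldlM_cons_le (h : IsSampler μ call) (t : ℝ≥0∞) (y : Tape) (Λ : Finset Site)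
    (σ : Conf q) (v : Site) (ws : List Site) :
    cost t ((v :: ws).foldlM (call y) ⟨Λ, σ, 0⟩) ≤ cost t (call y ⟨Λ, σ, 0⟩ v) +
      after (call y ⟨Λ, σ, 0⟩ v)
        (fun η z => cost t (ws.foldlM (call z) ⟨insert v Λ, η, 0⟩)) y := by
  rw [List.foldlM_cons]
  cases hc : call y ⟨Λ, σ, 0⟩ v with
  | none => exact le_self_add
  | some s' =>
    change cost t (ws.foldlM (call y) s') ≤ _
    rw [h.foldlM_eq, h.known _ _ _ _ hc]
    exact cost_map_addCalls_le _ _ _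

/-- The joint law of the spins found by sequential calls is dominated by the law under `μ`. -/
theorem foldlM_dominated (h : IsSampler μ call) {ws : List Site} (hws : ws.Nodup)
    {Λ : Finset Site} (hΛ : Disjoint Λ ws.toFinset) (σ : Conf q) {Ψ : Conf q → Tape → ℝ≥0∞}
    (hΨ : ∀ η, Measurable (Ψ η)) :
    μ (cyl Λ σ) * ∫⁻ y, after (ws.foldlM (call y) ⟨Λ, σ, 0⟩) Ψ y ∂tape ≤
      sumOver ws.toFinset (fun η => μ (cyl (Λ ∪ ws.toFinset) η) * ∫⁻ z, Ψ η z ∂tape) σ := by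
  induction ws generalizing Λ σ with
  | nil => simp [sumOver_empty, after, shift_zero]
  | cons v ws ih =>
    rw [List.nodup_cons] at hws
    rw [List.toFinset_cons, Finset.disjoint_insert_right] at hΛ
    have hv : v ∉ ws.toFinset := by simpa using hws.1
    simp_rw [h.after_foldlM_cons]
    refine (h.dominated Λ σ v hΛ.1 _ fun η =>
      measurable_after (h.countablyMeasurable_foldlM _ _) hΨ).trans ?_
    rw [List.toFinset_cons, sumOver_insert hv]
    refine Finset.sum_le_sum fun i _ => ?_
    refine (ih hws.2 (Finset.disjoint_insert_left.2 ⟨hv, hΛ.2⟩) _).trans (le_of_eq ?_)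
    rw [Finset.insert_union, Finset.union_insert]

/-- Domination replaces the law of the first spin by the law under `μ`, so the weighted bound for
the remaining sites can be summed over this spin and the costs of the calls add up. -/
theorem foldlM_cost_le (h : IsSampler μ call) {t B : ℝ≥0∞} {Γ : Set Site}
    (hB : ∀ (Λ : Finset Site) (σ : Conf q) (v : Site), (Λ : Set Site) ⊆ Γ → v ∈ Γ → v ∉ Λ →
      μ (cyl Λ σ) * ∫⁻ y, cost t (call y ⟨Λ, σ, 0⟩ v) ∂tape ≤ μ (cyl Λ σ) * B)
    {ws : List Site} (hws : ws.Nodup) (hwsΓ : ∀ v ∈ ws, v ∈ Γ) {Λ : Finset Site}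
    (hΛΓ : (Λ : Set Site) ⊆ Γ) (hΛ : Disjoint Λ ws.toFinset) (σ : Conf q) :
    μ (cyl Λ σ) * ∫⁻ y, cost t (ws.foldlM (call y) ⟨Λ, σ, 0⟩) ∂tape ≤
      μ (cyl Λ σ) * (ws.length * B) := by
  induction ws generalizing Λ σ with
  | nil => simp [cost]
  | cons v ws ih =>
    rw [List.nodup_cons] at hws
    rw [List.toFinset_cons, Finset.disjoint_insert_right] at hΛ
    rw [List.forall_mem_cons] at hwsΓ
    have hv : v ∉ ws.toFinset := by simpa using hws.1
    refine (mul_le_mul_right (lintegral_mono fun y =>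
      h.cost_foldlM_cons_le t y Λ σ v ws) _).trans ?_
    rw [lintegral_add_left (measurable_cost (h.countablyMeasurable _ _) t), mul_add,
      List.length_cons, Nat.cast_add, Nat.cast_one, add_mul, one_mul, mul_add, add_comm]
    refine add_le_add ?_ (hB Λ σ v hΛΓ hwsΓ.1 hΛ.1)
    refine (h.dominated Λ σ v hΛ.1 _ fun η =>
      measurable_cost (h.countablyMeasurable_foldlM _ _) t).trans ?_
    rw [measure_cyl_insert μ hΛ.1 σ, Finset.sum_mul]
    refine Finset.sum_le_sum fun i _ => ?_
    refine ih hws.2 hwsΓ.2 ?_ (Finset.disjoint_insert_left.2 ⟨hv, hΛ.2⟩) _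
    rw [Finset.coe_insert]
    exact Set.insert_subset hwsΓ.1 hΛΓ

end IsSampler

end LazySampling

namespace LazySampling

variable {q : ℕ} {S : SpinSystem q} {L : ℕ} {ord : Finset Site → Conf q → Site → List Site}

/-! ### LAZY with bounded depth -/

lemma bdCalc_addCalls {call call' : State q → Site → Option (State q)} {c : ℕ}
    (h : ∀ s v, call (addCalls c s) v = (call' s v).map (addCalls c)) (s : State q) (v : Site)
    (p : Fin q → ℝ) (y : ℝ) : bdCalc S L ord call (addCalls c s) v p y =
      (bdCalc S L ord call' s v p y).map (addCalls c) := by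
  rw [bdCalc, bdCalc, foldlM_addCalls h]
  change (Option.map (addCalls c) ((ord s.known s.spin v).foldlM call' s)).bind _ = _
  cases (ord s.known s.spin v).foldlM call' s with
  | none => rfl
  | some s' =>
    change Option.map _ (pick _ (fun i => condMarginal S L s'.known s'.spin v i - p i) y) =
      Option.map _ (Option.map _ (pick _ (fun i => condMarginal S L s'.known s'.spin v i - p i) y))
    rw [Option.map_map]
    rfl

lemma lazyDepth_addCalls (n c : ℕ) (y : Tape) (s : State q) (v : Site) :
    lazyDepth S L ord y n (addCalls c s) v =
      (lazyDepth S L ord (shift c y) n s v).map (addCalls c) := by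
  induction n generalizing s v with
  | zero => rfl
  | succ n ih =>
    rw [lazyDepth, lazyDepth]
    change (match pick 0 (pMin S L s.known s.spin v) (y (s.calls + c)) with
      | some i => _
      | none => bdCalc S L ord _ ⟨s.known, s.spin, s.calls + c + 1⟩ v _ _) =
      Option.map _ (match pick 0 (pMin S L s.known s.spin v) (y (s.calls + c)) with
      | some i => _
      | none => _)
    have hs : (⟨s.known, s.spin, s.calls + c + 1⟩ : State q) =
        addCalls c ⟨s.known, s.spin, s.calls + 1⟩ := by
      simp only [addCalls, State.mk.injEq, true_and]; omega
    cases pick 0 (pMin S L s.known s.spin v) (y (s.calls + c)) with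
    | some i =>
      simp only [Option.map_some, addCalls, Option.some.injEq, State.mk.injEq, true_and]; omega
    | none =>
      simp only [hs]
      exact bdCalc_addCalls ih _ _ _ _

lemma lazyDepth_known {n : ℕ} {y : Tape} {s s' : State q} {v : Site}
    (h : lazyDepth S L ord y n s v = some s') :
    s'.known = insert v s.known ∧ ∃ i, s'.spin = update s.spin v i := by
  cases n with
  | zero => cases h
  | succ n =>
    rw [lazyDepth] at h
    split at h
    · cases h; exact ⟨rfl, _, rfl⟩
    · rw [bdCalc, Option.bind_eq_some_iff] at h
      obtain ⟨s₁, -, h⟩ := h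
      rw [Option.map_eq_some_iff] at h
      obtain ⟨i, -, rfl⟩ := h
      exact ⟨rfl, _, rfl⟩

lemma foldlM_mono {call call' : State q → Site → Option (State q)}
    (h : ∀ s v s', call s v = some s' → call' s v = some s') {ws : List Site} {s s' : State q}
    (hs : ws.foldlM call s = some s') : ws.foldlM call' s = some s' := by
  induction ws generalizing s with
  | nil => exact hs
  | cons v ws ih =>
    rw [List.foldlM_cons, Option.bind_eq_bind, Option.bind_eq_some_iff] at hs ⊢
    obtain ⟨s₁, h1, h2⟩ := hs
    exact ⟨s₁, h _ _ _ h1, ih h2⟩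

/-- A larger depth bound only turns failures into results. Hence results found at different depths
agree. -/
lemma lazyDepth_succ_eq_some {n : ℕ} {y : Tape} {s s' : State q} {v : Site}
    (h : lazyDepth S L ord y n s v = some s') : lazyDepth S L ord y (n + 1) s v = some s' := by
  induction n generalizing s v s' with
  | zero => cases h
  | succ n ih =>
    rw [lazyDepth] at h ⊢
    split at h
    · exact h
    · rw [bdCalc, Option.bind_eq_some_iff] at h ⊢
      obtain ⟨s₁, h1, h2⟩ := h
      exact ⟨s₁, foldlM_mono (fun _ _ _ => ih) h1, h2⟩

lemma foldlM_lazyDepth_mono {n m : ℕ} (hnm : n ≤ m) {y : Tape} {ws : List Site} {s s' : State q}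
    (h : ws.foldlM (lazyDepth S L ord y n) s = some s') :
    ws.foldlM (lazyDepth S L ord y m) s = some s' := by
  induction m, hnm using Nat.le_induction with
  | base => exact h
  | succ m _ ih => exact foldlM_mono (fun _ _ _ => lazyDepth_succ_eq_some) ih

lemma lazyListReturns_unique {y : Tape} {ws : List Site} {s s₁ s₂ : State q}
    (h₁ : LazyListReturns S L ord y s ws s₁) (h₂ : LazyListReturns S L ord y s ws s₂) :
    s₁ = s₂ := by
  obtain ⟨n, hn⟩ := h₁
  obtain ⟨m, hm⟩ := h₂
  have h1 := foldlM_lazyDepth_mono (le_max_left n m) hn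
  rw [foldlM_lazyDepth_mono (le_max_right n m) hm] at h1
  exact (Option.some.inj h1).symm

lemma lazyListReturns_singleton {y : Tape} {s s' : State q} {v : Site} :
    LazyListReturns S L ord y s [v] s' ↔ LazyReturns S L ord y s v s' := by
  refine exists_congr fun n => ?_
  rw [List.foldlM_cons]
  simp

lemma countablyMeasurable_lazyDepth (n : ℕ) (s : State q) (v : Site) :
    CountablyMeasurable fun y : Tape => lazyDepth S L ord y n s v := by
  induction n generalizing s v with
  | zero => exact .const none
  | succ n ih =>
    have hcoe : Measurable fun y : Tape => ((y s.calls : unitInterval) : ℝ) :=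
      measurable_subtype_coe.comp (measurable_pi_apply s.calls)
    have hfold : ∀ (ws : List Site) (s : State q),
        CountablyMeasurable fun y : Tape => ws.foldlM (lazyDepth S L ord y n) s := by
      intro ws
      induction ws with
      | nil => exact fun _ => .const _
      | cons v ws ihw => exact fun s => (ih s v).bind fun s' => ihw s'
    simp only [lazyDepth]
    refine ((countablyMeasurable_pick _ _).comp hcoe).eval (G := fun o y => match o with
      | some i => some (State.mk (insert v s.known) (update s.spin v i) (s.calls + 1))
      | none => bdCalc S L ord (lazyDepth S L ord y n) ⟨s.known, s.spin, s.calls + 1⟩ v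
          (pMin S L s.known s.spin v) (y s.calls)) fun o => ?_
    cases o with
    | some i => exact .const _
    | none =>
      exact (hfold _ _).bind fun s' => ((countablyMeasurable_pick _ _).comp hcoe).map _

/-- LAZY on a tape with first entry `x`. -/
lemma lazyDepth_consTape (n : ℕ) (x : unitInterval) (z : Tape) (Λ : Finset Site) (σ : Conf q)
    (v : Site) : lazyDepth S L ord (consTape x z) (n + 1) ⟨Λ, σ, 0⟩ v =
      match pick 0 (pMin S L Λ σ v) x with
      | some i => some ⟨insert v Λ, update σ v i, 1⟩
      | none => ((ord Λ σ v).foldlM (lazyDepth S L ord z n) ⟨Λ, σ, 0⟩).bind fun s =>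
          (pick (∑ j, pMin S L Λ σ v j)
            (fun i => condMarginal S L s.known s.spin v i - pMin S L Λ σ v i) x).map fun i =>
              ⟨insert v Λ, update σ v i, s.calls + 1⟩ := by
  rw [lazyDepth]
  change (match pick 0 (pMin S L Λ σ v) x with
    | some i => _
    | none => _) = _
  cases pick 0 (pMin S L Λ σ v) x with
  | some i => rfl
  | none =>
    change ((ord Λ σ v).foldlM (lazyDepth S L ord (consTape x z) n)
      (addCalls 1 ⟨Λ, σ, 0⟩)).bind _ = _
    rw [foldlM_addCalls (lazyDepth_addCalls n 1 (consTape x z))]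
    change (Option.map (addCalls 1)
      ((ord Λ σ v).foldlM (lazyDepth S L ord z n) ⟨Λ, σ, 0⟩)).bind _ = _
    cases (ord Λ σ v).foldlM (lazyDepth S L ord z n) ⟨Λ, σ, 0⟩ <;> rfl

/-! ### Domination of LAZY by the Gibbs measure -/

lemma ring_disjoint_inner (v : Site) : Disjoint (ring L v) (inner L v) :=
  Finset.sdiff_disjoint

/-- The square `Γ_v` is disjoint from its inside, so adding it to the known sites does not change
the volume of the marginal: BD-CALC ends with the same function of the spins over which `pMin` takes
the minimum. -/
lemma condMarginal_union_ring (Λ : Finset Site) (τ : Conf q) (v : Site) (i : Fin q) :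
    condMarginal S L (Λ ∪ (ring L v \ Λ)) τ v i = condMarginal S L Λ τ v i := by
  rw [condMarginal, condMarginal]
  congr 1
  ext x
  have h (h : x ∈ ring L v) := Finset.disjoint_left.1 (ring_disjoint_inner (L := L) v) h
  simp only [Finset.mem_sdiff, Finset.mem_union]
  tauto

/-- The final choice of BD-CALC, as a function of the configuration on `Γ_v`. -/
noncomputable def finalPick (S : SpinSystem q) (L : ℕ) (Λ : Finset Site) (σ : Conf q) (v : Site)
    (η : Conf q) (x : ℝ) : Option (Fin q) :=
  pick (∑ j, pMin S L Λ σ v j) (fun i => condMarginal S L Λ η v i - pMin S L Λ σ v i) x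

section Domination

variable {μ : Measure (Conf q)} {n : ℕ}

lemma known_eq_of_foldlM (hord : IsOrdering L ord)
    (h : IsSampler μ fun y => lazyDepth S L ord y n)
    {z : Tape} {Λ : Finset Site} {σ : Conf q} {v : Site} {s : State q}
    (hs : (ord Λ σ v).foldlM (lazyDepth S L ord z n) ⟨Λ, σ, 0⟩ = some s) :
    s.known = Λ ∪ (ring L v \ Λ) := by
  rw [h.foldlM_known (y := z) hs, (hord Λ σ v).2]

lemma after_lazyDepth_consTape (hord : IsOrdering L ord)
    (h : IsSampler μ fun y => lazyDepth S L ord y n) (x : unitInterval) (z : Tape)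
    (Λ : Finset Site) (σ : Conf q) (v : Site) (Ψ : Conf q → Tape → ℝ≥0∞) :
    after (lazyDepth S L ord (consTape x z) (n + 1) ⟨Λ, σ, 0⟩ v) Ψ (consTape x z) =
      match pick 0 (pMin S L Λ σ v) x with
      | some i => Ψ (update σ v i) z
      | none => after ((ord Λ σ v).foldlM (lazyDepth S L ord z n) ⟨Λ, σ, 0⟩)
          (fun η z' => (finalPick S L Λ σ v η x).elim 0 fun i => Ψ (update σ v i) z') z := by
  rw [lazyDepth_consTape]
  cases pick 0 (pMin S L Λ σ v) x with
  | some i => rfl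
  | none =>
    dsimp only
    cases hs : (ord Λ σ v).foldlM (lazyDepth S L ord z n) ⟨Λ, σ, 0⟩ with
    | none => rfl
    | some s =>
      simp only [Option.bind_some, known_eq_of_foldlM hord h hs, condMarginal_union_ring]
      change after (Option.map _ (finalPick S L Λ σ v s.spin x)) _ _ =
        (finalPick S L Λ σ v s.spin x).elim 0 _
      cases finalPick S L Λ σ v s.spin x <;> rfl

/-- The penalty `t` can be incurred in the recursive calls or by the final choice. The second term
accounts for the latter; it is shown to vanish for almost every `x` when the cost is bounded. -/
lemma cost_lazyDepth_consTape_le (hord : IsOrdering L ord)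
    (h : IsSampler μ fun y => lazyDepth S L ord y n) (t : ℝ≥0∞) (x : unitInterval) (z : Tape)
    (Λ : Finset Site) (σ : Conf q) (v : Site) :
    cost t (lazyDepth S L ord (consTape x z) (n + 1) ⟨Λ, σ, 0⟩ v) ≤ 1 +
      {x : unitInterval | pick 0 (pMin S L Λ σ v) x = none}.indicator (fun x =>
        cost t ((ord Λ σ v).foldlM (lazyDepth S L ord z n) ⟨Λ, σ, 0⟩) +
        after ((ord Λ σ v).foldlM (lazyDepth S L ord z n) ⟨Λ, σ, 0⟩)
          (fun η _ => (finalPick S L Λ σ v η x).elim t fun _ => 0) z) x := by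
  rw [lazyDepth_consTape]
  cases hp : pick 0 (pMin S L Λ σ v) x with
  | some i => simp [cost]
  | none =>
    rw [Set.indicator_of_mem (show x ∈ {x : unitInterval |
      pick 0 (pMin S L Λ σ v) x = none} from hp)]
    dsimp only
    cases hs : (ord Λ σ v).foldlM (lazyDepth S L ord z n) ⟨Λ, σ, 0⟩ with
    | none => exact le_self_add.trans le_add_self
    | some s =>
      simp only [Option.bind_some, known_eq_of_foldlM hord h hs, condMarginal_union_ring]
      change cost t (Option.map _ (finalPick S L Λ σ v s.spin x)) ≤
        1 + (_ + (finalPick S L Λ σ v s.spin x).elim t _)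
      cases finalPick S L Λ σ v s.spin x with
      | none => exact le_add_self.trans le_add_self
      | some i => simp [cost, add_comm]

lemma union_ring_sdiff (Λ : Finset Site) (v : Site) : Λ ∪ (ring L v \ Λ) = Λ ∪ ring L v :=
  Finset.union_sdiff_self_eq_union

/-- Positive probability under `μ` provides a good extension, so the configuration is among those
over which the minimum is taken. -/
lemma pMin_le_condMarginal_of_measure_ne_zero (hμ : S.IsGibbs μ) (hL : 0 < L) {Λ : Finset Site}
    {σ η : Conf q} {v : Site} (hv : v ∉ Λ) (hη : ∀ x ∉ ring L v \ Λ, η x = σ x)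
    (h0 : μ (cyl (Λ ∪ ring L v) η) ≠ 0) :
    (∀ i, pMin S L Λ σ v i ≤ condMarginal S L Λ η v i) ∧
      ∑ i, condMarginal S L Λ η v i = 1 := by
  obtain ⟨τ, hτ, hgood⟩ := hμ.feasible_of_measure_cyl_ne_zero h0
  have heq : ∀ i, condMarginal S L Λ η v i = condMarginal S L Λ τ v i := fun i =>
    SpinSystem.condMarginal_dependsOn hL hv i fun x hx => (hτ x hx).symm
  simp_rw [heq]
  refine ⟨fun i => SpinSystem.pMin_le (fun x hx => ?_) hgood v i,
    SpinSystem.sum_condMarginal L Λ hgood v⟩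
  rw [hτ x (Finset.mem_union_left _ hx), hη x (by simp [hx])]

/-- The law of total probability over the configurations on `Γ_v`. -/
lemma sumOver_condMarginal (hμ : S.IsGibbs μ) (hL : 0 < L) {Λ : Finset Site} {v : Site}
    (hv : v ∉ Λ) (σ : Conf q) (i : Fin q) :
    sumOver (ring L v \ Λ) (fun η => μ (cyl (Λ ∪ ring L v) η) *
      ENNReal.ofReal (condMarginal S L Λ η v i)) σ =
      μ (cyl (insert v Λ) (update σ v i)) := by
  rw [cyl_insert_update hv, ← hμ.setLIntegral_spec (W := inner L v \ Λ) Finset.disjoint_sdiff σ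
    (measurableSet_eval v i), setLIntegral_cyl μ (R := ring L v \ Λ) Finset.disjoint_sdiff σ,
    union_ring_sdiff]
  · rfl
  · rw [union_ring_sdiff]
    exact fun τ τ' h => congrArg ENNReal.ofReal
      (SpinSystem.condMarginal_dependsOn hL hv i h)

lemma lintegral_pick (I : Fin q → ℝ≥0∞) (a : ℝ) (r : Fin q → ℝ) :
    ∫⁻ x : unitInterval, (pick a r x).elim 0 I ≤ ∑ i, ENNReal.ofReal (r i) * I i := by
  classical
  have : ∀ x : unitInterval, (pick a r x).elim 0 I =
      ∑ i, {x : unitInterval | pick a r x = some i}.indicator (fun _ => I i) x := by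
    intro x
    cases h : pick a r x with
    | none => simp [h]
    | some j => simp [Set.indicator_apply, h]
  simp_rw [this]
  rw [lintegral_finsetSum _ fun i _ => measurable_const.indicator (measurableSet_pick _ _ _)]
  refine Finset.sum_le_sum fun i _ => ?_
  rw [lintegral_indicator_const (measurableSet_pick _ _ _), mul_comm]
  exact mul_le_mul_left (volume_pick_le _ _ _) _

lemma measurable_pick_elim (I : Fin q → ℝ≥0∞) (c : ℝ≥0∞) (a : ℝ) (r : Fin q → ℝ) :
    Measurable fun x : unitInterval => (pick a r x).elim c I :=
  ((countablyMeasurable_pick a r).comp measurable_subtype_coe).measurable_eval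
    (h := fun o _ => o.elim c I) fun _ => measurable_const

/-- LAZY with any recursion depth is dominated by the Gibbs measure. -/
theorem isSampler_lazyDepth (hμ : S.IsGibbs μ) (hL : 0 < L) (hord : IsOrdering L ord) (n : ℕ) :
    IsSampler μ fun y => lazyDepth S L ord y n := by
  have := hμ.1
  refine ⟨fun c y s v => lazyDepth_addCalls n c y s v, fun y s v s' h => (lazyDepth_known h).1,
    fun s v => countablyMeasurable_lazyDepth n s v, ?_⟩
  induction n with
  | zero => intro Λ σ v hv Ψ hΨ; simp [lazyDepth, after]
  | succ n ih =>
    intro Λ σ v hv Ψ hΨ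
    have hsamp : IsSampler μ fun y => lazyDepth S L ord y n :=
      ⟨fun c y s v => lazyDepth_addCalls n c y s v, fun y s v s' h => (lazyDepth_known h).1,
        fun s v => countablyMeasurable_lazyDepth n s v, ih⟩
    set I : Fin q → ℝ≥0∞ := fun i => ∫⁻ z, Ψ (update σ v i) z ∂tape with hI
    set p := pMin S L Λ σ v with hp
    rw [lintegral_tape (measurable_after (countablyMeasurable_lazyDepth _ _ _) hΨ)]
    simp_rw [after_lazyDepth_consTape hord hsamp]
    rw [← lintegral_const_mul' _ _ (measure_ne_top μ _)]
    -- With the first uniform variable frozen at `x`, the recursive calls use only the independent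
    -- rest `z` of the tape, so the induction hypothesis applies although `x` is used again in the
    -- final choice.
    have hx : ∀ x : unitInterval, μ (cyl Λ σ) * ∫⁻ z, (match pick 0 p x with
        | some i => Ψ (update σ v i) z
        | none => after ((ord Λ σ v).foldlM (lazyDepth S L ord z n) ⟨Λ, σ, 0⟩)
          (fun η z' => (finalPick S L Λ σ v η x).elim 0 fun i => Ψ (update σ v i) z') z) ∂tape ≤
        μ (cyl Λ σ) * (pick 0 p x).elim 0 I + sumOver (ring L v \ Λ) (fun η =>
          μ (cyl (Λ ∪ ring L v) η) * (finalPick S L Λ σ v η x).elim 0 I) σ := by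
      intro x
      cases pick 0 p x with
      | some i => exact le_self_add
      | none =>
        refine le_trans ?_ le_add_self
        have := hsamp.foldlM_dominated (hord Λ σ v).1 (Λ := Λ)
          (by rw [(hord Λ σ v).2]; exact Finset.disjoint_sdiff) σ
          (Ψ := fun η z' => (finalPick S L Λ σ v η x).elim 0 fun i => Ψ (update σ v i) z')
          (fun η => by
            cases finalPick S L Λ σ v η x with
            | none => exact measurable_const
            | some i => exact hΨ _)
        refine this.trans (le_of_eq ?_)
        rw [(hord Λ σ v).2, union_ring_sdiff]
        refine sumOver_congr fun η _ => ?_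
        cases finalPick S L Λ σ v η x <;> simp [hI]
    refine (lintegral_mono hx).trans ?_
    rw [lintegral_add_left ((measurable_pick_elim I 0 0 p).const_mul _),
      lintegral_const_mul _ (measurable_pick_elim I 0 0 p)]
    have hsum : ∫⁻ x : unitInterval, sumOver (ring L v \ Λ) (fun η =>
        μ (cyl (Λ ∪ ring L v) η) * (finalPick S L Λ σ v η x).elim 0 I) σ ≤
        sumOver (ring L v \ Λ) (fun η => μ (cyl (Λ ∪ ring L v) η) *
          ∑ i, ENNReal.ofReal (condMarginal S L Λ η v i - p i) * I i) σ := by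
      simp only [sumOver, finalPick]
      rw [lintegral_finsetSum _ fun ξ _ => (measurable_pick_elim I 0 _ _).const_mul _]
      refine Finset.sum_le_sum fun ξ _ => ?_
      rw [lintegral_const_mul _ (measurable_pick_elim I 0 _ _)]
      exact mul_le_mul_right (lintegral_pick I _ _) _
    refine (add_le_add (mul_le_mul_right (lintegral_pick I 0 p) _) hsum).trans (le_of_eq ?_)
    -- Both branches are written as sums over the spins `η` on `Γ_v`, where `p^i + (μ_v^η(i) - p^i)
    -- = μ_v^η(i)`. Configurations of measure zero, for which the bracket might be negative, drop
    -- out.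
    rw [measure_cyl μ (R := ring L v \ Λ) Finset.disjoint_sdiff σ, union_ring_sdiff,
      ← sumOver_mul_right, ← sumOver_add]
    simp_rw [← sumOver_condMarginal hμ hL hv, ← sumOver_mul_right, ← sumOver_sum]
    refine sumOver_congr fun η hη => ?_
    by_cases h0 : μ (cyl (Λ ∪ ring L v) η) = 0
    · simp [h0]
    · obtain ⟨h1, -⟩ := pMin_le_condMarginal_of_measure_ne_zero hμ hL hv hη h0
      rw [← mul_add, ← Finset.sum_add_distrib, Finset.mul_sum]
      refine Finset.sum_congr rfl fun i _ => ?_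
      rw [← add_mul, ← ENNReal.ofReal_add (SpinSystem.pMin_nonneg _ _ _ _ _)
        (sub_nonneg.2 (h1 i)), add_sub_cancel, mul_assoc]

/-! ### The expected number of calls -/

lemma boundary_openSquare_subset {c : Site} {m : ℤ} (h1 : (L : ℤ) ∣ c.1) (h2 : (L : ℤ) ∣ c.2)
    (hm : (L : ℤ) ∣ m) : (boundary (openSquare c m) : Set Site) ⊆ mesh L := by
  intro u hu
  obtain ⟨hu1, w, hw, hwu⟩ := mem_boundary.1 (Finset.mem_coe.1 hu)
  rw [openSquare, Finset.mem_product, Finset.mem_Ioo, Finset.mem_Ioo] at hu1 hw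
  rw [gridGraph_adj, gridDist] at hwu
  have : u.1 = c.1 ∨ u.1 = c.1 + m ∨ u.2 = c.2 ∨ u.2 = c.2 + m := by omega
  rcases this with h | h | h | h
  · exact Or.inl (h ▸ h1)
  · exact Or.inl (h ▸ dvd_add h1 hm)
  · exact Or.inr (h ▸ h2)
  · exact Or.inr (h ▸ dvd_add h2 hm)

lemma ring_subset_mesh (hL : 0 < L) (v : Site) : (ring L v : Set Site) ⊆ mesh L :=
  boundary_openSquare_subset (corner_spec hL _).1 (corner_spec hL _).1 (Dvd.intro_left _ rfl)

/-- Subcritical branching: a call costs one plus at most `1/2` of the bound `B` for depth `n`, and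
`1 + B / 2` is the bound for depth `n + 1`. -/
theorem lazyDepth_cost_le (hμ : S.IsGibbs μ) (hL : 0 < L) (hord : IsOrdering L ord)
    (hscale : ∀ (Λ : Finset Site) (σ : Conf q) (v : Site), (Λ : Set Site) ⊆ mesh L →
      S.Feasible (Λ : Set Site) σ → v ∉ Λ →
        (ring L v).card * (1 - ∑ i, pMin S L Λ σ v i) ≤ 1 / 2) (t : ℝ≥0∞) (n : ℕ)
    (Λ : Finset Site) (σ : Conf q) (v : Site) (hΛ : (Λ : Set Site) ⊆ mesh L)
    (hv : v ∉ Λ) :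
    μ (cyl Λ σ) * ∫⁻ y, cost t (lazyDepth S L ord y n ⟨Λ, σ, 0⟩ v) ∂tape ≤
      μ (cyl Λ σ) * (2 + t * 2⁻¹ ^ n) := by
  have := hμ.1
  induction n generalizing Λ σ v with
  | zero => simp [lazyDepth, cost]; gcongr; exact le_add_self
  | succ n ih =>
    by_cases h0 : μ (cyl Λ σ) = 0
    · simp [h0]
    have hfeas : S.Feasible (Λ : Set Site) σ := by
      obtain ⟨η, h1, h2⟩ := hμ.feasible_of_measure_cyl_ne_zero h0
      exact SpinSystem.feasible_iff_exists_good.2 ⟨η, h1, h2⟩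
    have hsamp := isSampler_lazyDepth (n := n) hμ hL hord
    set p := pMin S L Λ σ v with hp
    set B : ℝ≥0∞ := 2 + t * 2⁻¹ ^ n with hB
    set E := {x : unitInterval | pick 0 p x = none} with hE
    have hEm : MeasurableSet E := measurableSet_pick _ _ _
    have hlen : (ord Λ σ v).length = (ring L v \ Λ).card := by
      rw [← (hord Λ σ v).2, List.toFinset_card_of_nodup (hord Λ σ v).1]
    have hdisj : Disjoint Λ (ord Λ σ v).toFinset := by
      rw [(hord Λ σ v).2]; exact Finset.disjoint_sdiff
    have hfold := hsamp.foldlM_cost_le (Γ := mesh L) (fun Λ σ v h1 _ h3 => ih Λ σ v h1 h3)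
      (hord Λ σ v).1 (fun w hw => by
        have : w ∈ ring L v \ Λ := by rw [← (hord Λ σ v).2]; simpa using hw
        exact ring_subset_mesh hL v (Finset.mem_sdiff.1 this).1) hΛ hdisj σ
    rw [lintegral_tape (measurable_cost (countablyMeasurable_lazyDepth _ _ _) t),
      ← lintegral_const_mul' _ _ (measure_ne_top μ _)]
    -- The half-open intervals of the final choice fill `[∑ p, 1)`, so apart from infeasible spins
    -- on `Γ_v` the choice fails only at `x = 1`, a null event.
    have hx : ∀ x : unitInterval, x ≠ 1 → μ (cyl Λ σ) * ∫⁻ z,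
        cost t (lazyDepth S L ord (consTape x z) (n + 1) ⟨Λ, σ, 0⟩ v) ∂tape ≤
        μ (cyl Λ σ) + E.indicator
          (fun _ => μ (cyl Λ σ) * ((ord Λ σ v).length * B)) x := by
      intro x hx1
      refine (mul_le_mul_right (lintegral_mono fun z =>
        cost_lazyDepth_consTape_le hord hsamp t x z Λ σ v) _).trans ?_
      by_cases hxE : x ∈ E
      · rw [Set.indicator_of_mem hxE]
        simp_rw [Set.indicator_of_mem (show x ∈ {x : unitInterval |
          pick 0 (pMin S L Λ σ v) x = none} from hxE)]
        rw [lintegral_add_left measurable_const, lintegral_const, measure_univ, mul_one, mul_add,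
          mul_one, lintegral_add_left (measurable_cost
            (hsamp.countablyMeasurable_foldlM _ _) t), mul_add]
        refine add_le_add le_rfl ((add_le_add hfold ?_).trans (add_zero _).le)
        refine (hsamp.foldlM_dominated (hord Λ σ v).1 hdisj σ
          (fun η => measurable_const)).trans (le_of_eq ?_)
        rw [(hord Λ σ v).2, union_ring_sdiff]
        refine Finset.sum_eq_zero fun ξ _ => ?_
        set η := glue (ring L v \ Λ) ξ σ with hη
        by_cases hz : μ (cyl (Λ ∪ ring L v) η) = 0
        · simp [hz]
        obtain ⟨-, h2⟩ := pMin_le_condMarginal_of_measure_ne_zero hμ hL hv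
          (fun x hx => glue_of_notMem hx) hz
        cases hf : finalPick S L Λ σ v η x with
        | some i => simp [hf]
        | none =>
          exfalso
          have h3 : ∑ j, p j ≤ (x : ℝ) := by
            simpa using le_of_pick_eq_none (show pick 0 p x = none from hxE) x.2.1
          have h4 := le_of_pick_eq_none hf h3
          rw [Finset.sum_sub_distrib, h2, add_sub_cancel] at h4
          exact hx1 (Subtype.ext (le_antisymm x.2.2 h4))
      · rw [Set.indicator_of_notMem hxE]
        simp_rw [Set.indicator_of_notMem (show x ∉ {x : unitInterval |
          pick 0 (pMin S L Λ σ v) x = none} from hxE)]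
        simp
    have hae : ∀ᵐ x : unitInterval, x ≠ 1 := by
      simp [ae_iff]
    refine (lintegral_mono_ae (hae.mono hx)).trans ?_
    rw [lintegral_add_left measurable_const, lintegral_const, measure_univ, mul_one,
      lintegral_indicator_const hEm]
    have hvol : (ord Λ σ v).length * volume E ≤ 2⁻¹ := by
      have hr : ENNReal.ofReal ((ring L v).card * (1 - ∑ i, p i)) ≤ 2⁻¹ := by
        refine (ENNReal.ofReal_le_ofReal (hscale Λ σ v hΛ hfeas hv)).trans (le_of_eq ?_)
        rw [one_div, ENNReal.ofReal_inv_of_pos two_pos]; simp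
      refine le_trans ?_ hr
      rw [ENNReal.ofReal_mul (Nat.cast_nonneg _), ENNReal.ofReal_natCast, hlen]
      gcongr
      · exact Finset.sdiff_subset
      · exact volume_pick_none_le p
    calc μ (cyl Λ σ) + μ (cyl Λ σ) * ((ord Λ σ v).length * B) * volume E
        = μ (cyl Λ σ) * (1 + ((ord Λ σ v).length * volume E) * B) := by ring
      _ ≤ μ (cyl Λ σ) * (1 + 2⁻¹ * B) := by gcongr
      _ = μ (cyl Λ σ) * (2 + t * 2⁻¹ ^ (n + 1)) := by
        have h2 : (2⁻¹ : ℝ≥0∞) * 2 = 1 := ENNReal.inv_mul_cancel two_ne_zero ENNReal.ofNat_ne_top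
        rw [hB, mul_add 2⁻¹, h2, ← add_assoc, one_add_one_eq_two, pow_succ]
        ring

end Domination

end LazySampling

namespace LazySampling

variable {q : ℕ} {S : SpinSystem q} {L : ℕ} {ord : Finset Site → Conf q → Site → List Site}

/-! ### Sequential calls of LAZY with unbounded depth -/

/-- Expresses unbounded depth as a supremum over depth bounds, increasing by
`monotone_after_foldlM`. This supplies measurability and monotone convergence. -/
lemma iSup_lazyListReturns (y : Tape) (s : State q) (ws : List Site) (Φ : Conf q → ℝ≥0∞) :
    ⨆ (s' : State q) (_ : LazyListReturns S L ord y s ws s'), Φ s'.spin =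
      ⨆ n, after (ws.foldlM (lazyDepth S L ord y n) s) (fun η _ => Φ η) y := by
  refine le_antisymm (iSup₂_le ?_) (iSup_le fun n => ?_)
  · rintro s' ⟨n, hn⟩
    refine le_iSup_of_le n ?_
    rw [hn]
    exact le_rfl
  · cases hs : ws.foldlM (lazyDepth S L ord y n) s with
    | none => exact zero_le
    | some s' => exact le_iSup₂_of_le s' ⟨n, hs⟩ le_rfl

lemma iSup_of_lazyListReturns {y : Tape} {s s' : State q} {ws : List Site}
    (h : LazyListReturns S L ord y s ws s') (Φ : Conf q → ℝ≥0∞) :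
    ⨆ (s' : State q) (_ : LazyListReturns S L ord y s ws s'), Φ s'.spin = Φ s'.spin := by
  refine le_antisymm (iSup₂_le fun s₁ h₁ => ?_) (le_iSup₂_of_le s' h le_rfl)
  rw [lazyListReturns_unique h₁ h]

lemma monotone_after_foldlM (y : Tape) (s : State q) (ws : List Site) (Φ : Conf q → ℝ≥0∞) :
    Monotone fun n => after (ws.foldlM (lazyDepth S L ord y n) s) (fun η _ => Φ η) y := by
  intro n m hnm
  cases hs : ws.foldlM (lazyDepth S L ord y n) s with
  | none => simp [after, hs]
  | some s' => simp [hs, foldlM_lazyDepth_mono hnm hs]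

lemma monotone_cost_foldlM (y : Tape) (s : State q) (ws : List Site) :
    Monotone fun n => cost 0 (ws.foldlM (lazyDepth S L ord y n) s) := by
  intro n m hnm
  cases hs : ws.foldlM (lazyDepth S L ord y n) s with
  | none => simp [cost, hs]
  | some s' => simp [hs, foldlM_lazyDepth_mono hnm hs]

lemma callCount_le_iSup {y : Tape} {s s' : State q} {ws : List Site}
    (h : LazyListReturns S L ord y s ws s') : callCount (LazyListReturns S L ord y s ws) ≤
      ⨆ n, cost 0 (ws.foldlM (lazyDepth S L ord y n) s) := by
  refine iInf₂_le_of_le s' h ?_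
  obtain ⟨n, hn⟩ := h
  refine le_iSup_of_le n ?_
  rw [hn]
  exact le_rfl

section Sequence

variable {μ : Measure (Conf q)} (hμ : S.IsGibbs μ) (hL : 0 < L) (hord : IsOrdering L ord)
  (hscale : ∀ (Λ : Finset Site) (σ : Conf q) (v : Site), (Λ : Set Site) ⊆ mesh L →
    S.Feasible (Λ : Set Site) σ → v ∉ Λ → (ring L v).card * (1 - ∑ i, pMin S L Λ σ v i) ≤ 1 / 2)
  {ws : List Site} (hws : ws.Nodup) (hwsL : ∀ v ∈ ws, v ∈ mesh L) {Λ : Finset Site}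
  (hΛL : (Λ : Set Site) ⊆ mesh L) (hΛ : Disjoint Λ ws.toFinset) {σ : Conf q}
  (h0 : μ (cyl Λ σ) ≠ 0)

include hμ hL hord hscale hws hwsL hΛL hΛ h0

lemma lintegral_cost_foldlM_le (t : ℝ≥0∞) (n : ℕ) :
    ∫⁻ y, cost t (ws.foldlM (lazyDepth S L ord y n) ⟨Λ, σ, 0⟩) ∂tape ≤
      ws.length * (2 + t * 2⁻¹ ^ n) := by
  have := hμ.1
  refine (ENNReal.mul_le_mul_iff_right h0 (measure_ne_top μ _)).1 ?_
  exact (isSampler_lazyDepth hμ hL hord n).foldlM_cost_le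
    (fun Λ σ v h1 _ h3 => lazyDepth_cost_le hμ hL hord hscale t n Λ σ v h1 h3) hws hwsL hΛL hΛ σ

/-- Charging `2^n` for exceeding depth `n` keeps the expected cost below `3` per site, so by
Markov's inequality failure has probability of order `2^{-n}`. -/
theorem ae_exists_lazyListReturns :
    ∀ᵐ y ∂tape, ∃ s, LazyListReturns S L ord y ⟨Λ, σ, 0⟩ ws s := by
  rw [ae_iff]
  set N := {y : Tape | ¬ ∃ s, LazyListReturns S L ord y ⟨Λ, σ, 0⟩ ws s} with hN
  have hpow : ∀ n : ℕ, (2 : ℝ≥0∞) ^ n * 2⁻¹ ^ n = 1 := fun n => by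
    rw [← mul_pow, ENNReal.mul_inv_cancel two_ne_zero ENNReal.ofNat_ne_top, one_pow]
  have hle : ∀ n : ℕ, tape N ≤ ws.length * 3 * 2⁻¹ ^ n := by
    intro n
    have h1 : 2 ^ n * tape N ≤ ws.length * 3 := by
      calc 2 ^ n * tape N
          ≤ 2 ^ n * tape {y | (2 : ℝ≥0∞) ^ n ≤
              cost (2 ^ n) (ws.foldlM (lazyDepth S L ord y n) ⟨Λ, σ, 0⟩)} := by
            gcongr
            intro y hy
            cases hs : ws.foldlM (lazyDepth S L ord y n) ⟨Λ, σ, 0⟩ with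
            | none => simp [hs, cost]
            | some s => exact absurd ⟨s, n, hs⟩ hy
        _ ≤ _ := mul_meas_ge_le_lintegral (measurable_cost
            ((isSampler_lazyDepth hμ hL hord n).countablyMeasurable_foldlM _ _) _) _
        _ ≤ _ := lintegral_cost_foldlM_le hμ hL hord hscale hws hwsL hΛL hΛ h0 _ n
        _ = ws.length * 3 := by rw [hpow]; norm_num
    calc tape N = 2 ^ n * tape N * 2⁻¹ ^ n := by
          rw [mul_right_comm, hpow, one_mul]
      _ ≤ _ := by gcongr
  have hlim : Filter.Tendsto (fun n : ℕ => (ws.length * 3 : ℝ≥0∞) * 2⁻¹ ^ n) Filter.atTop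
      (nhds 0) := by
    have := ENNReal.Tendsto.const_mul (a := (ws.length * 3 : ℝ≥0∞))
      (ENNReal.tendsto_pow_atTop_nhds_zero_of_lt_one (r := 2⁻¹) (by simp))
      (Or.inr (ENNReal.mul_ne_top (ENNReal.natCast_ne_top _) ENNReal.ofNat_ne_top))
    simpa using this
  exact le_antisymm (ge_of_tendsto' hlim hle) zero_le

/-- With no charge for failure each site costs at most `2`, uniformly in the depth. Tapes of
infinite count form a null set by termination. -/
theorem lintegral_callCount_le :
    ∫⁻ y, callCount (LazyListReturns S L ord y ⟨Λ, σ, 0⟩ ws) ∂tape ≤ 2 * ws.length := by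
  calc _ ≤ ∫⁻ y, ⨆ n, cost 0 (ws.foldlM (lazyDepth S L ord y n) ⟨Λ, σ, 0⟩) ∂tape := by
        refine lintegral_mono_ae ?_
        filter_upwards [ae_exists_lazyListReturns hμ hL hord hscale hws hwsL hΛL hΛ h0] with y hy
        obtain ⟨s, hs⟩ := hy
        exact callCount_le_iSup hs
    _ = ⨆ n, ∫⁻ y, cost 0 (ws.foldlM (lazyDepth S L ord y n) ⟨Λ, σ, 0⟩) ∂tape :=
        lintegral_iSup (fun n => measurable_cost
          ((isSampler_lazyDepth hμ hL hord n).countablyMeasurable_foldlM _ _) _)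
          fun n m hnm y => monotone_cost_foldlM y _ ws hnm
    _ ≤ _ := iSup_le fun n => by
        have := lintegral_cost_foldlM_le hμ hL hord hscale hws hwsL hΛL hΛ h0 0 n
        rwa [zero_mul, add_zero, mul_comm] at this

/-- The spins found by sequential calls of LAZY have exactly the conditional law under `μ`. -/
theorem lintegral_iSup_lazyListReturns {Φ : Conf q → ℝ≥0∞} (hΦ : ∀ η, Φ η ≤ 1) :
    μ (cyl Λ σ) * ∫⁻ y, ⨆ (s : State q) (_ : LazyListReturns S L ord y ⟨Λ, σ, 0⟩ ws s),
      Φ s.spin ∂tape =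
    sumOver ws.toFinset (fun η => μ (cyl (Λ ∪ ws.toFinset) η) * Φ η) σ := by
  have := hμ.1
  have hmeas : ∀ (Φ : Conf q → ℝ≥0∞) (n : ℕ), Measurable fun y =>
      after (ws.foldlM (lazyDepth S L ord y n) ⟨Λ, σ, 0⟩) (fun η _ => Φ η) y := fun Φ n =>
    measurable_after ((isSampler_lazyDepth hμ hL hord n).countablyMeasurable_foldlM _ _)
      fun η => measurable_const
  have hle : ∀ Φ : Conf q → ℝ≥0∞, μ (cyl Λ σ) * ∫⁻ y, ⨆ (s : State q)
      (_ : LazyListReturns S L ord y ⟨Λ, σ, 0⟩ ws s), Φ s.spin ∂tape ≤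
      sumOver ws.toFinset (fun η => μ (cyl (Λ ∪ ws.toFinset) η) * Φ η) σ := by
    intro Φ
    simp_rw [iSup_lazyListReturns]
    rw [lintegral_iSup (hmeas Φ) fun n m hnm y => monotone_after_foldlM y _ ws Φ hnm,
      ENNReal.mul_iSup]
    refine iSup_le fun n => ?_
    have := (isSampler_lazyDepth hμ hL hord n).foldlM_dominated hws hΛ σ
      (Ψ := fun η _ => Φ η) fun η => measurable_const
    simpa using this
  refine le_antisymm (hle Φ) ?_
  -- The upper bound holds for `Φ` and for `1 - Φ`. By almost sure termination the two left sides
  -- add up to `μ (cyl Λ σ)`, as do the right sides, so neither inequality can be strict.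
  have hadd : ∀ η, Φ η + (1 - Φ η) = 1 := fun η => add_tsub_cancel_of_le (hΦ η)
  have h1 : sumOver ws.toFinset (fun η => μ (cyl (Λ ∪ ws.toFinset) η) * Φ η) σ +
      sumOver ws.toFinset (fun η => μ (cyl (Λ ∪ ws.toFinset) η) * (1 - Φ η)) σ =
      μ (cyl Λ σ) := by
    simp_rw [← sumOver_add, ← mul_add, hadd, mul_one]
    exact (measure_cyl μ hΛ σ).symm
  have h2 : (∫⁻ y, ⨆ (s : State q) (_ : LazyListReturns S L ord y ⟨Λ, σ, 0⟩ ws s),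
      Φ s.spin ∂tape) + ∫⁻ y, ⨆ (s : State q) (_ : LazyListReturns S L ord y ⟨Λ, σ, 0⟩ ws s),
      (1 - Φ s.spin) ∂tape = 1 := by
    rw [← lintegral_add_left]
    · calc _ = ∫⁻ _, 1 ∂tape := lintegral_congr_ae ?_
        _ = 1 := by simp
      filter_upwards [ae_exists_lazyListReturns hμ hL hord hscale hws hwsL hΛL hΛ h0] with y hy
      obtain ⟨s, hs⟩ := hy
      rw [iSup_of_lazyListReturns hs, iSup_of_lazyListReturns hs fun η => 1 - Φ η, hadd]
    · simp_rw [iSup_lazyListReturns]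
      exact .iSup (hmeas Φ)
  have h3 := hle fun η => 1 - Φ η
  have hfin : sumOver ws.toFinset (fun η => μ (cyl (Λ ∪ ws.toFinset) η) * (1 - Φ η)) σ ≠ ∞ :=
    ne_top_of_le_ne_top (measure_ne_top μ (cyl Λ σ)) (h1 ▸ le_add_self)
  refine (ENNReal.add_le_add_iff_right hfin).1 ?_
  rw [h1]
  have h4 := congrArg (μ (cyl Λ σ) * ·) h2
  simp only [mul_add, mul_one] at h4
  exact h4.symm.le.trans (add_le_add le_rfl h3)

end Sequence

/-- The law of the output of a single call of LAZY. -/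
theorem tape_lazyReturns {μ : Measure (Conf q)} (hμ : S.IsGibbs μ) (hL : 0 < L)
    (hord : IsOrdering L ord)
    (hscale : ∀ (Λ : Finset Site) (σ : Conf q) (v : Site), (Λ : Set Site) ⊆ mesh L →
      S.Feasible (Λ : Set Site) σ → v ∉ Λ → (ring L v).card * (1 - ∑ i, pMin S L Λ σ v i) ≤ 1 / 2)
    {Λ : Finset Site} (hΛL : (Λ : Set Site) ⊆ mesh L) {σ : Conf q} (h0 : μ (cyl Λ σ) ≠ 0)
    {v : Site} (hvL : v ∈ mesh L) (hv : v ∉ Λ) (i : Fin q) :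
    tape {y | ∃ s, LazyReturns S L ord y ⟨Λ, σ, 0⟩ v s ∧
      s.known = insert v Λ ∧ s.spin = update σ v i} = cond μ (cyl Λ σ) {η | η v = i} := by
  classical
  have := hμ.1
  set E := {y | ∃ s, LazyReturns S L ord y ⟨Λ, σ, 0⟩ v s ∧
      s.known = insert v Λ ∧ s.spin = update σ v i} with hE
  set Φ : Conf q → ℝ≥0∞ := fun η => if η = update σ v i then 1 else 0 with hΦ
  have hΦ1 : ∀ η, Φ η ≤ 1 := fun η => by simp only [hΦ]; split_ifs <;> simp
  have hout : ∀ y, ⨆ (s : State q) (_ : LazyListReturns S L ord y ⟨Λ, σ, 0⟩ [v] s), Φ s.spin =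
      E.indicator 1 y := by
    intro y
    by_cases hy : y ∈ E
    · rw [Set.indicator_of_mem hy]
      obtain ⟨s, hs, -, hspin⟩ := hy
      rw [iSup_of_lazyListReturns (lazyListReturns_singleton.2 hs)]
      simp [hΦ, hspin]
    · rw [Set.indicator_of_notMem hy]
      refine le_antisymm (iSup₂_le fun s hs => ?_) zero_le
      have hs' := lazyListReturns_singleton.1 hs
      have hne : s.spin ≠ update σ v i := fun h => by
        obtain ⟨n, hn⟩ := hs'
        exact hy ⟨s, ⟨n, hn⟩, (lazyDepth_known hn).1, h⟩
      simp [hΦ, hne]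
  -- The event is defined by an unbounded search; its indicator is a supremum of measurable
  -- functions.
  have hEm : MeasurableSet E := by
    have h1 : Measurable (E.indicator (1 : Tape → ℝ≥0∞)) := by
      rw [← funext hout]
      simp_rw [iSup_lazyListReturns]
      exact .iSup fun n => measurable_after
        ((isSampler_lazyDepth hμ hL hord n).countablyMeasurable_foldlM _ _)
          fun η => measurable_const
    exact (measurable_indicator_const_iff (1 : ℝ≥0∞)).1 h1
  have key := lintegral_iSup_lazyListReturns hμ hL hord hscale (List.nodup_singleton v)
    (by simpa using hvL) hΛL (by simpa using hv) h0 hΦ1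
  simp_rw [hout] at key
  rw [lintegral_indicator_one hEm] at key
  have hsing : [v].toFinset = {v} := rfl
  rw [hsing, sumOver_singleton, Finset.sum_eq_single i] at key
  · rw [cond_apply (measurableSet_cyl Λ σ), ← cyl_insert_update hv]
    have h1 : Λ ∪ {v} = insert v Λ := by rw [Finset.union_comm, Finset.insert_eq]
    rw [h1] at key
    simp only [hΦ, if_true, mul_one] at key
    rw [← key, ← mul_assoc, ENNReal.inv_mul_cancel h0 (measure_ne_top μ _), one_mul]
  · intro j _ hj
    have : update σ v j ≠ update σ v i := fun h => hj (by simpa using congrFun h v)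
    simp [hΦ, this]
  · simp

/-! ### The window -/

lemma meshSupport_subset (U : Finset Site) : (meshSupport L U : Set Site) ⊆ mesh L := by
  classical
  intro x hx
  simp only [meshSupport, Finset.coe_union, Set.mem_union, Finset.mem_coe, Finset.mem_filter,
    Finset.mem_biUnion] at hx
  obtain hx | ⟨v, -, hx⟩ := hx
  · exact hx.2
  · exact boundary_openSquare_subset (Dvd.intro _ rfl) (Dvd.intro _ rfl) dvd_rfl hx

/-- Makes the final finite-volume draw a function of the spins found by LAZY only. -/
lemma boundary_cellInteriors_subset (U : Finset Site) :
    boundary (cellInteriors L U) ⊆ meshSupport L U := by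
  classical
  intro x hx
  obtain ⟨hx, u, hu, hux⟩ := mem_boundary.1 hx
  simp only [cellInteriors, Finset.mem_biUnion, not_exists, not_and] at hx hu
  obtain ⟨v, hv, hu⟩ := hu
  refine Finset.mem_union_right _ (Finset.mem_biUnion.2 ⟨v, ?_, ?_⟩)
  · convert hv
  · exact mem_boundary.2 ⟨hx v hv, u, hu, hux⟩

lemma mem_openSquare_of_notMem_mesh (hL : 0 < L) {v : Site} (hv : v ∉ mesh L) :
    v ∈ openSquare (L * (v.1 / L), L * (v.2 / L)) L := by
  have hL' : (0 : ℤ) < L := by exact_mod_cast hL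
  have key : ∀ a : ℤ, ¬ (L : ℤ) ∣ a → L * (a / L) < a ∧ a < L * (a / L) + L := by
    intro a ha
    have h1 := Int.mul_ediv_add_emod a L
    have h2 := Int.emod_pos_of_not_dvd ha
    have h3 := Int.emod_lt_of_pos a hL'
    omega
  have hv' : ¬ (L : ℤ) ∣ v.1 ∧ ¬ (L : ℤ) ∣ v.2 := not_or.1 hv
  rw [openSquare, Finset.mem_product, Finset.mem_Ioo, Finset.mem_Ioo]
  exact ⟨key _ hv'.1, key _ hv'.2⟩

lemma subset_meshSupport_union (hL : 0 < L) (U : Finset Site) :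
    U ⊆ meshSupport L U ∪ cellInteriors L U := by
  classical
  intro x hx
  by_cases hxL : x ∈ mesh L
  · exact Finset.mem_union_left _ (Finset.mem_union_left _ (Finset.mem_filter.2 ⟨hx, hxL⟩))
  · exact Finset.mem_union_right _ (Finset.mem_biUnion.2 ⟨x, Finset.mem_filter.2 ⟨hx, hxL⟩,
      mem_openSquare_of_notMem_mesh hL hxL⟩)

lemma card_boundary_le (W : Finset Site) : (boundary W).card ≤ 4 * W.card := by
  rw [mul_comm]
  exact (Finset.card_le_card Finset.sdiff_subset).trans
    (Finset.card_biUnion_le_card_mul _ _ _ fun x _ => Finset.card_le_four)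

lemma card_meshSupport_le (U : Finset Site) :
    (meshSupport L U).card ≤ (1 + 4 * L ^ 2) * U.card := by
  classical
  have hsq : ∀ c : Site, (boundary (openSquare c L)).card ≤ 4 * L ^ 2 := by
    intro c
    refine (card_boundary_le _).trans (Nat.mul_le_mul_left _ ?_)
    rw [openSquare, Finset.card_product, Int.card_Ioo, Int.card_Ioo, sq]
    exact Nat.mul_le_mul (by omega) (by omega)
  refine (Finset.card_union_le _ _).trans ?_
  rw [add_mul, one_mul]
  refine add_le_add (Finset.card_le_card (Finset.filter_subset _ _)) ?_
  refine (Finset.card_biUnion_le_card_mul _ _ _ fun v _ => hsq _).trans ?_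
  rw [mul_comm]
  exact Nat.mul_le_mul_left _ (Finset.card_le_card (Finset.filter_subset _ _))

/-- The window sampler is exact. -/
theorem lintegral_windowProb {μ : Measure (Conf q)} (hμ : S.IsGibbs μ) (hL : 0 < L)
    (hord : IsOrdering L ord)
    (hscale : ∀ (Λ : Finset Site) (σ : Conf q) (v : Site), (Λ : Set Site) ⊆ mesh L →
      S.Feasible (Λ : Set Site) σ → v ∉ Λ → (ring L v).card * (1 - ∑ i, pMin S L Λ σ v i) ≤ 1 / 2)
    {U : Finset Site} (σ₀ : Conf q) {ws : List Site} (hws : ws.Nodup)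
    (hU : ws.toFinset = meshSupport L U) (ξ : Conf q) :
    ∫⁻ y, windowProb S L ord U ⟨∅, σ₀, 0⟩ ws ξ y ∂tape = μ (cyl U ξ) := by
  classical
  have := hμ.1
  have huniv : cyl ∅ σ₀ = Set.univ := Set.eq_univ_of_forall fun η x hx => by simp at hx
  have hwsL : ∀ v ∈ ws, v ∈ mesh L := fun v hv =>
    meshSupport_subset U (by rw [← hU]; simpa using hv)
  have key := lintegral_iSup_lazyListReturns hμ hL hord hscale hws hwsL (Λ := ∅) (by simp)
    (by simp) (σ := σ₀) (by simp [huniv])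
    (Φ := fun η => ENNReal.ofReal (S.spec (cellInteriors L U) η (cyl U ξ))) fun η => by
      rw [ENNReal.ofReal_le_one, SpinSystem.spec_eq_expect]
      refine (le_abs_self _).trans (SpinSystem.abs_expect_le zero_le_one fun ζ => ?_)
      by_cases h : ζ ∈ cyl U ξ <;> simp [h]
  rw [huniv, measure_univ, one_mul] at key
  refine key.trans ?_
  -- The sum is the integral under `μ` of the conditional probability given the spins on the mesh
  -- support, so consistency on the cell interiors returns the measure of the cylinder.
  rw [← setLIntegral_cyl μ (Finset.disjoint_empty_left _),
    hμ.setLIntegral_spec (Finset.disjoint_empty_left _) σ₀ (measurableSet_cyl U ξ), huniv,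
    Set.univ_inter]
  rw [Finset.empty_union, hU]
  simp_rw [SpinSystem.spec_eq_expect]
  intro η η' h
  refine congrArg ENNReal.ofReal (SpinSystem.expect_dependsOn'
    (boundary_cellInteriors_subset U) (SpinSystem.dependsOn_indicator fun ζ ζ' hζ => ?_) h)
  simp only [mem_cyl, eq_iff_iff]
  refine forall₂_congr fun x hx => ?_
  rw [hζ x (subset_meshSupport_union hL U hx)]

end LazySampling

/-! ### The main theorem -/

open LazySampling in
theorem mainTheorem1 {q : ℕ} (S : SpinSystem q) (hsoft : S.IsSoft)
    (hwsm : S.ExpWeakSpatialMixing) :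
    ∃ μ : Measure (Conf q), S.IsGibbs μ ∧ (∀ ν : Measure (Conf q), S.IsGibbs ν → ν = μ) ∧
      ∃ L₀ : ℕ, ∀ L : ℕ, L₀ < L → ∃ K : ℝ≥0,
        ∀ ord : Finset Site → Conf q → Site → List Site, IsOrdering L ord →
          (∀ (Λ : Finset Site) (σ : Conf q) (v : Site),
            (Λ : Set Site) ⊆ mesh L → S.Feasible (Λ : Set Site) σ → v ∈ mesh L → v ∉ Λ →
              (∀ᵐ y ∂tape, ∃ s, LazyReturns S L ord y ⟨Λ, σ, 0⟩ v s) ∧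
              (∀ i : Fin q,
                tape {y | ∃ s, LazyReturns S L ord y ⟨Λ, σ, 0⟩ v s ∧
                    s.known = insert v Λ ∧ s.spin = Function.update σ v i} =
                  ProbabilityTheory.cond μ {η | ∀ x ∈ Λ, η x = σ x} {η | η v = i}) ∧
              ∫⁻ y, callCount (LazyReturns S L ord y ⟨Λ, σ, 0⟩ v) ∂tape ≤ K) ∧
          (∀ (U : Finset Site) (σ₀ : Conf q) (ws : List Site),
            ws.Nodup → ws.toFinset = meshSupport L U →
              (∀ᵐ y ∂tape, ∃ s, LazyListReturns S L ord y ⟨∅, σ₀, 0⟩ ws s) ∧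
              (∀ ξ : Conf q, ∫⁻ y, windowProb S L ord U ⟨∅, σ₀, 0⟩ ws ξ y ∂tape =
                μ {η | ∀ x ∈ U, η x = ξ x}) ∧
              ∫⁻ y, callCount (LazyListReturns S L ord y ⟨∅, σ₀, 0⟩ ws) ∂tape ≤ K * U.card) := by
  obtain ⟨s₀, hb, hA, -⟩ := hsoft.exists_singleton_lower_bound
  have hgood : S.Good fun _ => s₀ := ⟨fun _ => hb, fun _ _ _ => hA _⟩
  obtain ⟨μ, hμ⟩ := SpinSystem.exists_isGibbs hgood
  obtain ⟨L₀, hL₀⟩ := SpinSystem.exists_scale hsoft hwsm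
  refine ⟨μ, hμ, fun ν hν => hwsm.gibbs_unique hν hμ, L₀, fun L hL => ?_⟩
  have hscale := hL₀ L hL
  have hL0 : 0 < L := by omega
  -- At most `2` expected calls per mesh site, and at most `1 + 4 L²` mesh sites for each site of
  -- the window.
  refine ⟨2 * (1 + 4 * L ^ 2), fun ord hord => ⟨fun Λ σ v hΛL hσ hvL hv => ?_,
    fun U σ₀ ws hws hU => ?_⟩⟩
  · have h0 := hμ.measure_cyl_pos hb hA hσ
    have hvL' : ∀ w ∈ [v], w ∈ mesh L := by simpa using hvL
    have hdisj : Disjoint Λ [v].toFinset := by simpa using hv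
    have hiff : ∀ y, LazyListReturns S L ord y ⟨Λ, σ, 0⟩ [v] = LazyReturns S L ord y ⟨Λ, σ, 0⟩ v :=
      fun y => funext fun s => propext lazyListReturns_singleton
    have h1 := ae_exists_lazyListReturns hμ hL0 hord hscale (List.nodup_singleton v) hvL' hΛL
      hdisj h0
    have h2 := lintegral_callCount_le hμ hL0 hord hscale (List.nodup_singleton v) hvL' hΛL
      hdisj h0
    simp_rw [hiff] at h1 h2
    refine ⟨h1, fun i => tape_lazyReturns hμ hL0 hord hscale hΛL h0 hvL hv i, h2.trans ?_⟩
    have : (2 : ℝ≥0) * 1 ≤ 2 * (1 + 4 * L ^ 2) := by gcongr; exact le_self_add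
    simpa using ENNReal.coe_le_coe.2 this
  · have := hμ.1
    have hwsL : ∀ v ∈ ws, v ∈ mesh L := fun v hv =>
      meshSupport_subset U (by rw [← hU]; simpa using hv)
    have huniv : cyl ∅ σ₀ = Set.univ := Set.eq_univ_of_forall fun η x hx => by simp at hx
    have h0 : μ (cyl ∅ σ₀) ≠ 0 := by simp [huniv]
    refine ⟨ae_exists_lazyListReturns hμ hL0 hord hscale hws hwsL (by simp) (by simp) h0,
      fun ξ => lintegral_windowProb hμ hL0 hord hscale σ₀ hws hU ξ,
      (lintegral_callCount_le hμ hL0 hord hscale hws hwsL (by simp) (by simp) h0).trans ?_⟩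
    rw [← List.toFinset_card_of_nodup hws, hU]
    have h := Nat.mul_le_mul_left 2 (card_meshSupport_le (L := L) U)
    calc (2 : ℝ≥0∞) * (meshSupport L U).card = ((2 * (meshSupport L U).card : ℕ) : ℝ≥0∞) := by
          push_cast; rfl
      _ ≤ ((2 * ((1 + 4 * L ^ 2) * U.card) : ℕ) : ℝ≥0∞) := by exact_mod_cast h
      _ = _ := by push_cast; ring
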